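/- Let $n\ge 1$, and equip $\mathbb{R}^{2n+1}=\mathbb{C}^n\times\mathbb{R}$, with coordinates $(x_1,y_1,\dots,x_n,y_n,z)$ and the corresponding orientation, with the contact form $\alpha=dz-\sum_j y_j\,dx_j$, whose Reeb field is $\partial_z$; put $\omega=\sum_j dx_j\wedge dy_j$ and let $\Pi_{\mathbb C}:\mathbb{R}^{2n+1}\to\mathbb{C}^n$ forget $z$. Let $L\subset\mathbb{R}^{2n+1}$ be a compact (boundaryless), connected, orientable Legendrian submanifold that is chord generic, i.e. the self-intersection of $\Pi_{\mathbb C}(L)$ consists of finitely many transverse double points. Let $\mathcal{C}$ be the (finite) set of Reeb chords of $L$. For $c\in\mathcal{C}$ with end points $a,b\in L$, $z(a)>z(b)$, choose a path $\gamma_c$ in $L$ from $a$ to $b$, and put $V_0=d\Pi_{\mathbb C}(T_aL)$ and $V_1=d\Pi_{\mathbb C}(T_bL)$. The Conley–Zehnder index $\nu_{\gamma_c}(c)\in\mathbb{Z}$ is the Maslov index of the loop of Lagrangian subspaces of $(\mathbb{C}^n,\omega)$ formed by the path $t\mapsto d\Pi_{\mathbb C}(T_{\gamma_c(t)}L)$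 from $V_0$ to $V_1$ followed by $t\mapsto e^{tI}V_1$, $0\le t\le\pi/2$, where $I$ is any complex structure on $\mathbb{C}^n$ compatible with $\omega$ with $I(V_1)=V_0$ (the index does not depend on $I$). Put $|c|=\nu_{\gamma_c}(c)-1$. Let $\mathrm{tb}(L)$ be the linking number of $L$ (with any orientation) with its push-off by a small positive time along $\partial_z$, i.e. the algebraic intersection number with the push-off of an $(n+1)$-chain with boundary $L$. Then, for every choice of the paths $\gamma_c$, $$\mathrm{tb}(L)=(-1)^{\frac{(n-2)(n-1)}{2}}\sum_{c\in\mathcal{C}}(-1)^{|c|}.$$ -/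

import Mathlib

open scoped ContDiff Topology

noncomputable section

namespace LegendrianTB

/-! ### Standard contact space -/

/-- `ℂⁿ`, with coordinates `x_j + i y_j`, as a real vector space. -/
abbrev Cn (n : ℕ) : Type := Fin n → ℂ

/-- `ℝ^{2n+1} = ℂⁿ × ℝ`, with coordinates `((x_j + i y_j)_j, z)`. The first projection is the
Lagrangian projection `Π_ℂ`. -/
abbrev Space (n : ℕ) : Type := Cn n × ℝ

/-- The contact form `α = dz - ∑ y_j dx_j` at the point `p`, applied to the vector `v`. -/
def contactForm {n : ℕ} (p v : Space n) : ℝ :=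
  v.2 - ∑ j, (p.1 j).im * (v.1 j).re

/-- The symplectic form `ω = ∑ dx_j ∧ dy_j` on `ℂⁿ`; it is also `dα` (pulled back by `Π_ℂ`). -/
def symplecticForm {n : ℕ} (u v : Cn n) : ℝ :=
  ∑ j, ((u j).re * (v j).im - (u j).im * (v j).re)

/-- The Reeb vector field `∂_z` of `α` (a constant vector field; its time `t` flow is the
translation by `t • reebField`). -/
def reebField {n : ℕ} : Space n := (0, 1)

/-- The defining property of the Reeb field: `α(∂_z) = 1` and `dα(∂_z, ·) = 0`. -/
theorem reebField_spec {n : ℕ} (p v : Space n) :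
    contactForm p (reebField : Space n) = 1 ∧
      symplecticForm (reebField : Space n).1 v.1 = 0 := by
  simp [contactForm, symplecticForm, reebField]

/-- The coordinates of a vector of `ℝ^{2n+1}` in the order `x_1, y_1, …, x_n, y_n, z`. -/
def coords {n : ℕ} (v : Space n) (k : Fin (n + n + 1)) : ℝ :=
  if h : k.val / 2 < n then
    (if k.val % 2 = 0 then (v.1 ⟨k.val / 2, h⟩).re else (v.1 ⟨k.val / 2, h⟩).im)
  else v.2

/-- The determinant of `2n+1` vectors of `ℝ^{2n+1}` in the coordinates
`x_1, y_1, …, x_n, y_n, z`. The vectors form a positively oriented basis iff it is positive. -/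
def orientDet {n : ℕ} (w : Fin (n + n + 1) → Space n) : ℝ :=
  Matrix.det (Matrix.of fun i k => coords (w i) k)

/-! ### Submanifolds and Legendrian submanifolds -/

/-- `L` is an `n`-dimensional smooth (embedded, boundaryless) submanifold of `ℝ^{2n+1}`:
around each of its points there is a smooth slice chart. -/
def IsSubmanifold {n : ℕ} (L : Set (Space n)) : Prop :=
  ∀ p ∈ L, ∃ Φ : OpenPartialHomeomorph (Space n) ((Fin n → ℝ) × (Fin (n + 1) → ℝ)),
    p ∈ Φ.source ∧ ContDiffOn ℝ ∞ Φ Φ.source ∧ ContDiffOn ℝ ∞ Φ.symm Φ.target ∧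
      ∀ x ∈ Φ.source, x ∈ L ↔ (Φ x).2 = 0

/-- The tangent space `T_pL`: (the span of) the velocities at `p` of curves in `L`. -/
def tangentSpaceAt {n : ℕ} (L : Set (Space n)) (p : Space n) : Submodule ℝ (Space n) :=
  Submodule.span ℝ {v | ∃ c : ℝ → Space n,
    c 0 = p ∧ (∀ᶠ t in 𝓝 (0 : ℝ), c t ∈ L) ∧ HasDerivAt c v 0}

/-- An `n`-dimensional submanifold everywhere tangent to the contact structure `ker α`. -/
structure IsLegendrian {n : ℕ} (L : Set (Space n)) : Prop where
  submanifold : IsSubmanifold L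
  tangent : ∀ p ∈ L, ∀ v ∈ tangentSpaceAt L p, contactForm p v = 0

/-- The image `dΠ_ℂ(T_pL)` in `ℂⁿ`. -/
def projTangent {n : ℕ} (L : Set (Space n)) (p : Space n) : Submodule ℝ (Cn n) :=
  (tangentSpaceAt L p).map (LinearMap.fst ℝ (Cn n) ℝ)

/-- A Reeb chord of `L`: a segment of positive length of a flow line of the Reeb field that
starts (`lower`) and ends (`upper`) on `L`. -/
@[ext]
structure ReebChord {n : ℕ} (L : Set (Space n)) where
  upper : L
  lower : L
  flow : ∃ T : ℝ, 0 < T ∧ (upper : Space n) = (lower : Space n) + T • reebField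

/-- `L` is chord generic: the self-intersection of `Π_ℂ(L)` consists of finitely many
transverse double points. -/
structure IsChordGeneric {n : ℕ} (L : Set (Space n)) : Prop where
  finite : {w : Cn n | ∃ a ∈ L, ∃ b ∈ L, a ≠ b ∧ a.1 = w ∧ b.1 = w}.Finite
  double : ∀ a ∈ L, ∀ b ∈ L, ∀ c ∈ L, a.1 = b.1 → b.1 = c.1 → a = b ∨ b = c ∨ a = c
  transverse : ∀ a ∈ L, ∀ b ∈ L, a ≠ b → a.1 = b.1 → projTangent L a ⊔ projTangent L b = ⊤

/-! ### Orientations, linking numbers, the Thurston–Bennequin invariant -/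

/-- A field of alternating `n`-forms on `ℝ^{2n+1}` (only its restriction to the tangent spaces
of a submanifold is used). -/
abbrev FormField (n : ℕ) : Type := Space n → (Space n) [⋀^Fin n]→L[ℝ] ℝ

/-- `τ` orients the `n`-dimensional submanifold `L`: it is a continuous `n`-form along `L` that
restricts to a nonzero top form on every tangent space of `L`. -/
structure IsOrientation {n : ℕ} (L : Set (Space n)) (τ : FormField n) : Prop where
  continuousOn : ContinuousOn τ L
  nonvanishing : ∀ p ∈ L, ∀ v : Fin n → Space n,
    (∀ i, v i ∈ tangentSpaceAt L p) → LinearIndependent ℝ v → τ p v ≠ 0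

/-- `L` is orientable. -/
def IsOrientable {n : ℕ} (L : Set (Space n)) : Prop := ∃ τ, IsOrientation L τ

/-- `v` is a positively oriented basis of `T_pL`, for `L` oriented by `τ`. -/
def IsPositiveFrame {n : ℕ} (L : Set (Space n)) (τ : FormField n) (p : Space n)
    (v : Fin n → Space n) : Prop :=
  (∀ i, v i ∈ tangentSpaceAt L p) ∧ 0 < τ p v

/-- `F` is an `(n+1)`-chain bounded by `K`, in the form of a smooth singular cone on `K`: a
smooth map on `K × [0,1]` that is the inclusion of `K` at time `0` and constant, equal to `q`, at
time `1`. (A smooth map on `K × [0,1]`, with `K` a compact submanifold, is the restriction of a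
smooth map of the ambient vector space.) -/
structure IsCone {n : ℕ} (K : Set (Space n)) (F : Space n × ℝ → Space n) (q : Space n) :
    Prop where
  smooth : ContDiff ℝ ∞ F
  base : ∀ p ∈ K, F (p, 0) = p
  apex : ∀ p ∈ K, F (p, 1) = q

/-- The parameters `(p, s)` of the intersection points of the chain `F` on `K` with `J`. -/
def intersections {n : ℕ} (K J : Set (Space n)) (F : Space n × ℝ → Space n) :
    Set (Space n × ℝ) :=
  {x | x.1 ∈ K ∧ x.2 ∈ Set.Icc (0 : ℝ) 1 ∧ F x ∈ J}

/-- The chain `F` on `(K, τ)` meets `(J, σ)` transversely at the parameter `x = (p, s)`, with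
local intersection number `δ = ±1`: the tangent space of the chain followed by that of `J` is a
basis of `ℝ^{2n+1}` whose orientation is the sign `δ`. The orientation of the chain is the one for
which `K` is its oriented boundary (outward normal first; at `s = 0` the outward normal is
`-∂/∂s`). -/
def IsLocalIntersectionNumber {n : ℕ} (K : Set (Space n)) (τ : FormField n)
    (J : Set (Space n)) (σ : FormField n) (F : Space n × ℝ → Space n)
    (x : Space n × ℝ) (δ : ℤ) : Prop :=
  (δ = 1 ∨ δ = -1) ∧
    ∀ e f : Fin n → Space n, IsPositiveFrame K τ x.1 e → IsPositiveFrame J σ (F x) f →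
      0 < (δ : ℝ) * orientDet (Fin.cons (fderiv ℝ F x (0, -1))
        (Fin.append (fun i => fderiv ℝ F x (e i, 0)) f))

/-- `N` is a linking number of the disjoint oriented submanifolds `(K, τ)` and `(J, σ)`: the
algebraic intersection number with `J` of some chain with boundary `K` that is transverse to
`J`. -/
def HasLinkingNumber {n : ℕ} (K : Set (Space n)) (τ : FormField n)
    (J : Set (Space n)) (σ : FormField n) (N : ℤ) : Prop :=
  Disjoint K J ∧ ∃ (F : Space n × ℝ → Space n) (q : Space n) (S : Finset (Space n × ℝ))
    (δ : Space n × ℝ → ℤ),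
    IsCone K F q ∧ q ∉ J ∧ (S : Set (Space n × ℝ)) = intersections K J F ∧
      (∀ x ∈ S, IsLocalIntersectionNumber K τ J σ F x (δ x)) ∧ N = ∑ x ∈ S, δ x

/-- `L` pushed off itself by time `ε` along the Reeb field. -/
def pushOff {n : ℕ} (ε : ℝ) (L : Set (Space n)) : Set (Space n) :=
  (fun p => p + ε • reebField) '' L

/-- The orientation of the push-off. -/
def pushOffForm {n : ℕ} (ε : ℝ) (τ : FormField n) : FormField n :=
  fun p => τ (p - ε • reebField)

/-- `tb(L) = N`: `L` is orientable and, for every orientation of `L` and all sufficiently small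
`ε > 0`, the linking number of `L` and its push-off by `ε` along the Reeb field is well defined
(some transverse chain computes it, and all of them give the same value) and equal to `N`. -/
def HasThurstonBennequin {n : ℕ} (L : Set (Space n)) (N : ℤ) : Prop :=
  IsOrientable L ∧ ∀ τ, IsOrientation L τ → ∀ᶠ ε in 𝓝[>] (0 : ℝ), ∀ m : ℤ,
    HasLinkingNumber L τ (pushOff ε L) (pushOffForm ε τ) m ↔ m = N

/-! ### Maslov and Conley–Zehnder indices -/

/-- Lagrangian subspaces of `(ℂⁿ, ω)`. -/
def IsLagrangian {n : ℕ} (V : Submodule ℝ (Cn n)) : Prop :=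
  Module.finrank ℝ V = n ∧ ∀ u ∈ V, ∀ v ∈ V, symplecticForm u v = 0

/-- The Maslov index of the (continuous) loop `Γ : [0,1] → Λ_n` of Lagrangian subspaces is `m`:
`m` is the winding number of `det² Γ : [0,1] → S¹`, where `det² V = (det v)² / |det v|²` for any
real basis `v` of `V`. Here `θ` is a continuous argument of `det² Γ`. -/
def HasMaslovIndex {n : ℕ} (Γ : ℝ → Submodule ℝ (Cn n)) (m : ℤ) : Prop :=
  (∀ t ∈ Set.Icc (0 : ℝ) 1, IsLagrangian (Γ t)) ∧ Γ 0 = Γ 1 ∧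
    ∃ θ : ℝ → ℝ, ContinuousOn θ (Set.Icc 0 1) ∧
      (∀ t ∈ Set.Icc (0 : ℝ) 1, ∀ v : Fin n → Cn n, (∀ i, v i ∈ Γ t) →
        LinearIndependent ℝ v →
          (Matrix.of v).det ^ 2 = (‖(Matrix.of v).det‖ : ℂ) ^ 2 * Complex.exp (θ t * Complex.I)) ∧
      θ 1 - θ 0 = 2 * Real.pi * m

/-- Complex structures on the real vector space `ℂⁿ` that are compatible with `ω`. -/
structure IsCompatible {n : ℕ} (I : Cn n →ₗ[ℝ] Cn n) : Prop where
  sq : ∀ v, I (I v) = -v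
  symplectic : ∀ u v, symplecticForm (I u) (I v) = symplecticForm u v
  pos : ∀ v, v ≠ 0 → 0 < symplecticForm v (I v)

/-- The path `t ↦ e^{tI} V`, where `e^{tI} = cos t + (sin t) I`. -/
def rotate {n : ℕ} (I : Cn n →ₗ[ℝ] Cn n) (V : Submodule ℝ (Cn n)) (t : ℝ) :
    Submodule ℝ (Cn n) :=
  V.map (Real.cos t • LinearMap.id + Real.sin t • I)

/-- The path `t ↦ dΠ_ℂ(T_{γ(t)}L)` along the capping path `γ`, from the upper to the lower end
of the chord, followed by `t ↦ e^{tI} V₁`, `0 ≤ t ≤ π/2`, with `V₁` the projected tangent space at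
the lower end. -/
def cappedPath {n : ℕ} {L : Set (Space n)} (c : ReebChord L) (γ : Path c.upper c.lower)
    (I : Cn n →ₗ[ℝ] Cn n) (t : ℝ) : Submodule ℝ (Cn n) :=
  if t ≤ 1 / 2 then projTangent L (γ.extend (2 * t) : L)
  else rotate I (projTangent L (c.lower : Space n)) (Real.pi / 2 * (2 * t - 1))

/-- `ν_γ(c) = m`: for some compatible complex structure `I` on `ℂⁿ` with `I V₁ = V₀`, where `V₀`
and `V₁` are the projected tangent spaces at the upper and the lower end of `c`, the loop obtained
by closing up the path of tangent spaces along `γ` with `e^{tI} V₁` has Maslov index `m`. -/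
def HasConleyZehnderIndex {n : ℕ} {L : Set (Space n)} (c : ReebChord L)
    (γ : Path c.upper c.lower) (m : ℤ) : Prop :=
  ∃ I : Cn n →ₗ[ℝ] Cn n, IsCompatible I ∧
    (projTangent L (c.lower : Space n)).map I = projTangent L (c.upper : Space n) ∧
      HasMaslovIndex (cappedPath c γ I) m

end LegendrianTB

end

open LegendrianTB

/-!
The local contribution of a Reeb chord to the Thurston–Bennequin invariant and the parity of its
Conley–Zehnder index are the same orientation comparison of the two Lagrangian planes at its ends.

*The linking number as a sum over chords.* The cone `reebCone` pushes `L` down along the Reeb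
flow, and contracts it only after it has left the slab of the push-off. It meets the push-off of
`L` exactly once for every Reeb chord, where the upper end has been moved to the push-off of the
lower end (`eventually_hasLinkingNumber`). The sign of this intersection is the orientation of the
Reeb direction followed by positive frames of the tangent spaces at the upper and the lower end.

*Independence of the cone.* The intersection number of a cone `F` on `K` with `J` is the degree
over `0` of the map `(p, y, s) ↦ F (p, s) - y` on `K × J × [0, 1]`. It is expressed as the
integral of the pullback of `φ · vol` for a bump function `φ` near `0`
(`exists_degIntegral_gapMap_eq`). By Stokes' theorem, applied chart by chart, the integral does
not change when one cone is deformed to another (`degIntegral_gapMap_eq`): at `s = 0` the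
deformation is constant, and at `s = 1` both cones are constant along `K`, so that the Jacobian of
the deformation degenerates. Together they give `HasLinkingNumber.unique`.

*The sign of a chord.* Let `V₀` and `V₁` be the projected tangent spaces at the upper and the
lower end, and let `I` be a compatible complex structure with `I V₁ = V₀`. For a frame `v` of
`V₁`, the orientation of the basis `I v, v` of `ℝ²ⁿ` is found by multiplying with `i v*`, which
makes it block triangular, the diagonal blocks being the matrices of the symplectic form between
`I v` and `v` and of the metric on `v`, both definite (`det_fromBlocks_re_im`,
`orientDet_pos_of_compatible`). With the sign of the permutation from `x₁, y₁, …, xₙ, yₙ` to `x₁,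
…, xₙ, y₁, …, yₙ`, the result is `(-1) ^ (n (n + 1) / 2)`. The frame `I v` need not be positive at
the upper end.

*The parity of the index.* On an oriented Legendrian submanifold, the complex determinant of a
projected frame is a continuous nowhere vanishing function times the orientation form
(`IsLegendrian.exists_phase`). A continuous argument of the determinant along the capping path
followed by the rotation `e ^ (tI) V₁` therefore changes by `π` times the Maslov index, and this
integer is even iff `I` maps positive frames of `V₁` to positive frames of `V₀`
(`exists_hasMaslovIndex`). The same lift, over the segment between two compatible complex
structures, shows that the index does not depend on `I`.
-/

noncomputable section
namespace LegendrianTB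

/-! ### Homotopy invariance of the degree integral on a box -/

open MeasureTheory Set

/-- The standard volume form of `ℝᴺ`. -/
def volForm (N : ℕ) : (Fin N → ℝ) [⋀^Fin N]→L[ℝ] ℝ :=
  { (Matrix.detRowAlternating : (Fin N → ℝ) [⋀^Fin N]→ₗ[ℝ] ℝ) with
    cont := by
      change Continuous fun v : Fin N → Fin N → ℝ => Matrix.det (Matrix.of v)
      exact Continuous.matrix_det continuous_id }

theorem volForm_apply {N : ℕ} (v : Fin N → Fin N → ℝ) :
    volForm N v = (Matrix.of v).det := rfl

theorem volForm_comp {N : ℕ} (T : (Fin N → ℝ) →L[ℝ] (Fin N → ℝ)) :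
    volForm N (fun i => T (Pi.single i 1)) = T.det := by
  rw [volForm_apply, ← Matrix.det_transpose, ContinuousLinearMap.det, ← LinearMap.det_toMatrix']
  congr 1

theorem volForm_eq_zero_of_parallel {N : ℕ} (v : Fin N → Fin N → ℝ) {i j : Fin N} (hij : i ≠ j)
    {d : Fin N → ℝ} {a b : ℝ} (hi : v i = a • d) (hj : v j = b • d) : volForm N v = 0 := by
  have h1 : v = Function.update (Function.update v i (a • d)) j (b • d) := by
    rw [← hi, Function.update_eq_self, ← hj, Function.update_eq_self]
  rw [h1, ContinuousAlternatingMap.map_update_smul, Function.update_comm hij,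
    ContinuousAlternatingMap.map_update_smul]
  rw [(volForm N).map_eq_zero_of_eq (i := i) (j := j) _ _ hij]
  · simp
  · simp [Function.update_of_ne hij.symm]

theorem volForm_eq_zero_of_row {N : ℕ} (v : Fin N → Fin N → ℝ) {i : Fin N} (hi : v i = 0) :
    volForm N v = 0 := (volForm N).map_coord_zero i hi

/-- The pullback of the top form `φ · vol` under `h`. -/
def pullbackTop {N : ℕ} {E : Type*} [NormedAddCommGroup E] [NormedSpace ℝ E]
    (φ : (Fin N → ℝ) → ℝ) (h : E → Fin N → ℝ) (x : E) : E [⋀^Fin N]→L[ℝ] ℝ :=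
  (φ (h x) • volForm N).compContinuousLinearMap (fderiv ℝ h x)

theorem pullbackTop_apply {N : ℕ} {E : Type*} [NormedAddCommGroup E] [NormedSpace ℝ E]
    (φ : (Fin N → ℝ) → ℝ) (h : E → Fin N → ℝ) (x : E) (v : Fin N → E) :
    pullbackTop φ h x v = φ (h x) * volForm N (fun i => fderiv ℝ h x (v i)) := rfl

/-- The pullback of a top form is closed: exterior derivatives commute with pullbacks, and there are
no nonzero alternating forms of degree `N + 1` on `ℝᴺ`. -/
theorem extDeriv_pullbackTop {N : ℕ} {E : Type*} [NormedAddCommGroup E] [NormedSpace ℝ E]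
    {φ : (Fin N → ℝ) → ℝ} (hφ : ContDiff ℝ ∞ φ) {h : E → Fin N → ℝ} (hh : ContDiff ℝ ∞ h)
    (x : E) : extDeriv (pullbackTop φ h) x = 0 := by
  have hd : DifferentiableAt ℝ (fun y => φ y • volForm N) (h x) :=
    ((hφ.differentiable (by simp)) _).smul_const _
  have h1 := extDeriv_pullback (𝕜 := ℝ) (r := ∞) (x := x) (f := h) hd hh.contDiffAt
    (by
      rw [minSmoothness_of_isRCLikeNormedField]
      exact WithTop.coe_le_coe.2 (le_top : (2 : ℕ∞) ≤ ⊤))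
  change extDeriv (fun x => ((fun y => φ y • volForm N) (h x)).compContinuousLinearMap
    (fderiv ℝ h x)) x = 0
  rw [h1]
  have h2 : extDeriv (fun y => φ y • volForm N) (h x) = 0 := by
    ext v
    apply AlternatingMap.map_linearDependent
      (extDeriv (fun y => φ y • volForm N) (h x)).toAlternatingMap v
    intro hv
    have := hv.fintype_card_le_finrank
    simp at this
  rw [h2]
  ext v
  simp

theorem contDiff_pullbackTop_apply {N : ℕ} {E : Type*} [NormedAddCommGroup E] [NormedSpace ℝ E]
    {φ : (Fin N → ℝ) → ℝ} (hφ : ContDiff ℝ ∞ φ) {h : E → Fin N → ℝ} (hh : ContDiff ℝ ∞ h)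
    (v : Fin N → E) : ContDiff ℝ ∞ fun x => pullbackTop φ h x v := by
  simp only [pullbackTop_apply]
  refine (hφ.comp hh).mul ?_
  have : ContDiff ℝ ∞ (volForm N) := (volForm N).toContinuousMultilinearMap.contDiff
  refine this.comp ?_
  rw [contDiff_pi]
  intro i
  exact (hh.fderiv_right (m := ∞) (by simp)).clm_apply contDiff_const

theorem differentiableAt_pullbackTop {N : ℕ} {E : Type*} [NormedAddCommGroup E] [NormedSpace ℝ E]
    {φ : (Fin N → ℝ) → ℝ} (hφ : ContDiff ℝ ∞ φ) {h : E → Fin N → ℝ} (hh : ContDiff ℝ ∞ h)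
    (x : E) : DifferentiableAt ℝ (pullbackTop φ h) x := by
  unfold pullbackTop
  apply DifferentiableAt.continuousAlternatingMapCompContinuousLinearMap
  · exact (((hφ.comp hh).differentiable (by simp)) _).smul_const _
  · exact ((hh.fderiv_right (m := ∞) (by simp)).differentiable (by simp)) _

/-- Stokes' theorem for the closed form `h^*(φ · vol)` on a box. -/
theorem sum_face_integrals_eq_zero {N : ℕ} {φ : (Fin N → ℝ) → ℝ} (hφ : ContDiff ℝ ∞ φ)
    {h : (Fin (N + 1) → ℝ) → Fin N → ℝ} (hh : ContDiff ℝ ∞ h) {a b : Fin (N + 1) → ℝ}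
    (hab : a ≤ b) :
    ∑ i : Fin (N + 1),
      ((∫ x in Icc (a ∘ i.succAbove) (b ∘ i.succAbove),
          (-1) ^ (i : ℕ) * pullbackTop φ h (i.insertNth (b i) x)
            (i.removeNth fun k => (Pi.single k 1 : Fin (N + 1) → ℝ))) -
        ∫ x in Icc (a ∘ i.succAbove) (b ∘ i.succAbove),
          (-1) ^ (i : ℕ) * pullbackTop φ h (i.insertNth (a i) x)
            (i.removeNth fun k => (Pi.single k 1 : Fin (N + 1) → ℝ))) = 0 := by
  have hd : ∀ i : Fin (N + 1), ContDiff ℝ ∞ fun x => (-1) ^ (i : ℕ) * pullbackTop φ h x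
            (i.removeNth fun k => (Pi.single k 1 : Fin (N + 1) → ℝ)) := fun i =>
    contDiff_const.mul (contDiff_pullbackTop_apply hφ hh _)
  have hz : ∀ x : Fin (N + 1) → ℝ, ∑ i : Fin (N + 1),
      fderiv ℝ (fun x => (-1) ^ (i : ℕ) * pullbackTop φ h x
            (i.removeNth fun k => (Pi.single k 1 : Fin (N + 1) → ℝ))) x (Pi.single i 1) = 0 := by
    intro x
    have h1 := extDeriv_apply (differentiableAt_pullbackTop hφ hh x)
      (fun k => (Pi.single k 1 : Fin (N + 1) → ℝ))
    rw [extDeriv_pullbackTop hφ hh] at h1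
    change (0 : ℝ) = _ at h1
    rw [h1]
    refine Finset.sum_congr rfl fun i _ => ?_
    rw [fderiv_const_mul]
    · simp
    · exact ((contDiff_pullbackTop_apply hφ hh _).differentiable (by simp)) _
  have := integral_divergence_of_hasFDerivAt_off_countable' a b hab
    (fun i x => (-1) ^ (i : ℕ) * pullbackTop φ h x
            (i.removeNth fun k => (Pi.single k 1 : Fin (N + 1) → ℝ)))
    (fun i x => fderiv ℝ (fun x => (-1) ^ (i : ℕ) * pullbackTop φ h x
            (i.removeNth fun k => (Pi.single k 1 : Fin (N + 1) → ℝ))) x) ∅ countable_empty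
    (fun i => (hd i).continuous.continuousOn)
    (fun x _ i => (((hd i).differentiable (by simp)) x).hasFDerivAt)
    (by simp only [hz]; exact integrableOn_zero)
  rw [← this]
  simp [hz]

/-- The integrand of the degree: the density of `h^*(φ · vol)`. -/
def degDensity {N : ℕ} (φ : (Fin N → ℝ) → ℝ) (h : (Fin N → ℝ) → Fin N → ℝ) (x : Fin N → ℝ) : ℝ :=
  φ (h x) * (fderiv ℝ h x).det

/-- The degree integral over a box does not change along the linear homotopy `h + t • η`, if on
every face `η` vanishes or is parallel to a derivative of `h + t • η` along the face. -/
theorem integral_degDensity_add {N : ℕ} {φ : (Fin N → ℝ) → ℝ} (hφ : ContDiff ℝ ∞ φ)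
    {h η : (Fin N → ℝ) → Fin N → ℝ} (hh : ContDiff ℝ ∞ h) (hη : ContDiff ℝ ∞ η)
    {a b : Fin N → ℝ} (hab : a ≤ b)
    (hface : ∀ x ∈ Icc a b, ∀ i, (x i = a i ∨ x i = b i) → ∀ t : ℝ, η x = 0 ∨
      ∃ k ≠ i, ∃ (d : Fin N → ℝ) (r s : ℝ), η x = r • d ∧
        fderiv ℝ (h + t • η) x (Pi.single k 1) = s • d) :
    ∫ x in Icc a b, degDensity φ (h + η) x = ∫ x in Icc a b, degDensity φ h x := by
  -- the homotopy on the box `[0, 1] × [a, b]`, with time as the coordinate of index `0`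
  set H : (Fin (N + 1) → ℝ) → Fin N → ℝ := fun y => h (Fin.tail y) + y 0 • η (Fin.tail y) with hHdef
  have htail : ContDiff ℝ ∞ (fun y : Fin (N + 1) → ℝ => Fin.tail y) := by
    rw [contDiff_pi]; intro i; exact contDiff_apply ℝ ℝ _
  have hH : ContDiff ℝ ∞ H :=
    (hh.comp htail).add ((contDiff_apply ℝ ℝ _).smul (hη.comp htail))
  have hd0 : ∀ y, fderiv ℝ H y (Pi.single 0 1) = η (Fin.tail y) := by
    intro y
    have h1 : HasFDerivAt H (fderiv ℝ H y) y := ((hH.differentiable (by simp)) y).hasFDerivAt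
    have h2 : HasDerivAt (fun t : ℝ => y + t • (Pi.single 0 1 : Fin (N + 1) → ℝ))
        (Pi.single 0 1) 0 := by
      simpa using ((hasDerivAt_id (0 : ℝ)).smul_const (Pi.single 0 1 : Fin (N + 1) → ℝ)).const_add y
    have h3 := HasFDerivAt.comp_hasDerivAt (0 : ℝ) (f := fun t : ℝ => y + t • (Pi.single 0 1))
      (l := H) (l' := fderiv ℝ H y) (by simpa using h1) h2
    have h4 : (H ∘ fun t : ℝ => y + t • (Pi.single 0 1)) =
        fun t => h (Fin.tail y) + (y 0 + t) • η (Fin.tail y) := by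
      ext1 t
      have : Fin.tail (y + t • (Pi.single 0 1)) = Fin.tail y := by
        ext i; simp [Fin.tail]
      simp [hHdef, this]
    rw [h4] at h3
    refine h3.unique ?_
    simpa using (((hasDerivAt_id (0 : ℝ)).const_add (y 0)).smul_const (η (Fin.tail y))).const_add
      (h (Fin.tail y))
  have hds : ∀ (t : ℝ) (x : Fin N → ℝ) (k : Fin N), fderiv ℝ H (Fin.cons t x) (Pi.single k.succ 1) =
      fderiv ℝ (h + t • η) x (Pi.single k 1) := by
    intro t x k
    have h1 : HasFDerivAt H (fderiv ℝ H (Fin.cons t x)) (Fin.cons t x) :=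
      ((hH.differentiable (by simp)) _).hasFDerivAt
    have h2 : HasDerivAt (fun τ : ℝ => (Fin.cons t x : Fin (N + 1) → ℝ) +
        τ • (Pi.single k.succ 1 : Fin (N + 1) → ℝ)) (Pi.single k.succ 1) 0 := by
      simpa using ((hasDerivAt_id (0 : ℝ)).smul_const
        (Pi.single k.succ 1 : Fin (N + 1) → ℝ)).const_add (Fin.cons t x : Fin (N + 1) → ℝ)
    have h3 := HasFDerivAt.comp_hasDerivAt (0 : ℝ) (f := fun τ : ℝ =>
      (Fin.cons t x : Fin (N + 1) → ℝ) + τ • (Pi.single k.succ 1))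
      (l := H) (l' := fderiv ℝ H (Fin.cons t x)) (by simpa using h1) h2
    have hdiff : Differentiable ℝ (h + t • η) :=
      (hh.differentiable (by simp)).add ((hη.differentiable (by simp)).const_smul t)
    have h2' : HasDerivAt (fun τ : ℝ => x + τ • (Pi.single k 1 : Fin N → ℝ)) (Pi.single k 1) 0 := by
      simpa using ((hasDerivAt_id (0 : ℝ)).smul_const (Pi.single k 1 : Fin N → ℝ)).const_add x
    have h3' := HasFDerivAt.comp_hasDerivAt (0 : ℝ) (f := fun τ : ℝ => x + τ • (Pi.single k 1))
      (l := h + t • η) (l' := fderiv ℝ (h + t • η) x) (by simpa using (hdiff x).hasFDerivAt) h2'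
    refine h3.unique ?_
    convert! h3' using 1
    ext1 τ
    have e1 : Fin.tail ((Fin.cons t x : Fin (N + 1) → ℝ) + τ • (Pi.single k.succ 1)) =
        x + τ • (Pi.single k 1 : Fin N → ℝ) := by
      ext i; simp [Fin.tail, Pi.single_apply]
    have e2 : ((Fin.cons t x : Fin (N + 1) → ℝ) + τ • (Pi.single k.succ 1 : Fin (N + 1) → ℝ)) 0 =
        t := by
      simp
    simp only [Function.comp, hHdef, e1, e2, Pi.add_apply, Pi.smul_apply]
  -- in Stokes' theorem for `H`, the faces `t = 0` and `t = 1` give the two degree integrals, and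
  -- the other faces give zero
  have key := sum_face_integrals_eq_zero hφ hH (a := Fin.cons 0 a) (b := Fin.cons 1 b) (by
    intro i; refine Fin.cases ?_ (fun j => ?_) i
    · simp
    · simpa using hab j)
  rw [Fin.sum_univ_succ, Finset.sum_eq_zero (s := Finset.univ), add_zero] at key
  · have hc : ∀ (t : ℝ) (x : Fin N → ℝ), pullbackTop φ H (Fin.cons t x)
        ((0 : Fin (N + 1)).removeNth fun k => (Pi.single k 1 : Fin (N + 1) → ℝ)) = degDensity φ
            (h + t • η) x := by
      intro t x
      rw [pullbackTop_apply, degDensity, ← volForm_comp]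
      congr 1
      congr 1
      ext1 k
      exact hds t x k
    have e0 : ∀ (t : ℝ) (a : Fin N → ℝ), (Fin.cons t a : Fin (N + 1) → ℝ) ∘
        (0 : Fin (N + 1)).succAbove = a := by
      intro t a; ext i; simp
    simp only [e0, Fin.insertNth_zero', hc, Fin.val_zero, pow_zero, one_mul,
      Fin.cons_zero, zero_smul, add_zero, one_smul] at key
    linarith
  · intro j _
    have hv : ∀ (t : ℝ) (z : Fin N → ℝ), (z j = a j ∨ z j = b j) → z ∈ Icc a b →
        pullbackTop φ H (Fin.cons t z)
            (j.succ.removeNth fun k => (Pi.single k 1 : Fin (N + 1) → ℝ)) = 0 := by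
      intro t z hz hmem
      rw [pullbackTop_apply]
      -- the index `i₀` of the row `∂_t H = η`
      obtain ⟨i0, hi0⟩ := Fin.exists_succAbove_eq (x := (0 : Fin (N + 1))) (y := j.succ)
          (Fin.succ_ne_zero j).symm
      have r0 : fderiv ℝ H (Fin.cons t z) (j.succ.removeNth (fun k => (Pi.single k 1 :
          Fin (N + 1) → ℝ)) i0) = η z := by
        simp only [Fin.removeNth, hi0, hd0]; rfl
      rcases hface z hmem j hz t with h0 | ⟨k, hk, d, r, s, hd1, hd2⟩
      · rw [volForm_eq_zero_of_row _ (i := i0) (by rw [r0, h0]), mul_zero]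
      · obtain ⟨i1, hi1⟩ := Fin.exists_succAbove_eq (x := k.succ) (y := j.succ)
          (by simpa using hk)
        rw [volForm_eq_zero_of_parallel _ (i := i0) (j := i1) (d := d) (a := r) (b := s), mul_zero]
        · rintro rfl
          rw [hi0] at hi1
          exact (Fin.succ_ne_zero k) hi1.symm
        · rw [r0, hd1]
        · simp only [Fin.removeNth, hi1]
          rw [hds, hd2]
    have hface0 : ∀ c : ℝ, (c = a j ∨ c = b j) → a j ≤ c → c ≤ b j →
        ∫ x in Icc ((Fin.cons 0 a : Fin (N + 1) → ℝ) ∘ j.succ.succAbove)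
          ((Fin.cons 1 b : Fin (N + 1) → ℝ) ∘ j.succ.succAbove),
          (-1) ^ (j.succ : ℕ) * pullbackTop φ H (j.succ.insertNth c x)
            (j.succ.removeNth fun k => (Pi.single k 1 : Fin (N + 1) → ℝ)) = 0 := by
      intro c hc hc1 hc2
      rw [setIntegral_eq_zero_of_forall_eq_zero]
      intro x hx
      set y : Fin (N + 1) → ℝ := j.succ.insertNth c x with hy
      have hyj : y j.succ = c := by simp [hy]
      have hys : ∀ i, y (j.succ.succAbove i) = x i := by intro i; simp [hy]
      have hmem : ∀ k : Fin N, a k ≤ y k.succ ∧ y k.succ ≤ b k := by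
        intro k
        by_cases hkj : k = j
        · subst hkj; rw [hyj]; exact ⟨hc1, hc2⟩
        · obtain ⟨i, hi⟩ := Fin.exists_succAbove_eq (x := k.succ) (y := j.succ) (by simpa using hkj)
          have h1 := hx.1 i
          have h2 := hx.2 i
          simp only [Function.comp, hi, Fin.cons_succ] at h1 h2
          rw [← hi, hys]; exact ⟨h1, h2⟩
      rw [← Fin.cons_self_tail y, hv (y 0) (Fin.tail y) (by simpa [Fin.tail, hyj] using hc)
        ⟨fun k => (hmem k).1, fun k => (hmem k).2⟩, mul_zero]
    simp only [Fin.cons_succ]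
    rw [hface0 (b j) (Or.inr rfl) (hab j) le_rfl, hface0 (a j) (Or.inl rfl) le_rfl (hab j),
        sub_zero]

end LegendrianTB
end

noncomputable section
namespace LegendrianTB

/-! ### Oriented atlases and integration of densities -/

open MeasureTheory Set

/-- A finite oriented atlas of a subset `M` of `E` modelled on `X`, together with a smooth
partition of unity subordinate to it. The parametrization `par i` is smooth on all of `X`, but
parametrizes `M ∩ cod i` only on the open set `dom i`; its inverse is the restriction of the
ambient map `coord i`. The orientation is recorded by the signs `sign i = ±1`: the transition map
from `i` to `j` has a Jacobian of the sign `sign i * sign j`. -/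
structure OrientedAtlas (ι X E : Type*) [Fintype ι] [NormedAddCommGroup X] [NormedSpace ℝ X]
    [NormedAddCommGroup E] [NormedSpace ℝ E] (M : Set E) where
  dom : ι → Set X
  cod : ι → Set E
  par : ι → X → E
  coord : ι → E → X
  weight : ι → E → ℝ
  sign : ι → ℝ
  isOpen_dom : ∀ i, IsOpen (dom i)
  isOpen_cod : ∀ i, IsOpen (cod i)
  contDiff_par : ∀ i, ContDiff ℝ ∞ (par i)
  contDiffOn_coord : ∀ i, ContDiffOn ℝ ∞ (coord i) (cod i)
  par_mem : ∀ i, ∀ x ∈ dom i, par i x ∈ M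
  par_mem_cod : ∀ i, ∀ x ∈ dom i, par i x ∈ cod i
  coord_par : ∀ i, ∀ x ∈ dom i, coord i (par i x) = x
  coord_mem : ∀ i, ∀ p ∈ M, p ∈ cod i → coord i p ∈ dom i
  par_coord : ∀ i, ∀ p ∈ M, p ∈ cod i → par i (coord i p) = p
  contDiff_weight : ∀ i, ContDiff ℝ ∞ (weight i)
  weight_mem : ∀ i p, weight i p ∈ Icc (0 : ℝ) 1
  tsupport_weight : ∀ i, tsupport (weight i) ⊆ cod i
  sum_weight : ∀ p ∈ M, ∑ i, weight i p = 1
  sign_eq : ∀ i, sign i = 1 ∨ sign i = -1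
  sign_compat : ∀ i j, ∀ x ∈ dom i, par i x ∈ cod j →
    0 < sign i * sign j * (fderiv ℝ (coord j ∘ par i) x).det

namespace OrientedAtlas

variable {ι E : Type*} [Fintype ι] [NormedAddCommGroup E] [NormedSpace ℝ E] {M : Set E}

section Basic

variable {X : Type*} [NormedAddCommGroup X] [NormedSpace ℝ X] (A : OrientedAtlas ι X E M)
include A

theorem exists_mem_cod {p : E} (hp : p ∈ M) : ∃ i, p ∈ A.cod i := by
  by_contra! h
  have h1 := A.sum_weight p hp
  rw [Finset.sum_eq_zero] at h1
  · norm_num at h1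
  · intro i _
    by_contra h2
    exact h i (A.tsupport_weight i (subset_tsupport _ h2))

theorem isOpen_overlap (i j : ι) : IsOpen (A.dom i ∩ A.par i ⁻¹' A.cod j) :=
  (A.isOpen_dom i).inter ((A.isOpen_cod j).preimage (A.contDiff_par i).continuous)

theorem differentiableAt_transition {i j : ι} {x : X}
    (hxj : A.par i x ∈ A.cod j) : DifferentiableAt ℝ (A.coord j ∘ A.par i) x := by
  refine DifferentiableAt.comp x ?_ ((A.contDiff_par i).differentiable (by simp) x)
  exact ((A.contDiffOn_coord j).differentiableOn (by simp)).differentiableAt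
    ((A.isOpen_cod j).mem_nhds hxj)

theorem par_transition {i j : ι} {x : X} (hx : x ∈ A.dom i) (hxj : A.par i x ∈ A.cod j) :
    A.par j (A.coord j (A.par i x)) = A.par i x := A.par_coord j _ (A.par_mem i x hx) hxj

theorem transition_mem {i j : ι} {x : X} (hx : x ∈ A.dom i) (hxj : A.par i x ∈ A.cod j) :
    A.coord j (A.par i x) ∈ A.dom j := A.coord_mem j _ (A.par_mem i x hx) hxj

theorem image_transition (i j : ι) :
    (A.coord j ∘ A.par i) '' (A.dom i ∩ A.par i ⁻¹' A.cod j) =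
      A.dom j ∩ A.par j ⁻¹' A.cod i := by
  ext y
  constructor
  · rintro ⟨x, ⟨hx, hxj⟩, rfl⟩
    refine ⟨A.transition_mem hx hxj, ?_⟩
    simp only [Function.comp, mem_preimage]
    rw [A.par_transition hx hxj]
    exact A.par_mem_cod i x hx
  · rintro ⟨hy, hyi⟩
    refine ⟨A.coord i (A.par j y), ⟨A.transition_mem hy hyi, ?_⟩, ?_⟩
    · rw [mem_preimage, A.par_transition hy hyi]
      exact A.par_mem_cod j y hy
    · simp only [Function.comp]
      rw [A.par_transition hy hyi, A.coord_par j y hy]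

theorem injOn_transition (i j : ι) :
    InjOn (A.coord j ∘ A.par i) (A.dom i ∩ A.par i ⁻¹' A.cod j) := by
  rintro x ⟨hx, hxj⟩ y ⟨hy, hyj⟩ h
  simp only [Function.comp] at h
  have h1 := congrArg (A.par j) h
  rw [A.par_transition hx hxj, A.par_transition hy hyj] at h1
  rw [← A.coord_par i x hx, h1, A.coord_par i y hy]

/-- The chain rule for a map `H` read in two charts. -/
theorem fderiv_comp_par {Y : Type*} [NormedAddCommGroup Y] [NormedSpace ℝ Y] {H : E → Y}
    (hH : ContDiff ℝ ∞ H) {i j : ι} {x : X} (hx : x ∈ A.dom i) (hxj : A.par i x ∈ A.cod j) :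
    fderiv ℝ (H ∘ A.par i) x = (fderiv ℝ (H ∘ A.par j) (A.coord j (A.par i x))).comp
      (fderiv ℝ (A.coord j ∘ A.par i) x) := by
  have h1 : H ∘ A.par i =ᶠ[𝓝 x] (H ∘ A.par j) ∘ (A.coord j ∘ A.par i) := by
    filter_upwards [(A.isOpen_overlap i j).mem_nhds ⟨hx, hxj⟩] with y hy
    simp only [Function.comp]
    rw [A.par_transition hy.1 hy.2]
  rw [h1.fderiv_eq, fderiv_comp]
  · rfl
  · exact ((hH.comp (A.contDiff_par j)).differentiable (by simp)) _
  · exact A.differentiableAt_transition hxj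

end Basic

section Integral

variable {N : ℕ} (A : OrientedAtlas ι (Fin N → ℝ) E M)

/-- A family of functions on the charts that transforms like a density under the transition
maps. -/
def IsDensity (w : ι → (Fin N → ℝ) → ℝ) : Prop :=
  ∀ i j, ∀ x ∈ A.dom i, A.par i x ∈ A.cod j →
    w i x = |(fderiv ℝ (A.coord j ∘ A.par i) x).det| * w j (A.coord j (A.par i x))

/-- The integral of a density over `M`. -/
def total (w : ι → (Fin N → ℝ) → ℝ) : ℝ :=
  ∑ i, ∫ x in A.dom i, A.weight i (A.par i x) * w i x

variable {A} in
theorem IsDensity.mul_fun {w : ι → (Fin N → ℝ) → ℝ} (hw : A.IsDensity w) (g : E → ℝ) :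
    A.IsDensity fun i x => g (A.par i x) * w i x := by
  intro i j x hx hxj
  simp only
  rw [hw i j x hx hxj, A.par_transition hx hxj]
  ring

variable {A} in
theorem IsDensity.sub {w w' : ι → (Fin N → ℝ) → ℝ} (hw : A.IsDensity w) (hw' : A.IsDensity w') :
    A.IsDensity fun i x => w i x - w' i x := by
  intro i j x hx hxj
  simp only
  rw [hw i j x hx hxj, hw' i j x hx hxj]
  ring

variable {A} in
theorem IsDensity.setIntegral_overlap {w : ι → (Fin N → ℝ) → ℝ} (hw : A.IsDensity w) (i j : ι) :
    ∫ x in A.dom i ∩ A.par i ⁻¹' A.cod j, w i x = ∫ x in A.dom j ∩ A.par j ⁻¹' A.cod i, w j x := by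
  rw [← A.image_transition i j, integral_image_eq_integral_abs_det_fderiv_smul volume
    (A.isOpen_overlap i j).measurableSet
    (fun x hx => (A.differentiableAt_transition hx.2).hasFDerivAt.hasFDerivWithinAt)
    (A.injOn_transition i j)]
  refine setIntegral_congr_fun (A.isOpen_overlap i j).measurableSet fun x hx => ?_
  simp only [smul_eq_mul, Function.comp]
  exact hw i j x hx.1 hx.2

theorem weight_eq_zero {i : ι} {p : E} (hp : p ∉ A.cod i) : A.weight i p = 0 := by
  by_contra h
  exact hp (A.tsupport_weight i (subset_tsupport _ h))

variable {A} in
/-- The integral of a density that is supported in a single chart is computed in this chart. -/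
theorem IsDensity.total_eq_setIntegral {w : ι → (Fin N → ℝ) → ℝ} (hw : A.IsDensity w) {k : ι}
    (hk : ∀ i, ∀ x ∈ A.dom i, w i x ≠ 0 → A.par i x ∈ A.cod k)
    (hint : IntegrableOn (w k) (A.dom k)) : A.total w = ∫ x in A.dom k, w k x := by
  have h1 : ∀ i, ∫ x in A.dom i, A.weight i (A.par i x) * w i x =
      ∫ x in A.dom k, A.weight i (A.par k x) * w k x := by
    intro i
    have e1 : ∫ x in A.dom i ∩ A.par i ⁻¹' A.cod k, A.weight i (A.par i x) * w i x =
        ∫ x in A.dom i, A.weight i (A.par i x) * w i x := by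
      refine (setIntegral_eq_of_subset_of_forall_sdiff_eq_zero (A.isOpen_dom i).measurableSet
        inter_subset_left fun x hx => ?_).symm
      by_cases h : w i x = 0
      · rw [h, mul_zero]
      · exact absurd ⟨hx.1, hk i x hx.1 h⟩ hx.2
    have e2 : ∫ x in A.dom k ∩ A.par k ⁻¹' A.cod i, A.weight i (A.par k x) * w k x =
        ∫ x in A.dom k, A.weight i (A.par k x) * w k x := by
      refine (setIntegral_eq_of_subset_of_forall_sdiff_eq_zero (A.isOpen_dom k).measurableSet
        inter_subset_left fun x hx => ?_).symm
      rw [A.weight_eq_zero fun h => hx.2 ⟨hx.1, h⟩, zero_mul]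
    rw [← e1, ← e2]
    exact (hw.mul_fun (A.weight i)).setIntegral_overlap i k
  have h2 : ∀ i, IntegrableOn (fun x => A.weight i (A.par k x) * w k x) (A.dom k) := by
    intro i
    refine Integrable.bdd_mul (c := 1) hint ?_ ?_
    · exact ((A.contDiff_weight i).continuous.comp
        (A.contDiff_par k).continuous).aestronglyMeasurable
    · refine Filter.Eventually.of_forall fun x => ?_
      have := A.weight_mem i (A.par k x)
      rw [Real.norm_eq_abs, abs_of_nonneg this.1]
      exact this.2
  rw [total, Finset.sum_congr rfl fun i _ => h1 i, ← integral_finsetSum _ fun i _ => h2 i]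
  refine setIntegral_congr_fun (A.isOpen_dom k).measurableSet fun x hx => ?_
  rw [← Finset.sum_mul, A.sum_weight _ (A.par_mem k x hx), one_mul]

/-- The density of the form `g · H^*(φ · vol)` on the oriented `M`. -/
def degFamily (φ : (Fin N → ℝ) → ℝ) (H : E → Fin N → ℝ) (g : E → ℝ) (i : ι) (x : Fin N → ℝ) : ℝ :=
  g (A.par i x) * (A.sign i * degDensity φ (H ∘ A.par i) x)

/-- The signs of the atlas turn the Jacobians of the transition maps into their absolute values. -/
theorem isDensity_degFamily (φ : (Fin N → ℝ) → ℝ) {H : E → Fin N → ℝ} (hH : ContDiff ℝ ∞ H)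
    (g : E → ℝ) : A.IsDensity (A.degFamily φ H g) := by
  refine IsDensity.mul_fun (w := fun i x => A.sign i * degDensity φ (H ∘ A.par i) x) ?_ g
  intro i j x hx hxj
  have h1 := A.sign_compat i j x hx hxj
  simp only [degDensity, Function.comp]
  have h2 := A.fderiv_comp_par hH hx hxj
  have h3 : (fderiv ℝ (H ∘ A.par i) x).det = (fderiv ℝ (H ∘ A.par j) (A.coord j (A.par i x))).det *
      (fderiv ℝ (A.coord j ∘ A.par i) x).det := by
    rw [h2]
    exact LinearMap.det_comp _ _
  rw [A.par_transition hx hxj]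
  change A.sign i * (φ (H (A.par i x)) * (fderiv ℝ (H ∘ A.par i) x).det) =
    |(fderiv ℝ (A.coord j ∘ A.par i) x).det| * (A.sign j * (φ (H (A.par i x)) *
      (fderiv ℝ (H ∘ A.par j) (A.coord j (A.par i x))).det))
  rw [h3]
  have h4 : A.sign i * (fderiv ℝ (A.coord j ∘ A.par i) x).det =
      A.sign j * |(fderiv ℝ (A.coord j ∘ A.par i) x).det| := by
    rcases A.sign_eq i with hi | hi <;> rcases A.sign_eq j with hj | hj <;> rw [hi, hj] at h1 ⊢
    · rw [abs_of_pos (by linarith)]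
    · rw [abs_of_neg (by linarith)]; ring
    · rw [abs_of_neg (by linarith)]; ring
    · rw [abs_of_pos (by linarith)]
  linear_combination (φ (H (A.par i x)) *
      (fderiv ℝ (H ∘ A.par j) (A.coord j (A.par i x))).det) * h4

theorem continuous_degDensity {φ : (Fin N → ℝ) → ℝ} (hφ : Continuous φ)
    {h : (Fin N → ℝ) → Fin N → ℝ} (hh : ContDiff ℝ ∞ h) : Continuous (degDensity φ h) := by
  refine (hφ.comp hh.continuous).mul ?_
  exact ContinuousLinearMap.continuous_det.comp (hh.continuous_fderiv (by simp))

omit A in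
theorem contDiff_comp_par (A : OrientedAtlas ι (Fin N → ℝ) E M) {Y : Type*}
    [NormedAddCommGroup Y] [NormedSpace ℝ Y] {H : E → Y} (hH : ContDiff ℝ ∞ H) (i : ι) :
    ContDiff ℝ ∞ (H ∘ A.par i) := hH.comp (A.contDiff_par i)

theorem isCompact_coord_image {Z : Set E} (hZ : IsCompact Z) (i : ι) {T : Set E}
    (hT : IsClosed T) (hTi : T ⊆ A.cod i) : IsCompact (A.coord i '' (T ∩ Z)) :=
  (hZ.inter_left hT).image_of_continuousOn
    ((A.contDiffOn_coord i).continuousOn.mono (inter_subset_left.trans hTi))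

theorem integrableOn_weight_mul_degFamily {φ : (Fin N → ℝ) → ℝ} (hφ : Continuous φ)
    {H : E → Fin N → ℝ} (hH : ContDiff ℝ ∞ H) {Z : Set E} (hZ : IsCompact Z) (hZM : Z ⊆ M)
    {B : Set E} (hB : IsOpen B) (i : ι) :
    IntegrableOn (fun x => A.weight i (A.par i x) *
      A.degFamily φ H ((Z ∩ B).indicator 1) i x) (A.dom i) := by
  set C := A.coord i '' (tsupport (A.weight i) ∩ Z)
  have hC : IsCompact C := A.isCompact_coord_image hZ i (isClosed_tsupport _) (A.tsupport_weight i)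
  set F : (Fin N → ℝ) → ℝ := fun x => A.weight i (A.par i x) *
    (A.sign i * degDensity φ (H ∘ A.par i) x)
  have hF : Continuous F :=
    ((A.contDiff_weight i).continuous.comp (A.contDiff_par i).continuous).mul
      (continuous_const.mul (continuous_degDensity hφ (A.contDiff_comp_par hH i)))
  have hm : MeasurableSet (C ∩ A.par i ⁻¹' B) :=
    hC.measurableSet.inter (hB.preimage (A.contDiff_par i).continuous).measurableSet
  have h1 : Integrable ((C ∩ A.par i ⁻¹' B).indicator F) := by
    rw [integrable_indicator_iff hm]
    exact (hF.continuousOn.integrableOn_compact hC).mono_set inter_subset_left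
  refine (h1.integrableOn (s := A.dom i)).congr_fun (fun x hx => ?_) (A.isOpen_dom i).measurableSet
  simp only [degFamily, F]
  by_cases hw : A.weight i (A.par i x) = 0
  · rw [hw, zero_mul]
    by_cases h : x ∈ C ∩ A.par i ⁻¹' B
    · rw [indicator_of_mem h, hw, zero_mul]
    · rw [indicator_of_notMem h]
  have hmem : A.par i x ∈ Z ↔ x ∈ C := by
    constructor
    · intro h
      exact ⟨_, ⟨subset_tsupport _ hw, h⟩, A.coord_par i x hx⟩
    · rintro ⟨p, ⟨hp, hpZ⟩, rfl⟩
      rwa [A.par_coord i p (hZM hpZ) (A.tsupport_weight i hp)]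
  by_cases h : x ∈ C ∩ A.par i ⁻¹' B
  · rw [indicator_of_mem h, indicator_of_mem (show A.par i x ∈ Z ∩ B from ⟨hmem.2 h.1, h.2⟩)]
    simp
  · rw [indicator_of_notMem h, indicator_of_notMem (fun h' => h ⟨hmem.1 h'.1, h'.2⟩)]
    simp

/-- The integral of `H^*(φ · vol)` over the part `Z` of `M`. -/
def degIntegral (φ : (Fin N → ℝ) → ℝ) (H : E → Fin N → ℝ) (Z : Set E) : ℝ :=
  A.total (A.degFamily φ H (Z.indicator 1))

end Integral

end OrientedAtlas

end LegendrianTB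
end

noncomputable section
namespace LegendrianTB

/-! ### The degree integral counts transverse zeros -/

open MeasureTheory Set

/-- Near a point at which the Jacobian of `f` does not vanish, `f` is injective and open on
arbitrarily small neighbourhoods. -/
theorem exists_open_injOn_image {N : ℕ} {f : (Fin N → ℝ) → Fin N → ℝ} (hf : ContDiff ℝ ∞ f)
    {x : Fin N → ℝ} (hx : (fderiv ℝ f x).det ≠ 0) {s : Set (Fin N → ℝ)} (hs : s ∈ 𝓝 x) :
    ∃ U ⊆ s, IsOpen U ∧ x ∈ U ∧ InjOn f U ∧ IsOpen (f '' U) := by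
  set T := (fderiv ℝ f x).toContinuousLinearEquivOfDetNeZero hx with hT
  have h1 : HasStrictFDerivAt f (T : (Fin N → ℝ) →L[ℝ] (Fin N → ℝ)) x := by
    have h2 := hf.contDiffAt.hasStrictFDerivAt (x := x) (by simp)
    have h3 : (T : (Fin N → ℝ) →L[ℝ] (Fin N → ℝ)) = fderiv ℝ f x := by
      ext1 v; rfl
    rwa [h3]
  obtain ⟨V, hVs, hVo, hxV⟩ := mem_nhds_iff.1 hs
  set e := h1.toOpenPartialHomeomorph f
  have he : (e : (Fin N → ℝ) → Fin N → ℝ) = f := h1.toOpenPartialHomeomorph_coe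
  refine ⟨e.source ∩ V, inter_subset_right.trans hVs, e.open_source.inter hVo,
    ⟨h1.mem_toOpenPartialHomeomorph_source, hxV⟩, ?_, ?_⟩
  · rw [← he]; exact e.injOn.mono inter_subset_left
  · rw [← he]; exact e.isOpen_image_of_subset_source (e.open_source.inter hVo) inter_subset_left

/-- The contribution of a transverse zero to the degree integral. -/
theorem setIntegral_degDensity {N : ℕ} {φ : (Fin N → ℝ) → ℝ} {f : (Fin N → ℝ) → Fin N → ℝ}
    (hf : ContDiff ℝ ∞ f) (hφ : Integrable φ) {U : Set (Fin N → ℝ)} (hU : MeasurableSet U)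
    (hinj : InjOn f U) (hsupp : ∀ y, φ y ≠ 0 → y ∈ f '' U) {δ σ : ℝ} (hδ : δ = 1 ∨ δ = -1)
    (hσ : σ = 1 ∨ σ = -1) (hdet : ∀ x ∈ U, 0 < δ * (σ * (fderiv ℝ f x).det)) :
    IntegrableOn (fun x => σ * degDensity φ f x) U ∧
      ∫ x in U, σ * degDensity φ f x = δ * ∫ y, φ y := by
  have hfd : ∀ x ∈ U, HasFDerivWithinAt f (fderiv ℝ f x) U x := fun x _ =>
    ((hf.differentiable (by simp)) x).hasFDerivAt.hasFDerivWithinAt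
  have h1 : ∀ x ∈ U, σ * degDensity φ f x = δ * (|(fderiv ℝ f x).det| • φ (f x)) := by
    intro x hx
    have h2 := hdet x hx
    have h3 : σ * (fderiv ℝ f x).det = δ * |(fderiv ℝ f x).det| := by
      rcases hδ with hδ | hδ <;> rcases hσ with hσ | hσ <;> rw [hδ, hσ] at h2 ⊢
      · rw [abs_of_pos (by linarith)]
      · rw [abs_of_neg (by linarith)]; ring
      · rw [abs_of_neg (by linarith)]; ring
      · rw [abs_of_pos (by linarith)]
    simp only [degDensity, smul_eq_mul]
    linear_combination φ (f x) * h3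
  constructor
  · rw [integrableOn_congr_fun h1 hU]
    exact (((integrableOn_image_iff_integrableOn_abs_det_fderiv_smul volume hU hfd hinj φ).1
      hφ.integrableOn)).const_mul δ
  · rw [setIntegral_congr_fun hU h1, integral_const_mul,
      ← integral_image_eq_integral_abs_det_fderiv_smul volume hU hfd hinj,
      setIntegral_eq_integral_of_forall_compl_eq_zero]
    intro y hy
    by_contra h
    exact hy (hsupp y h)

namespace OrientedAtlas

variable {ι E : Type*} [Fintype ι] [NormedAddCommGroup E] [NormedSpace ℝ E] {M : Set E}
  {N : ℕ} (A : OrientedAtlas ι (Fin N → ℝ) E M)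

/-- If `H` has finitely many zeros `p ∈ S` in `Z`, all of them transverse, with signs `δ p`, then
the integral of `H^*(φ · vol)` is `∑ δ p` times that of `φ`, for all `φ` with small support. -/
theorem exists_degIntegral_eq_sum {Z : Set E} (hZ : IsCompact Z) (hZM : Z ⊆ M)
    {H : E → Fin N → ℝ} (hH : ContDiff ℝ ∞ H) (S : Finset E) (hS : ∀ p, p ∈ S ↔ p ∈ Z ∧ H p = 0)
    (k : E → ι) (hk : ∀ p ∈ S, p ∈ A.cod (k p)) (δ : E → ℝ) (hδ : ∀ p ∈ S, δ p = 1 ∨ δ p = -1)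
    (hdet : ∀ p ∈ S, 0 < δ p * (A.sign (k p) *
      (fderiv ℝ (H ∘ A.par (k p)) (A.coord (k p) p)).det))
    (hint : ∀ p ∈ S, ∃ O, IsOpen O ∧ p ∈ O ∧ O ∩ M ⊆ Z) :
    ∃ r > 0, ∀ φ : (Fin N → ℝ) → ℝ, Continuous φ → (∀ y, r ≤ ‖y‖ → φ y = 0) →
      A.degIntegral φ H Z = (∑ p ∈ S, δ p) * ∫ y, φ y := by
  classical
  have hSM : ∀ p ∈ S, p ∈ M := fun p hp => hZM ((hS p).1 hp).1
  -- disjoint ambient neighbourhoods of the zeros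
  obtain ⟨V, hV, hVd⟩ := (S.finite_toSet).t2_separation
  choose! O hOo hpO hOM using hint
  have hf : ∀ p, ContDiff ℝ ∞ (H ∘ A.par (k p)) := fun p => A.contDiff_comp_par hH (k p)
  have hUex : ∀ p ∈ S, ∃ U : Set (Fin N → ℝ), U ⊆ (A.dom (k p) ∩ A.par (k p) ⁻¹' (O p ∩ V p)) ∩
      {x | 0 < δ p * (A.sign (k p) * (fderiv ℝ (H ∘ A.par (k p)) x).det)} ∧ IsOpen U ∧
      A.coord (k p) p ∈ U ∧ InjOn (H ∘ A.par (k p)) U ∧ IsOpen ((H ∘ A.par (k p)) '' U) := by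
    intro p hp
    have hd := A.coord_mem _ p (hSM p hp) (hk p hp)
    have hpc := A.par_coord _ p (hSM p hp) (hk p hp)
    refine exists_open_injOn_image (hf p) ?_ (IsOpen.mem_nhds ?_ ?_)
    · intro h0
      have := hdet p hp
      rw [h0] at this
      simp at this
    · refine ((A.isOpen_dom _).inter (((hOo p hp).inter (hV p).2).preimage
        (A.contDiff_par _).continuous)).inter ?_
      refine isOpen_lt continuous_const (continuous_const.mul (continuous_const.mul ?_))
      exact ContinuousLinearMap.continuous_det.comp ((hf p).continuous_fderiv (by simp))
    · refine ⟨⟨hd, ?_⟩, hdet p hp⟩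
      rw [mem_preimage, hpc]
      exact ⟨hpO p hp, (hV p).1⟩
  choose! U hUsub hUo hpU hUinj hUim using hUex
  set W : E → Set E := fun p => (A.cod (k p) ∩ A.coord (k p) ⁻¹' (U p)) ∩ V p with hW
  have hWo : ∀ p ∈ S, IsOpen (W p) := fun p hp =>
    ((A.contDiffOn_coord (k p)).continuousOn.isOpen_inter_preimage (A.isOpen_cod _)
      (hUo p hp)).inter (hV p).2
  have hpW : ∀ p ∈ S, p ∈ W p := fun p hp => ⟨⟨hk p hp, hpU p hp⟩, (hV p).1⟩
  -- away from these neighbourhoods `H` is bounded away from zero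
  obtain ⟨r0, hr0, hr0'⟩ : ∃ r0 > 0, ∀ q ∈ Z, (∀ p ∈ S, q ∉ W p) → r0 ≤ ‖H q‖ := by
    have hc : IsCompact (Z \ ⋃ p ∈ S, W p) :=
      hZ.diff (isOpen_biUnion fun p hp => hWo p hp)
    rcases (Z \ ⋃ p ∈ S, W p).eq_empty_or_nonempty with he | hne
    · refine ⟨1, one_pos, fun q hq hqW => ?_⟩
      have : q ∈ Z \ ⋃ p ∈ S, W p := ⟨hq, by simpa using hqW⟩
      rw [he] at this
      exact this.elim
    · obtain ⟨q0, hq0, hmin⟩ := hc.exists_isMinOn hne hH.continuous.norm.continuousOn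
      refine ⟨‖H q0‖, ?_, fun q hq hqW => hmin ⟨hq, by simpa using hqW⟩⟩
      rw [gt_iff_lt, norm_pos_iff]
      intro h0
      have hq0S := (hS q0).2 ⟨hq0.1, h0⟩
      exact hq0.2 (mem_biUnion hq0S (hpW q0 hq0S))
  have hball : ∀ p ∈ S, ∃ r > 0, Metric.ball (0 : Fin N → ℝ) r ⊆ (H ∘ A.par (k p)) '' U p := by
    intro p hp
    refine Metric.isOpen_iff.1 (hUim p hp) 0 ⟨_, hpU p hp, ?_⟩
    simp only [Function.comp]
    rw [A.par_coord _ p (hSM p hp) (hk p hp)]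
    exact ((hS p).1 hp).2
  choose! ρ hρ hρball using hball
  obtain ⟨r, hr, hrr0, hrρ⟩ : ∃ r > 0, r ≤ r0 ∧ ∀ p ∈ S, r ≤ ρ p := by
    have h1 : ∀ᶠ r in 𝓝[>] (0 : ℝ), 0 < r ∧ r ≤ r0 ∧ ∀ p ∈ S, r ≤ ρ p := by
      refine (eventually_mem_nhdsWithin).and (Filter.Eventually.and ?_ ?_)
      · exact (eventually_le_nhds hr0).filter_mono nhdsWithin_le_nhds
      · rw [Finset.eventually_all]
        intro p hp
        exact (eventually_le_nhds (hρ p hp)).filter_mono nhdsWithin_le_nhds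
    obtain ⟨r, h1, h2, h3⟩ := h1.exists
    exact ⟨r, h1, h2, h3⟩
  refine ⟨r, hr, fun φ hφ hφr => ?_⟩
  have hφi : Integrable φ := by
    refine hφ.integrable_of_hasCompactSupport (HasCompactSupport.intro
      (isCompact_closedBall (0 : Fin N → ℝ) r) fun y hy => hφr y ?_)
    rw [mem_closedBall_zero_iff, not_le] at hy
    exact hy.le
  -- split the integrand according to the zeros
  have hsplit : ∀ i, ∀ x ∈ A.dom i, A.degFamily φ H (Z.indicator 1) i x =
      ∑ p ∈ S, A.degFamily φ H ((Z ∩ W p).indicator 1) i x := by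
    intro i x hx
    by_cases hxW : ∃ p ∈ S, A.par i x ∈ W p
    · obtain ⟨p, hp, hpx⟩ := hxW
      rw [Finset.sum_eq_single_of_mem p hp]
      · simp only [degFamily]
        by_cases hxZ : A.par i x ∈ Z
        · rw [indicator_of_mem hxZ, indicator_of_mem (show A.par i x ∈ Z ∩ W p from ⟨hxZ, hpx⟩)]
        · rw [indicator_of_notMem hxZ, indicator_of_notMem fun h => hxZ h.1]
      · intro p' hp' hne
        simp only [degFamily]
        rw [indicator_of_notMem, zero_mul]
        rintro ⟨-, h⟩
        exact Set.disjoint_left.1 (hVd hp' hp hne) h.2 hpx.2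
    · push Not at hxW
      rw [Finset.sum_eq_zero]
      · simp only [degFamily]
        by_cases hxZ : A.par i x ∈ Z
        · have := hr0' _ hxZ hxW
          rw [degDensity, Function.comp, hφr _ (hrr0.trans this)]
          simp
        · rw [indicator_of_notMem hxZ, zero_mul]
      · intro p hp
        simp only [degFamily]
        rw [indicator_of_notMem fun h => hxW p hp h.2, zero_mul]
  have htot : A.degIntegral φ H Z =
      ∑ p ∈ S, A.total (A.degFamily φ H ((Z ∩ W p).indicator 1)) := by
    rw [degIntegral]
    simp only [total]
    rw [Finset.sum_comm]
    refine Finset.sum_congr rfl fun i _ => ?_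
    rw [← integral_finsetSum _ fun p hp =>
      A.integrableOn_weight_mul_degFamily hφ hH hZ hZM (hWo p hp) i]
    refine setIntegral_congr_fun (A.isOpen_dom i).measurableSet fun x hx => ?_
    rw [hsplit i x hx, Finset.mul_sum]
  rw [htot, Finset.sum_mul]
  refine Finset.sum_congr rfl fun p hp => ?_
  have hloc := setIntegral_degDensity (hf p) hφi (hUo p hp).measurableSet (hUinj p hp)
    (fun y hy => hρball p hp (by
      rw [mem_ball_zero_iff]
      by_contra h
      exact hy (hφr y ((hrρ p hp).trans (not_lt.1 h))))) (hδ p hp) (A.sign_eq (k p))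
    (fun x hx => (hUsub p hp hx).2)
  have hUdom : U p ⊆ A.dom (k p) := fun x hx => (hUsub p hp hx).1.1
  have hind : ∀ x ∈ A.dom (k p), A.degFamily φ H ((Z ∩ W p).indicator 1) (k p) x =
      (U p).indicator (fun x => A.sign (k p) * degDensity φ (H ∘ A.par (k p)) x) x := by
    intro x hx
    simp only [degFamily]
    by_cases hxU : x ∈ U p
    · have h1 := (hUsub p hp hxU).1.2
      rw [indicator_of_mem hxU, indicator_of_mem, Pi.one_apply, one_mul]
      refine ⟨hOM p hp ⟨h1.1, A.par_mem _ x hx⟩, ⟨A.par_mem_cod _ x hx, ?_⟩, h1.2⟩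
      rw [mem_preimage, A.coord_par _ x hx]
      exact hxU
    · rw [indicator_of_notMem hxU, indicator_of_notMem, zero_mul]
      rintro ⟨-, ⟨-, h⟩, -⟩
      rw [mem_preimage, A.coord_par _ x hx] at h
      exact hxU h
  rw [(A.isDensity_degFamily φ hH _).total_eq_setIntegral (k := k p)]
  · rw [setIntegral_congr_fun (A.isOpen_dom _).measurableSet hind,
      setIntegral_indicator (hUo p hp).measurableSet, inter_eq_self_of_subset_right hUdom, hloc.2]
  · intro i x hx hne
    simp only [degFamily] at hne
    by_contra h
    apply hne
    rw [indicator_of_notMem (fun h' => h h'.2.1.1), zero_mul]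
  · rw [integrableOn_congr_fun hind (A.isOpen_dom _).measurableSet]
    exact ((integrable_indicator_iff (hUo p hp).measurableSet).2 hloc.1).integrableOn

end OrientedAtlas

end LegendrianTB
end

noncomputable section
namespace LegendrianTB

/-! ### Homotopy invariance of the degree integral on a manifold -/

open MeasureTheory Set

theorem exists_contDiff_eq_one_near {X : Type*} [NormedAddCommGroup X] [NormedSpace ℝ X]
    [FiniteDimensional ℝ X] {C D : Set X} (hC : IsCompact C) (hD : IsOpen D) (hCD : C ⊆ D) :
    ∃ χ : X → ℝ, ContDiff ℝ ∞ χ ∧ HasCompactSupport χ ∧ tsupport χ ⊆ D ∧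
      ∀ x ∈ C, ∀ᶠ y in 𝓝 x, χ y = 1 := by
  obtain ⟨K, hK, hCK, hKD⟩ := exists_compact_between hC hD hCD
  obtain ⟨K', hK', hCK', hKD'⟩ := exists_compact_between hC isOpen_interior hCK
  obtain ⟨f, hf1, hf2, -⟩ := exists_contMDiffMap_one_nhds_of_subset_interior
    (modelWithCornersSelf ℝ X) (n := ⊤) hC.isClosed hCK'
  have hs : tsupport f ⊆ K := by
    refine closure_minimal (fun x hx => ?_) hK.isClosed
    by_contra h
    exact hx (hf2 x fun hx' => h (interior_subset (hKD' hx')))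
  refine ⟨f, f.contMDiff.contDiff, hK.of_isClosed_subset (isClosed_tsupport _) hs,
    hs.trans hKD, fun x hx => ?_⟩
  exact (Filter.eventually_iff_exists_mem.2 ⟨_, hf1, fun y hy => hy⟩ :
    ∀ᶠ y in 𝓝ˢ C, f y = 1).filter_mono (nhds_le_nhdsSet hx)

theorem degDensity_congr {N : ℕ} {φ : (Fin N → ℝ) → ℝ} {f g : (Fin N → ℝ) → Fin N → ℝ}
    {x : Fin N → ℝ} (h : f =ᶠ[𝓝 x] g) : degDensity φ f x = degDensity φ g x := by
  rw [degDensity, degDensity, h.fderiv_eq, h.eq_of_nhds]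

namespace OrientedAtlas

variable {ι E : Type*} [Fintype ι] [NormedAddCommGroup E] [NormedSpace ℝ E] {M : Set E}
  {N : ℕ} (A : OrientedAtlas ι (Fin N → ℝ) E M)

theorem eventually_weight_eq_zero {k : ι} {p : E} (hp : p ∉ tsupport (A.weight k)) :
    ∀ᶠ q in 𝓝 p, A.weight k q = 0 :=
  notMem_tsupport_iff_eventuallyEq.1 hp

/-- The degree integral over `Z` does not change if a multiple of `G`, localized in the chart `k`,
is added to `H`, provided there is no flux through the boundary of `Z`; here `Z` is the part of `M`
on which the coordinate of index `i₀` lies in `[0, 1]`. -/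
theorem degIntegral_add_weight_smul {Z : Set E} (hZ : IsCompact Z) (hZM : Z ⊆ M) {i₀ : Fin N}
    (hslab : ∀ k, ∀ x ∈ A.dom k, A.par k x ∈ Z ↔ x i₀ ∈ Icc (0 : ℝ) 1)
    {H G : E → Fin N → ℝ} (hH : ContDiff ℝ ∞ H) (hG : ContDiff ℝ ∞ G)
    {φ : (Fin N → ℝ) → ℝ} (hφ : ContDiff ℝ ∞ φ) (k : ι)
    (hface : ∀ x ∈ A.dom k, (x i₀ = 0 ∨ x i₀ = 1) → ∀ t : ℝ,
      A.weight k (A.par k x) • G (A.par k x) = 0 ∨ ∃ l ≠ i₀, ∃ (d : Fin N → ℝ) (r s : ℝ),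
        A.weight k (A.par k x) • G (A.par k x) = r • d ∧
        fderiv ℝ (fun x => H (A.par k x) + t • A.weight k (A.par k x) • G (A.par k x)) x
          (Pi.single l 1) = s • d) :
    A.degIntegral φ (fun p => H p + A.weight k p • G p) Z = A.degIntegral φ H Z := by
  set H' : E → Fin N → ℝ := fun p => H p + A.weight k p • G p with hH'
  have hH's : ContDiff ℝ ∞ H' := hH.add ((A.contDiff_weight k).smul hG)
  set C := A.coord k '' (tsupport (A.weight k) ∩ Z) with hCdef
  have hC : IsCompact C := A.isCompact_coord_image hZ k (isClosed_tsupport _) (A.tsupport_weight k)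
  have hCdom : C ⊆ A.dom k := by
    rintro _ ⟨p, ⟨hp, hpZ⟩, rfl⟩
    exact A.coord_mem k p (hZM hpZ) (A.tsupport_weight k hp)
  have hmemC : ∀ x ∈ A.dom k, A.par k x ∈ Z → x ∉ C → A.par k x ∉ tsupport (A.weight k) :=
    fun x hx hxZ hxC h => hxC ⟨_, ⟨h, hxZ⟩, A.coord_par k x hx⟩
  -- `η` is the perturbation read in the chart `k`; outside `dom k` the parametrization is
  -- meaningless, so it is cut off there
  obtain ⟨χ, hχ, hχc, hχD, hχ1⟩ := exists_contDiff_eq_one_near hC (A.isOpen_dom k) hCdom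
  set h : (Fin N → ℝ) → Fin N → ℝ := H ∘ A.par k with hh
  set η : (Fin N → ℝ) → Fin N → ℝ := fun x => χ x • A.weight k (A.par k x) • G (A.par k x) with hη
  have hhs : ContDiff ℝ ∞ h := A.contDiff_comp_par hH k
  have hηs : ContDiff ℝ ∞ η := hχ.smul ((A.contDiff_comp_par (A.contDiff_weight k) k).smul
    (A.contDiff_comp_par hG k))
  have hη0 : ∀ x ∉ tsupport χ, ∀ᶠ y in 𝓝 x, η y = 0 := fun x hx => by
    filter_upwards [notMem_tsupport_iff_eventuallyEq.1 hx] with y hy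
    simp only [hη, hy, Pi.zero_apply, zero_smul]
  have hη0' : ∀ x ∈ A.dom k, A.par k x ∈ Z → x ∉ C → ∀ᶠ y in 𝓝 x, η y = 0 :=
    fun x hx hxZ hxC => by
    filter_upwards [(A.contDiff_par k).continuous.continuousAt.eventually
      (A.eventually_weight_eq_zero (hmemC x hx hxZ hxC))] with y hy
    simp only [hη, hy, zero_smul, smul_zero]
  have hη1 : ∀ x ∈ C, ∀ᶠ y in 𝓝 x, η y = A.weight k (A.par k y) • G (A.par k y) :=
    fun x hx => by
    filter_upwards [hχ1 x hx] with y hy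
    simp only [hη, hy, one_smul]
  obtain ⟨R, hR0, hR⟩ : ∃ R > 0, ∀ x ∈ tsupport χ, ‖x‖ < R := by
    obtain ⟨R, hR⟩ := hχc.isBounded.exists_norm_le
    refine ⟨max R 0 + 1, by positivity, fun x hx => ?_⟩
    have := hR x hx
    have := le_max_left R 0
    linarith
  -- a box whose only faces that meet the support of `χ` are those in the boundary of the slab
  set a : Fin N → ℝ := fun i => if i = i₀ then 0 else -R with ha
  set b : Fin N → ℝ := fun i => if i = i₀ then 1 else R with hb
  have hab : a ≤ b := by
    intro i
    simp only [ha, hb]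
    split_ifs <;> linarith
  have hi0 : ∀ x ∈ Icc a b, x i₀ ∈ Icc (0 : ℝ) 1 := by
    intro x hx
    have h1 := hx.1 i₀
    have h2 := hx.2 i₀
    simp only [ha, hb, if_true] at h1 h2
    exact ⟨h1, h2⟩
  have hbox : ∀ x ∈ tsupport χ, x i₀ ∈ Icc (0 : ℝ) 1 → x ∈ Icc a b := by
    intro x hx hx0
    have h1 := hR x hx
    have h2 : ∀ i, |x i| < R := fun i => (norm_le_pi_norm x i).trans_lt h1
    constructor <;> intro i <;> simp only [ha, hb] <;> split_ifs with hi
    · rw [hi]; exact hx0.1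
    · exact (abs_lt.1 (h2 i)).1.le
    · rw [hi]; exact hx0.2
    · exact (abs_lt.1 (h2 i)).2.le
  have key := integral_degDensity_add hφ hhs hηs hab (by
    intro x hx i hxi t
    by_cases hxχ : x ∈ tsupport χ
    swap
    · exact Or.inl (hη0 x hxχ).self_of_nhds
    have hxd := hχD hxχ
    have hxZ := (hslab k x hxd).2 (hi0 x hx)
    by_cases hxC : x ∈ C
    swap
    · exact Or.inl (hη0' x hxd hxZ hxC).self_of_nhds
    have hii : i = i₀ := by
      by_contra hne
      have h1 := (norm_le_pi_norm x i).trans_lt (hR x hxχ)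
      rw [Real.norm_eq_abs, abs_lt] at h1
      simp only [ha, hb, if_neg hne] at hxi
      rcases hxi with h2 | h2 <;> linarith [h1.1, h1.2]
    rw [hii] at hxi ⊢
    simp only [ha, hb, if_true] at hxi
    rw [(hη1 x hxC).self_of_nhds]
    have hev : (h + t • η) =ᶠ[𝓝 x]
        (fun x => H (A.par k x) + t • A.weight k (A.par k x) • G (A.par k x)) := by
      filter_upwards [hη1 x hxC] with y hy
      simp only [Pi.add_apply, Pi.smul_apply, hy]
      rfl
    rw [hev.fderiv_eq]
    exact hface x hxd hxi t)
  -- the difference of the two densities is supported in the chart `k`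
  set w : ι → (Fin N → ℝ) → ℝ := fun i x =>
    A.degFamily φ H' (Z.indicator 1) i x - A.degFamily φ H (Z.indicator 1) i x with hw
  have hwd : A.IsDensity w :=
    (A.isDensity_degFamily φ hH's _).sub (A.isDensity_degFamily φ hH _)
  have hdiff : A.degIntegral φ H' Z - A.degIntegral φ H Z = A.total w := by
    simp only [degIntegral, total]
    rw [← Finset.sum_sub_distrib]
    refine Finset.sum_congr rfl fun i _ => ?_
    have i1 := A.integrableOn_weight_mul_degFamily hφ.continuous hH's hZ hZM isOpen_univ i
    have i2 := A.integrableOn_weight_mul_degFamily hφ.continuous hH hZ hZM isOpen_univ i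
    rw [inter_univ] at i1 i2
    rw [← integral_sub i1 i2]
    refine setIntegral_congr_fun (A.isOpen_dom i).measurableSet fun x _ => ?_
    simp only [hw]
    ring
  have hw0 : ∀ i x, A.par i x ∉ tsupport (A.weight k) → w i x = 0 := by
    intro i x hx
    simp only [hw, degFamily]
    rw [degDensity_congr (f := H' ∘ A.par i) (g := H ∘ A.par i), sub_self]
    filter_upwards [(A.contDiff_par i).continuous.continuousAt.eventually
      (A.eventually_weight_eq_zero hx)] with y hy
    simp only [Function.comp, hH', hy, zero_smul, add_zero]
  have hwk : ∀ x, (A.dom k).indicator (w k) x = (Icc a b).indicator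
      (fun x => A.sign k * (degDensity φ (h + η) x - degDensity φ h x)) x := by
    intro x
    have hzero : (∀ᶠ y in 𝓝 x, η y = 0) → (Icc a b).indicator
        (fun x => A.sign k * (degDensity φ (h + η) x - degDensity φ h x)) x = 0 := by
      intro hev
      rw [indicator_apply_eq_zero]
      intro _
      rw [degDensity_congr (f := h + η) (g := h), sub_self, mul_zero]
      filter_upwards [hev] with y hy
      simp [hy]
    by_cases hxd : x ∈ A.dom k
    swap
    · rw [indicator_of_notMem hxd, hzero (hη0 x fun hx => hxd (hχD hx))]
    rw [indicator_of_mem hxd]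
    by_cases hx0 : x i₀ ∈ Icc (0 : ℝ) 1
    swap
    · rw [indicator_of_notMem fun hx => hx0 (hi0 x hx)]
      simp only [hw, degFamily]
      rw [indicator_of_notMem fun hx => hx0 ((hslab k x hxd).1 hx)]
      ring
    have hxZ := (hslab k x hxd).2 hx0
    by_cases hxC : x ∈ C
    swap
    · rw [hzero (hη0' x hxd hxZ hxC), hw0 k x (hmemC x hxd hxZ hxC)]
    have hxχ : x ∈ tsupport χ := by
      apply subset_tsupport
      rw [Function.mem_support, (hχ1 x hxC).self_of_nhds]
      exact one_ne_zero
    rw [indicator_of_mem (hbox x hxχ hx0)]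
    simp only [hw, degFamily, indicator_of_mem hxZ, Pi.one_apply, one_mul]
    rw [degDensity_congr (f := h + η) (g := H' ∘ A.par k)]
    · ring
    · filter_upwards [hη1 x hxC] with y hy
      simp only [Pi.add_apply, hy]
      rfl
  have hcont : Continuous fun x => A.sign k * (degDensity φ (h + η) x - degDensity φ h x) :=
    continuous_const.mul ((continuous_degDensity hφ.continuous (hhs.add hηs)).sub
      (continuous_degDensity hφ.continuous hhs))
  have hIcc : IsCompact (Icc a b) := isCompact_Icc
  have hwint : IntegrableOn (w k) (A.dom k) := by
    rw [← integrable_indicator_iff (A.isOpen_dom k).measurableSet, funext hwk,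
      integrable_indicator_iff measurableSet_Icc]
    exact hcont.continuousOn.integrableOn_compact hIcc
  have htot : A.total w = 0 := by
    rw [hwd.total_eq_setIntegral (k := k) (fun i x _ hne => ?_) hwint,
      ← integral_indicator (A.isOpen_dom k).measurableSet, funext hwk,
      integral_indicator measurableSet_Icc, integral_const_mul, integral_sub, key, sub_self,
      mul_zero]
    · exact ((continuous_degDensity hφ.continuous
        (hhs.add hηs)).continuousOn.integrableOn_compact hIcc)
    · exact ((continuous_degDensity hφ.continuous hhs).continuousOn.integrableOn_compact hIcc)
    · by_contra hc
      exact hne (hw0 i x fun h' => hc (A.tsupport_weight k h'))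
  rw [htot] at hdiff
  linarith

end OrientedAtlas

end LegendrianTB
end

noncomputable section
namespace LegendrianTB

/-! ### Oriented atlases of submanifolds -/

open MeasureTheory Set

theorem map_comp_eq_det_mul {n : ℕ} {E : Type*} [AddCommGroup E] [Module ℝ E]
    (f : E [⋀^Fin n]→ₗ[ℝ] ℝ) (T : (Fin n → ℝ) →ₗ[ℝ] E) (A : (Fin n → ℝ) →ₗ[ℝ] (Fin n → ℝ)) :
    f (fun k => T (A (Pi.single k 1))) = LinearMap.det A * f (fun k => T (Pi.single k 1)) := by
  have h1 := (f.compLinearMap T).eq_smul_basis_det (Pi.basisFun ℝ (Fin n))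
  have h2 := congrArg (fun g : (Fin n → ℝ) [⋀^Fin n]→ₗ[ℝ] ℝ => g fun k => A (Pi.single k 1)) h1
  simp only [AlternatingMap.compLinearMap_apply, AlternatingMap.smul_apply, smul_eq_mul] at h2
  have h3 : (Pi.basisFun ℝ (Fin n)).det (fun k => A (Pi.single k 1)) = LinearMap.det A := by
    have := (Pi.basisFun ℝ (Fin n)).det_comp A (Pi.basisFun ℝ (Fin n))
    rw [Module.Basis.det_self, mul_one] at this
    rw [← this]
    congr 1
    ext1 k
    simp
  rw [h3] at h2
  rw [mul_comm]
  convert! h2 using 3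
  ext1 k
  simp

variable {n : ℕ}

/-- `par` parametrizes `L ∩ cod`, with parameters in `dom` and the inverse `coord`. -/
structure IsParam (L : Set (Space n)) (dom : Set (Fin n → ℝ)) (cod : Set (Space n))
    (par : (Fin n → ℝ) → Space n) (coord : Space n → Fin n → ℝ) : Prop where
  isOpen_dom : IsOpen dom
  isOpen_cod : IsOpen cod
  contDiff_par : ContDiff ℝ ∞ par
  contDiffOn_coord : ContDiffOn ℝ ∞ coord cod
  par_mem : ∀ x ∈ dom, par x ∈ L
  par_mem_cod : ∀ x ∈ dom, par x ∈ cod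
  coord_par : ∀ x ∈ dom, coord (par x) = x
  coord_mem : ∀ p ∈ L, p ∈ cod → coord p ∈ dom
  par_coord : ∀ p ∈ L, p ∈ cod → par (coord p) = p

theorem fderiv_mem_tangentSpaceAt {L : Set (Space n)} {f : (Fin n → ℝ) → Space n} {x : Fin n → ℝ}
    (hf : DifferentiableAt ℝ f x) (hx : ∀ᶠ y in 𝓝 x, f y ∈ L) (v : Fin n → ℝ) :
    fderiv ℝ f x v ∈ tangentSpaceAt L (f x) := by
  refine Submodule.subset_span ⟨fun t => f (x + t • v), by simp, ?_, ?_⟩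
  · have h1 : Continuous fun t : ℝ => x + t • v := by fun_prop
    have h2 := h1.tendsto 0
    rw [zero_smul, add_zero] at h2
    exact h2.eventually hx
  · have h2 : HasDerivAt (fun t : ℝ => x + t • v) v 0 := by
      simpa using ((hasDerivAt_id (0 : ℝ)).smul_const v).const_add x
    exact HasFDerivAt.comp_hasDerivAt (0 : ℝ) (l := f) (l' := fderiv ℝ f x)
      (by simpa using hf.hasFDerivAt) h2

theorem linearIndependent_fderiv {f : (Fin n → ℝ) → Space n} {g : Space n → Fin n → ℝ}
    {x : Fin n → ℝ} (hf : DifferentiableAt ℝ f x) (hg : DifferentiableAt ℝ g (f x))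
    (hgf : ∀ᶠ y in 𝓝 x, g (f y) = y) :
    LinearIndependent ℝ fun k => fderiv ℝ f x (Pi.single k 1) := by
  have h1 : (fderiv ℝ g (f x)).comp (fderiv ℝ f x) = ContinuousLinearMap.id ℝ _ := by
    rw [← fderiv_comp x hg hf]
    have : g ∘ f =ᶠ[𝓝 x] id := hgf
    rw [this.fderiv_eq, fderiv_id]
  have h2 : Function.Injective (fderiv ℝ f x) := by
    intro a b hab
    have := congrArg (fderiv ℝ g (f x)) hab
    rw [← ContinuousLinearMap.comp_apply, ← ContinuousLinearMap.comp_apply, h1] at this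
    simpa using this
  have h3 := (Pi.basisFun ℝ (Fin n)).linearIndependent.map' (fderiv ℝ f x : _ →ₗ[ℝ] Space n)
    (LinearMap.ker_eq_bot.2 h2)
  convert! h3 using 1
  ext1 k
  simp

namespace IsParam

variable {L : Set (Space n)} {dom : Set (Fin n → ℝ)} {cod : Set (Space n)}
  {par : (Fin n → ℝ) → Space n} {coord : Space n → Fin n → ℝ}

theorem differentiableAt_coord (h : IsParam L dom cod par coord) {p : Space n} (hp : p ∈ cod) :
    DifferentiableAt ℝ coord p :=
  (h.contDiffOn_coord.differentiableOn (by simp)).differentiableAt (h.isOpen_cod.mem_nhds hp)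

theorem differentiableAt_par (h : IsParam L dom cod par coord) (x : Fin n → ℝ) :
    DifferentiableAt ℝ par x := h.contDiff_par.differentiable (by simp) x

theorem fderiv_par_mem (h : IsParam L dom cod par coord) {x : Fin n → ℝ} (hx : x ∈ dom)
    (v : Fin n → ℝ) : fderiv ℝ par x v ∈ tangentSpaceAt L (par x) :=
  fderiv_mem_tangentSpaceAt (h.differentiableAt_par x)
    (Filter.mem_of_superset (h.isOpen_dom.mem_nhds hx) h.par_mem) v

theorem linearIndependent (h : IsParam L dom cod par coord) {x : Fin n → ℝ} (hx : x ∈ dom) :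
    LinearIndependent ℝ fun k => fderiv ℝ par x (Pi.single k 1) :=
  linearIndependent_fderiv (h.differentiableAt_par x)
    (h.differentiableAt_coord (h.par_mem_cod x hx))
    (Filter.mem_of_superset (h.isOpen_dom.mem_nhds hx) h.coord_par)

theorem tangentSpaceAt_eq (h : IsParam L dom cod par coord) {x : Fin n → ℝ} (hx : x ∈ dom) :
    tangentSpaceAt L (par x) = LinearMap.range (fderiv ℝ par x : (Fin n → ℝ) →ₗ[ℝ] Space n) := by
  apply le_antisymm
  · refine Submodule.span_le.2 ?_
    rintro v ⟨c, hc0, hcL, hc⟩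
    refine ⟨fderiv ℝ coord (par x) v, ?_⟩
    have hc0' : c 0 ∈ cod := by rw [hc0]; exact h.par_mem_cod x hx
    have h1 : HasDerivAt (coord ∘ c) (fderiv ℝ coord (par x) v) 0 := by
      refine HasFDerivAt.comp_hasDerivAt (0 : ℝ) ?_ hc
      rw [hc0]
      exact (h.differentiableAt_coord (h.par_mem_cod x hx)).hasFDerivAt
    have hx0 : (coord ∘ c) 0 = x := by simp [hc0, h.coord_par x hx]
    have h2 : HasDerivAt (par ∘ coord ∘ c) (fderiv ℝ par x (fderiv ℝ coord (par x) v)) 0 := by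
      refine HasFDerivAt.comp_hasDerivAt (0 : ℝ) ?_ h1
      rw [hx0]
      exact (h.differentiableAt_par x).hasFDerivAt
    have h3 : par ∘ coord ∘ c =ᶠ[𝓝 0] c := by
      filter_upwards [hcL, hc.continuousAt.eventually (h.isOpen_cod.mem_nhds hc0')] with t ht ht'
      exact h.par_coord _ ht ht'
    exact (h2.congr_of_eventuallyEq h3.symm).unique hc
  · rintro _ ⟨v, rfl⟩
    exact h.fderiv_par_mem hx v

end IsParam

theorem contDiff_smul_of_tsupport_subset {X F : Type*} [NormedAddCommGroup X] [NormedSpace ℝ X]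
    [NormedAddCommGroup F] [NormedSpace ℝ F] {χ : X → ℝ} (hχ : ContDiff ℝ ∞ χ) {f : X → F}
    {D : Set X} (hD : IsOpen D) (hf : ContDiffOn ℝ ∞ f D) (hχD : tsupport χ ⊆ D) :
    ContDiff ℝ ∞ fun x => χ x • f x := by
  rw [contDiff_iff_contDiffAt]
  intro x
  by_cases hx : x ∈ tsupport χ
  · exact hχ.contDiffAt.smul (hf.contDiffAt (hD.mem_nhds (hχD hx)))
  · refine (contDiffAt_const (c := (0 : F))).congr_of_eventuallyEq ?_
    filter_upwards [notMem_tsupport_iff_eventuallyEq.1 hx] with y hy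
    rw [hy, Pi.zero_apply, zero_smul]

/-- Around each point, an oriented submanifold has a parametrization of constant sign. -/
theorem exists_isParam {L : Set (Space n)} (hL : IsSubmanifold L) {τ : FormField n}
    (hτ : IsOrientation L τ) {p : Space n} (hp : p ∈ L) :
    ∃ dom cod par coord, ∃ σ : ℝ, IsParam L dom cod par coord ∧ p ∈ cod ∧ (σ = 1 ∨ σ = -1) ∧
      ∀ x ∈ dom, 0 < σ * τ (par x) fun k => fderiv ℝ par x (Pi.single k 1) := by
  obtain ⟨Φ, hpΦ, hΦ, hΦs, hslice⟩ := hL p hp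
  set ψ : (Fin n → ℝ) → Space n := fun u => Φ.symm (u, 0) with hψ
  set D : Set (Fin n → ℝ) := {u | (u, (0 : Fin (n + 1) → ℝ)) ∈ Φ.target} with hD
  have hι : ContDiff ℝ ∞ fun u : Fin n → ℝ => (u, (0 : Fin (n + 1) → ℝ)) :=
    contDiff_id.prodMk contDiff_const
  have hDo : IsOpen D := Φ.open_target.preimage hι.continuous
  have hψD : ContDiffOn ℝ ∞ ψ D := hΦs.comp hι.contDiffOn fun u hu => hu
  have hψsrc : ∀ u ∈ D, ψ u ∈ Φ.source := fun u hu => Φ.map_target hu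
  have hΦψ : ∀ u ∈ D, Φ (ψ u) = (u, 0) := fun u hu => Φ.right_inv hu
  have hψL : ∀ u ∈ D, ψ u ∈ L := fun u hu => by
    rw [hslice _ (hψsrc u hu), hΦψ u hu]
  set c : Space n → Fin n → ℝ := fun x => (Φ x).1 with hc
  have hcs : ContDiffOn ℝ ∞ c Φ.source := contDiff_fst.comp_contDiffOn hΦ
  have hu0 : ((Φ p).1, (0 : Fin (n + 1) → ℝ)) = Φ p := by
    ext1
    · rfl
    · exact ((hslice p hpΦ).1 hp).symm
  set u0 := (Φ p).1
  have hu0D : u0 ∈ D := by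
    change (u0, (0 : Fin (n + 1) → ℝ)) ∈ Φ.target
    rw [hu0]; exact Φ.map_source hpΦ
  set s : (Fin n → ℝ) → ℝ := fun u => τ (ψ u) fun k => fderiv ℝ ψ u (Pi.single k 1) with hs
  have hψd : ∀ u ∈ D, DifferentiableAt ℝ ψ u := fun u hu =>
    (hψD.differentiableOn (by simp)).differentiableAt (hDo.mem_nhds hu)
  have hs0 : ∀ u ∈ D, s u ≠ 0 := by
    intro u hu
    refine hτ.nonvanishing _ (hψL u hu) _ (fun k => ?_) ?_
    · exact fderiv_mem_tangentSpaceAt (hψd u hu) (Filter.mem_of_superset (hDo.mem_nhds hu) hψL) _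
    · refine linearIndependent_fderiv (g := c) (hψd u hu) ?_ ?_
      · exact (hcs.differentiableOn (by simp)).differentiableAt
          (Φ.open_source.mem_nhds (hψsrc u hu))
      · filter_upwards [hDo.mem_nhds hu] with y hy
        simp only [hc, hΦψ y hy]
  have hsc : ContinuousOn s D := by
    have h1 : ContinuousOn (fun u => τ (ψ u)) D := hτ.continuousOn.comp hψD.continuousOn hψL
    have h2 : ContinuousOn (fun u => fderiv ℝ ψ u) D :=
      hψD.continuousOn_fderiv_of_isOpen hDo (by simp)
    intro u hu
    have h3 : ContinuousWithinAt (fun u => (τ (ψ u), fun k : Fin n =>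
        fderiv ℝ ψ u (Pi.single k 1))) D u := by
      refine (h1 u hu).prodMk ?_
      rw [continuousWithinAt_pi]
      intro k
      exact (h2 u hu).clm_apply continuousWithinAt_const
    have h4 : Continuous fun q : ((Space n) [⋀^Fin n]→L[ℝ] ℝ) × (Fin n → Space n) => q.1 q.2 :=
      continuous_eval
    exact h4.continuousAt.comp_continuousWithinAt h3
  obtain ⟨σ, hσ, hσ0⟩ : ∃ σ : ℝ, (σ = 1 ∨ σ = -1) ∧ 0 < σ * s u0 := by
    rcases lt_or_gt_of_ne (hs0 u0 hu0D) with h | h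
    · exact ⟨-1, Or.inr rfl, by linarith⟩
    · exact ⟨1, Or.inl rfl, by linarith⟩
  have hnear : ∀ᶠ u in 𝓝 u0, u ∈ D ∧ 0 < σ * s u := by
    refine Filter.Eventually.and (hDo.mem_nhds hu0D) ?_
    exact (continuousAt_const.mul (hsc.continuousAt (hDo.mem_nhds hu0D))).eventually
      (lt_mem_nhds hσ0)
  obtain ⟨r, hr, hrD⟩ := Metric.nhds_basis_closedBall.eventually_iff.1 hnear
  obtain ⟨χ, hχ, -, hχD, hχ1⟩ := exists_contDiff_eq_one_near (isCompact_closedBall u0 r) hDo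
    fun u hu => (hrD hu).1
  have hpar : ∀ u ∈ Metric.closedBall u0 r, (fun x => χ x • ψ x) =ᶠ[𝓝 u] ψ := by
    intro u hu
    filter_upwards [hχ1 u hu] with y hy
    rw [hy, one_smul]
  have hsub : Metric.ball u0 r ⊆ Metric.closedBall u0 r := Metric.ball_subset_closedBall
  refine ⟨Metric.ball u0 r, Φ.source ∩ Φ ⁻¹' {y | y.1 ∈ Metric.ball u0 r}, fun x => χ x • ψ x, c, σ,
    ?_, ⟨hpΦ, ?_⟩, hσ, ?_⟩
  · refine ⟨Metric.isOpen_ball, ?_, contDiff_smul_of_tsupport_subset hχ hDo hψD hχD,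
      hcs.mono inter_subset_left, ?_, ?_, ?_, ?_, ?_⟩
    · exact Φ.continuousOn.isOpen_inter_preimage Φ.open_source
        (Metric.isOpen_ball.preimage continuous_fst)
    · intro u hu
      rw [(hpar u (hsub hu)).eq_of_nhds]
      exact hψL u (hrD (hsub hu)).1
    · intro u hu
      rw [(hpar u (hsub hu)).eq_of_nhds]
      refine ⟨hψsrc u (hrD (hsub hu)).1, ?_⟩
      rw [mem_preimage, hΦψ u (hrD (hsub hu)).1]
      exact hu
    · intro u hu
      rw [(hpar u (hsub hu)).eq_of_nhds]
      simp only [hc, hΦψ u (hrD (hsub hu)).1]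
    · intro q _ hq
      exact hq.2
    · intro q hqL hq
      have h1 : c q ∈ Metric.ball u0 r := hq.2
      rw [(hpar _ (hsub h1)).eq_of_nhds]
      have h2 : (c q, (0 : Fin (n + 1) → ℝ)) = Φ q := by
        ext1
        · rfl
        · exact ((hslice q hq.1).1 hqL).symm
      simp only [hψ]
      rw [h2]
      exact Φ.left_inv hq.1
  · exact Metric.mem_ball_self hr
  · intro u hu
    rw [(hpar u (hsub hu)).fderiv_eq]
    have h1 := (hrD (hsub hu)).2
    have h2 : (fun x => χ x • ψ x) u = ψ u := (hpar u (hsub hu)).eq_of_nhds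
    rwa [h2]

/-- A compact oriented submanifold has a finite oriented atlas, in which the sign of a chart tells
whether the coordinate frame is positively oriented. -/
theorem exists_orientedAtlas {L : Set (Space n)} (hL : IsSubmanifold L) (hc : IsCompact L)
    {τ : FormField n} (hτ : IsOrientation L τ) :
    ∃ (ι : Type) (_ : Fintype ι) (A : OrientedAtlas ι (Fin n → ℝ) (Space n) L), ∀ i,
      IsParam L (A.dom i) (A.cod i) (A.par i) (A.coord i) ∧
      ∀ x ∈ A.dom i, 0 < A.sign i * τ (A.par i x) fun k => fderiv ℝ (A.par i) x (Pi.single k 1) :=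
          by
  have hex := fun p : L => exists_isParam hL hτ p.2
  choose dom cod par coord σ hpar hpcod hσ hpos using hex
  obtain ⟨t, ht⟩ := hc.elim_finite_subcover (fun p : L => cod p) (fun p => (hpar p).isOpen_cod)
    fun p hp => mem_iUnion.2 ⟨⟨p, hp⟩, hpcod ⟨p, hp⟩⟩
  obtain ⟨f, hf⟩ := SmoothPartitionOfUnity.exists_isSubordinate (modelWithCornersSelf ℝ (Space n))
    hc.isClosed (fun i : t => cod i) (fun i => (hpar i).isOpen_cod) (by
      intro p hp
      obtain ⟨q, hq, hpq⟩ := mem_iUnion₂.1 (ht hp)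
      exact mem_iUnion.2 ⟨⟨q, hq⟩, hpq⟩)
  have hcompat : ∀ i j : t, ∀ x ∈ dom i, par i x ∈ cod j →
      0 < σ i * σ j * (fderiv ℝ (coord j ∘ par i) x).det := by
    intro i j x hx hxj
    have hd : DifferentiableAt ℝ (coord j ∘ par i) x :=
      ((hpar j).differentiableAt_coord hxj).comp x ((hpar i).differentiableAt_par x)
    have hpj : par j (coord j (par i x)) = par i x := (hpar j).par_coord _ ((hpar i).par_mem x hx)
        hxj
    have h1 : par i =ᶠ[𝓝 x] par j ∘ (coord j ∘ par i) := by
      have h2 : IsOpen (dom i ∩ par i ⁻¹' cod j) := (hpar i).isOpen_dom.inter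
        ((hpar j).isOpen_cod.preimage (hpar i).contDiff_par.continuous)
      filter_upwards [h2.mem_nhds ⟨hx, hxj⟩] with y hy
      exact ((hpar j).par_coord _ ((hpar i).par_mem y hy.1) hy.2).symm
    have h2 : fderiv ℝ (par i) x = (fderiv ℝ (par j) (coord j (par i x))).comp
        (fderiv ℝ (coord j ∘ par i) x) := by
      rw [h1.fderiv_eq, fderiv_comp x ((hpar j).differentiableAt_par _) hd]
      rfl
    have h3 := hpos i x hx
    have h4 := hpos j _ ((hpar j).coord_mem _ ((hpar i).par_mem x hx) hxj)
    rw [hpj] at h4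
    have h5 := map_comp_eq_det_mul (τ (par i x)).toAlternatingMap
      (fderiv ℝ (par j) (coord j (par i x)) : _ →ₗ[ℝ] Space n)
      (fderiv ℝ (coord j ∘ par i) x : _ →ₗ[ℝ] (Fin n → ℝ))
    rw [h2] at h3
    have h6 : 0 < σ i * ((fderiv ℝ (coord j ∘ par i) x).det *
        τ (par i x) fun k => fderiv ℝ (par j) (coord j (par i x)) (Pi.single k 1)) := by
      refine lt_of_lt_of_eq h3 ?_
      congr 1
    set d := (fderiv ℝ (coord j ∘ par i) x).det
    set T := τ (par i x) fun k => fderiv ℝ (par j) (coord j (par i x)) (Pi.single k 1)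
    have h7 : 0 < (σ i * (d * T)) * (σ j * T) := mul_pos h6 h4
    have h8 : (σ i * (d * T)) * (σ j * T) = (σ i * σ j * d) * T ^ 2 := by ring
    rw [h8] at h7
    exact pos_of_mul_pos_left h7 (sq_nonneg T)
  refine ⟨t, inferInstance, ⟨fun i => dom i, fun i => cod i, fun i => par i, fun i => coord i,
    fun i => f i, fun i => σ i, fun i => (hpar i).isOpen_dom, fun i => (hpar i).isOpen_cod,
    fun i => (hpar i).contDiff_par, fun i => (hpar i).contDiffOn_coord, fun i => (hpar i).par_mem,
    fun i => (hpar i).par_mem_cod, fun i => (hpar i).coord_par, fun i => (hpar i).coord_mem,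
    fun i => (hpar i).par_coord, fun i => (f i).contMDiff.contDiff,
    fun i p => ⟨f.nonneg i p, f.le_one i p⟩, hf, fun p hp => ?_, fun i => hσ i, hcompat⟩,
    fun i => ⟨hpar i, hpos i⟩⟩
  rw [← finsum_eq_sum_of_fintype]
  exact f.sum_eq_one hp

end LegendrianTB
end

noncomputable section
namespace LegendrianTB

/-! ### Products of oriented atlases -/

open MeasureTheory Set

namespace OrientedAtlas

theorem tsupport_mul_prod_subset {E F : Type*} [TopologicalSpace E] [TopologicalSpace F]
    (f : E → ℝ) (g : F → ℝ) :
    tsupport (fun q : E × F => f q.1 * g q.2) ⊆ tsupport f ×ˢ tsupport g := by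
  refine closure_minimal (fun q hq => ?_) ((isClosed_tsupport f).prod (isClosed_tsupport g))
  have h1 : f q.1 * g q.2 ≠ 0 := hq
  exact ⟨subset_tsupport _ (left_ne_zero_of_mul h1), subset_tsupport _ (right_ne_zero_of_mul h1)⟩

/-- The product of two oriented atlases. -/
def prod {ι κ X Y E F : Type*} [Fintype ι] [Fintype κ] [NormedAddCommGroup X] [NormedSpace ℝ X]
    [NormedAddCommGroup Y] [NormedSpace ℝ Y] [NormedAddCommGroup E] [NormedSpace ℝ E]
    [NormedAddCommGroup F] [NormedSpace ℝ F] [FiniteDimensional ℝ X] [FiniteDimensional ℝ Y]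
    {M : Set E} {M' : Set F} (A : OrientedAtlas ι X E M) (B : OrientedAtlas κ Y F M') :
    OrientedAtlas (ι × κ) (X × Y) (E × F) (M ×ˢ M') where
  dom k := A.dom k.1 ×ˢ B.dom k.2
  cod k := A.cod k.1 ×ˢ B.cod k.2
  par k := Prod.map (A.par k.1) (B.par k.2)
  coord k := Prod.map (A.coord k.1) (B.coord k.2)
  weight k p := A.weight k.1 p.1 * B.weight k.2 p.2
  sign k := A.sign k.1 * B.sign k.2
  isOpen_dom k := (A.isOpen_dom _).prod (B.isOpen_dom _)
  isOpen_cod k := (A.isOpen_cod _).prod (B.isOpen_cod _)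
  contDiff_par k := (A.contDiff_par _).prodMap (B.contDiff_par _)
  contDiffOn_coord k := (A.contDiffOn_coord _).prodMap (B.contDiffOn_coord _)
  par_mem k x hx := ⟨A.par_mem _ _ hx.1, B.par_mem _ _ hx.2⟩
  par_mem_cod k x hx := ⟨A.par_mem_cod _ _ hx.1, B.par_mem_cod _ _ hx.2⟩
  coord_par k x hx := Prod.ext (A.coord_par _ _ hx.1) (B.coord_par _ _ hx.2)
  coord_mem k p hp hpk := ⟨A.coord_mem _ _ hp.1 hpk.1, B.coord_mem _ _ hp.2 hpk.2⟩
  par_coord k p hp hpk := Prod.ext (A.par_coord _ _ hp.1 hpk.1) (B.par_coord _ _ hp.2 hpk.2)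
  contDiff_weight k := ((A.contDiff_weight _).comp contDiff_fst).mul
    ((B.contDiff_weight _).comp contDiff_snd)
  weight_mem k p := by
    have h1 := A.weight_mem k.1 p.1
    have h2 := B.weight_mem k.2 p.2
    exact ⟨mul_nonneg h1.1 h2.1, mul_le_one₀ h1.2 h2.1 h2.2⟩
  tsupport_weight k := (tsupport_mul_prod_subset _ _).trans
    (prod_mono (A.tsupport_weight _) (B.tsupport_weight _))
  sum_weight p hp := by
    rw [Fintype.sum_prod_type]
    simp only
    simp_rw [← Finset.mul_sum, B.sum_weight _ hp.2, mul_one, A.sum_weight _ hp.1]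
  sign_eq k := by
    rcases A.sign_eq k.1 with h1 | h1 <;> rcases B.sign_eq k.2 with h2 | h2 <;> simp [h1, h2]
  sign_compat i j x hx hxj := by
    have h1 := A.sign_compat i.1 j.1 x.1 hx.1 hxj.1
    have h2 := B.sign_compat i.2 j.2 x.2 hx.2 hxj.2
    have h3 : HasFDerivAt (Prod.map (A.coord j.1 ∘ A.par i.1) (B.coord j.2 ∘ B.par i.2))
        ((fderiv ℝ (A.coord j.1 ∘ A.par i.1) x.1).prodMap
          (fderiv ℝ (B.coord j.2 ∘ B.par i.2) x.2)) x :=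
      HasFDerivAt.prodMap x (A.differentiableAt_transition hxj.1).hasFDerivAt
        (B.differentiableAt_transition hxj.2).hasFDerivAt
    have h4 : (Prod.map (A.coord j.1) (B.coord j.2)) ∘ (Prod.map (A.par i.1) (B.par i.2)) =
        Prod.map (A.coord j.1 ∘ A.par i.1) (B.coord j.2 ∘ B.par i.2) := rfl
    rw [h4, h3.fderiv]
    have h5 : ((fderiv ℝ (A.coord j.1 ∘ A.par i.1) x.1).prodMap
          (fderiv ℝ (B.coord j.2 ∘ B.par i.2) x.2)).det =
        (fderiv ℝ (A.coord j.1 ∘ A.par i.1) x.1).det *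
          (fderiv ℝ (B.coord j.2 ∘ B.par i.2) x.2).det := LinearMap.det_prodMap _ _
    rw [h5]
    refine lt_of_lt_of_eq (mul_pos h1 h2) ?_
    ring

/-- The atlas of the line that consists of the identity. -/
def line : OrientedAtlas Unit ℝ ℝ (univ : Set ℝ) where
  dom _ := univ
  cod _ := univ
  par _ := id
  coord _ := id
  weight _ _ := 1
  sign _ := 1
  isOpen_dom _ := isOpen_univ
  isOpen_cod _ := isOpen_univ
  contDiff_par _ := contDiff_id
  contDiffOn_coord _ := contDiffOn_id
  par_mem _ _ _ := mem_univ _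
  par_mem_cod _ _ _ := mem_univ _
  coord_par _ _ _ := rfl
  coord_mem _ _ _ _ := mem_univ _
  par_coord _ _ _ _ := rfl
  contDiff_weight _ := contDiff_const
  weight_mem _ _ := ⟨zero_le_one, le_rfl⟩
  tsupport_weight _ := subset_univ _
  sum_weight _ _ := by simp
  sign_eq _ := Or.inl rfl
  sign_compat _ _ x _ _ := by
    have h1 : fderiv ℝ (id ∘ id : ℝ → ℝ) x = ContinuousLinearMap.id ℝ ℝ := fderiv_id
    have h2 : (ContinuousLinearMap.id ℝ ℝ).det = 1 := LinearMap.det_id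
    rw [h1, h2]
    norm_num

/-- The change of the model space of an atlas by a linear isomorphism. -/
def congrModel {ι X Y E : Type*} [Fintype ι] [NormedAddCommGroup X] [NormedSpace ℝ X]
    [NormedAddCommGroup Y] [NormedSpace ℝ Y] [NormedAddCommGroup E] [NormedSpace ℝ E]
    {M : Set E} (A : OrientedAtlas ι X E M) (L : Y ≃L[ℝ] X) : OrientedAtlas ι Y E M where
  dom k := L ⁻¹' A.dom k
  cod := A.cod
  par k := A.par k ∘ L
  coord k := L.symm ∘ A.coord k
  weight := A.weight
  sign := A.sign
  isOpen_dom k := (A.isOpen_dom k).preimage L.continuous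
  isOpen_cod := A.isOpen_cod
  contDiff_par k := (A.contDiff_par k).comp L.contDiff
  contDiffOn_coord k := L.symm.contDiff.comp_contDiffOn (A.contDiffOn_coord k)
  par_mem k x hx := A.par_mem k _ hx
  par_mem_cod k x hx := A.par_mem_cod k _ hx
  coord_par k x hx := by simp [A.coord_par k _ hx]
  coord_mem k p hp hpk := by simpa using A.coord_mem k p hp hpk
  par_coord k p hp hpk := by simpa using A.par_coord k p hp hpk
  contDiff_weight := A.contDiff_weight
  weight_mem := A.weight_mem
  tsupport_weight := A.tsupport_weight
  sum_weight := A.sum_weight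
  sign_eq := A.sign_eq
  sign_compat i j x hx hxj := by
    have h1 := A.sign_compat i j (L x) hx hxj
    have h2 := (A.differentiableAt_transition (i := i) (j := j) (x := L x) hxj).hasFDerivAt
    have h3 : HasFDerivAt ((L.symm ∘ A.coord j) ∘ (A.par i ∘ L))
        ((L.symm : X →L[ℝ] Y).comp ((fderiv ℝ (A.coord j ∘ A.par i) (L x)).comp
          (L : Y →L[ℝ] X))) x :=
      L.symm.hasFDerivAt.comp x (h2.comp x L.hasFDerivAt)
    rw [h3.fderiv]
    have h4 : ((L.symm : X →L[ℝ] Y).comp ((fderiv ℝ (A.coord j ∘ A.par i) (L x)).comp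
          (L : Y →L[ℝ] X))).det = (fderiv ℝ (A.coord j ∘ A.par i) (L x)).det :=
      LinearMap.det_conj (fderiv ℝ (A.coord j ∘ A.par i) (L x) : X →ₗ[ℝ] X)
        (L.symm : X ≃ₗ[ℝ] Y)
    rw [h4]
    exact h1

section

variable {ι E : Type*} [Fintype ι] [NormedAddCommGroup E] [NormedSpace ℝ E] {M : Set E}
  {N : ℕ} (A : OrientedAtlas ι (Fin N → ℝ) E M)

theorem degIntegral_congr {φ : (Fin N → ℝ) → ℝ} {H H' : E → Fin N → ℝ} (Z : Set E)
    (h : ∀ p ∈ M, H p = H' p) : A.degIntegral φ H Z = A.degIntegral φ H' Z := by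
  simp only [degIntegral, total]
  refine Finset.sum_congr rfl fun i _ => ?_
  refine setIntegral_congr_fun (A.isOpen_dom i).measurableSet fun x hx => ?_
  simp only [degFamily]
  rw [degDensity_congr]
  filter_upwards [(A.isOpen_dom i).mem_nhds hx] with y hy
  exact h _ (A.par_mem i y hy)

end

end OrientedAtlas

/-! ### The linking number does not depend on the chain -/

variable {n : ℕ}

/-- The splitting of the coordinates of `ℝ²ⁿ⁺¹` into one, `n` and `n` coordinates; the first one
is listed last in the product. -/
def splitCoords (n : ℕ) :
    (Fin (n + n + 1) → ℝ) ≃L[ℝ] ((Fin n → ℝ) × (Fin n → ℝ)) × ℝ :=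
  LinearEquiv.toContinuousLinearEquiv
    { toFun := fun x => ((fun l => x (Fin.castAdd n l).succ, fun l => x (Fin.natAdd n l).succ), x 0)
      invFun := fun y => Fin.cons y.2 (Fin.append y.1.1 y.1.2)
      map_add' := fun _ _ => rfl
      map_smul' := fun _ _ => rfl
      left_inv := fun x => by
        ext k
        refine Fin.cases rfl (fun l => ?_) k
        refine Fin.addCases (fun i => ?_) (fun i => ?_) l
        · simp only [Fin.cons_succ, Fin.append_left]
        · simp only [Fin.cons_succ, Fin.append_right]
      right_inv := fun y => by
        refine Prod.ext (Prod.ext ?_ ?_) rfl <;> ext l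
        · simp only [Fin.cons_succ, Fin.append_left]
        · simp only [Fin.cons_succ, Fin.append_right] }

/-- The coordinates of a vector of `ℝ²ⁿ⁺¹` as a linear map. -/
def coordsCLM (n : ℕ) : Space n →L[ℝ] (Fin (n + n + 1) → ℝ) :=
  LinearMap.toContinuousLinearMap
    { toFun := coords
      map_add' := fun v w => by
        ext k
        simp only [coords, Pi.add_apply]
        split_ifs <;> simp
      map_smul' := fun c v => by
        ext k
        simp only [coords, Pi.smul_apply]
        split_ifs <;> simp }

theorem coordsCLM_injective : Function.Injective (coordsCLM n) := by
  intro v w h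
  have hk : ∀ k, coords v k = coords w k := fun k => congrFun h k
  ext j
  · have h1 := hk ⟨2 * j, by omega⟩
    have h2 := hk ⟨2 * j + 1, by omega⟩
    have e1 : 2 * (j : ℕ) / 2 = j := by omega
    have e2 : (2 * (j : ℕ) + 1) / 2 = j := by omega
    have e3 : 2 * (j : ℕ) % 2 = 0 := by omega
    have e4 : ¬ (2 * (j : ℕ) + 1) % 2 = 0 := by omega
    simp only [coords, e1, e3, j.2, dif_pos, if_true] at h1
    simp only [coords, e2, e4, j.2, dif_pos, if_false] at h2
    exact Complex.ext h1 h2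
  · have h1 := hk (Fin.last _)
    have e1 : ¬ ((n + n) / 2 < n) := by omega
    simpa [coords, e1] using h1

theorem orientDet_eq_volForm (w : Fin (n + n + 1) → Space n) :
    orientDet w = volForm _ fun i => coordsCLM n (w i) := rfl

theorem orientDet_smul (c : Fin (n + n + 1) → ℝ) (w : Fin (n + n + 1) → Space n) :
    (orientDet fun i => c i • w i) = (∏ i, c i) * orientDet w := by
  simp only [orientDet_eq_volForm, map_smul]
  exact (volForm _).toMultilinearMap.map_smul_univ c _

theorem orientDet_cons_append_smul (c : ℝ) (α β : Fin n → ℝ) (w : Space n)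
    (e f : Fin n → Space n) :
    orientDet (Fin.cons (c • w) (Fin.append (fun i => α i • e i) fun i => β i • f i)) =
      c * ((∏ i, α i) * ∏ i, β i) * orientDet (Fin.cons w (Fin.append e f)) := by
  have h1 := orientDet_smul (Fin.cons c (Fin.append α β)) (Fin.cons w (Fin.append e f))
  rw [Fin.prod_univ_succ, Fin.prod_univ_add] at h1
  simp only [Fin.cons_zero, Fin.cons_succ, Fin.append_left, Fin.append_right] at h1
  rw [← h1]
  congr 1
  ext1 k
  refine Fin.cases rfl (fun l => ?_) k
  refine Fin.addCases (fun i => ?_) (fun i => ?_) l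
  · simp only [Fin.cons_succ, Fin.append_left]
  · simp only [Fin.cons_succ, Fin.append_right]

/-- The local intersection number determines the sign of the determinant for frames of any
orientation. -/
theorem IsLocalIntersectionNumber.pos_mul_orientDet (hn : 1 ≤ n) {K : Set (Space n)}
    {τ : FormField n} {J : Set (Space n)} {σ : FormField n} {F : Space n × ℝ → Space n}
    {x : Space n × ℝ} {δ : ℤ} (h : IsLocalIntersectionNumber K τ J σ F x δ) {a b : ℝ}
    {e f : Fin n → Space n} (he : ∀ i, e i ∈ tangentSpaceAt K x.1)
    (hf : ∀ i, f i ∈ tangentSpaceAt J (F x)) (hae : 0 < a * τ x.1 e) (hbf : 0 < b * σ (F x) f) :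
    0 < (δ : ℝ) * (a * b) * orientDet (Fin.cons (fderiv ℝ F x (0, -1))
        (Fin.append (fun i => fderiv ℝ F x (e i, 0)) f)) := by
  have : NeZero n := ⟨by omega⟩
  set α : Fin n → ℝ := fun i => if i = 0 then a else 1 with hα
  set β : Fin n → ℝ := fun i => if i = 0 then b else 1 with hβ
  have hαp : ∏ i, α i = a := by simp [hα]
  have hβp : ∏ i, β i = b := by simp [hβ]
  have h1 := h.2 (fun i => α i • e i) (fun i => β i • f i)
    ⟨fun i => Submodule.smul_mem _ _ (he i), by
      have := (τ x.1).toMultilinearMap.map_smul_univ α e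
      rw [hαp] at this
      exact lt_of_lt_of_eq hae this.symm⟩
    ⟨fun i => Submodule.smul_mem _ _ (hf i), by
      have := (σ (F x)).toMultilinearMap.map_smul_univ β f
      rw [hβp] at this
      exact lt_of_lt_of_eq hbf this.symm⟩
  have h2 : (fun i => fderiv ℝ F x (α i • e i, 0)) = fun i => α i • fderiv ℝ F x (e i, 0) := by
    ext1 i
    rw [← map_smul, show α i • (e i, (0 : ℝ)) = (α i • e i, 0) from Prod.ext rfl (smul_zero _)]
  have h3 := orientDet_cons_append_smul 1 α β (fderiv ℝ F x (0, -1))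
    (fun i => fderiv ℝ F x (e i, 0)) f
  rw [one_smul, one_mul, hαp, hβp] at h3
  rw [h2, h3, ← mul_assoc] at h1
  exact h1

/-- The map whose zeros are the intersections of the chain `F` with `J`. -/
def gapMap (F : Space n × ℝ → Space n) (z : (Space n × Space n) × ℝ) : Fin (n + n + 1) → ℝ :=
  coordsCLM n (F (z.1.1, z.2) - z.1.2)

theorem contDiff_gapMap {F : Space n × ℝ → Space n} (hF : ContDiff ℝ ∞ F) :
    ContDiff ℝ ∞ (gapMap F) := by
  refine (coordsCLM n).contDiff.comp (ContDiff.sub (hF.comp ?_) ?_)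
  · exact (contDiff_fst.comp contDiff_fst).prodMk contDiff_snd
  · exact contDiff_snd.comp contDiff_fst

/-- The atlas of `K × J × ℝ` obtained from atlases of `K` and `J`; the first coordinate is that
of `ℝ`. -/
def cylinderAtlas {ι κ : Type*} [Fintype ι] [Fintype κ] {K J : Set (Space n)}
    (A : OrientedAtlas ι (Fin n → ℝ) (Space n) K) (B : OrientedAtlas κ (Fin n → ℝ) (Space n) J) :
    OrientedAtlas ((ι × κ) × Unit) (Fin (n + n + 1) → ℝ) ((Space n × Space n) × ℝ)
      ((K ×ˢ J) ×ˢ univ) :=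
  ((A.prod B).prod OrientedAtlas.line).congrModel (splitCoords n)

/-- The Jacobian of the gap map in a chart of `K × J × ℝ`. -/
theorem det_fderiv_gapMap {F : Space n × ℝ → Space n} (hF : ContDiff ℝ ∞ F)
    {f g : (Fin n → ℝ) → Space n} (hf : ContDiff ℝ ∞ f) (hg : ContDiff ℝ ∞ g)
    (x : Fin (n + n + 1) → ℝ) {p y : Space n} {u v : Fin n → ℝ} {s : ℝ}
    (hx : splitCoords n x = ((u, v), s)) (hp : f u = p) (hy : g v = y) :
    (fderiv ℝ (gapMap F ∘ (Prod.map (Prod.map f g) id) ∘ splitCoords n) x).det =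
      (-1) ^ (n + 1) * orientDet (Fin.cons (fderiv ℝ F (p, s) (0, -1))
        (Fin.append (fun i => fderiv ℝ F (p, s) (fderiv ℝ f u (Pi.single i 1), 0))
          fun i => fderiv ℝ g v (Pi.single i 1))) := by
  have hsplit : HasFDerivAt (splitCoords n)
      (splitCoords n : (Fin (n + n + 1) → ℝ) →L[ℝ] ((Fin n → ℝ) × (Fin n → ℝ)) × ℝ) x :=
    (splitCoords n).hasFDerivAt
  have h1 : HasFDerivAt (Prod.map (Prod.map f g) (id : ℝ → ℝ))
      (((fderiv ℝ f u).prodMap (fderiv ℝ g v)).prodMap (ContinuousLinearMap.id ℝ ℝ))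
      (splitCoords n x) := by
    rw [hx]
    refine HasFDerivAt.prodMap (p := ((u, v), s)) ?_ (hasFDerivAt_id s)
    exact HasFDerivAt.prodMap (p := (u, v)) (hf.differentiable (by simp) u).hasFDerivAt
      (hg.differentiable (by simp) v).hasFDerivAt
  have h2 : HasFDerivAt (gapMap F) ((coordsCLM n).comp ((fderiv ℝ F (p, s)).comp
      (((ContinuousLinearMap.fst ℝ _ _).comp (ContinuousLinearMap.fst ℝ _ _)).prod
        (ContinuousLinearMap.snd ℝ (Space n × Space n) ℝ)) -
      (ContinuousLinearMap.snd ℝ (Space n) (Space n)).comp (ContinuousLinearMap.fst ℝ _ _)))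
      (Prod.map (Prod.map f g) (id : ℝ → ℝ) (splitCoords n x)) := by
    rw [hx]
    simp only [Prod.map_apply, hp, hy, id]
    refine (coordsCLM n).hasFDerivAt.comp _ (HasFDerivAt.sub ?_ ?_)
    · exact HasFDerivAt.comp (f := fun z : (Space n × Space n) × ℝ => (z.1.1, z.2))
        ((p, y), s) (hF.differentiable (by simp) (p, s)).hasFDerivAt
        (((ContinuousLinearMap.fst ℝ (Space n) (Space n)).comp
          (ContinuousLinearMap.fst ℝ (Space n × Space n) ℝ)).prod
            (ContinuousLinearMap.snd ℝ (Space n × Space n) ℝ)).hasFDerivAt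
    · exact ((ContinuousLinearMap.snd ℝ (Space n) (Space n)).comp
        (ContinuousLinearMap.fst ℝ (Space n × Space n) ℝ)).hasFDerivAt
  have h3 := (h2.comp x (h1.comp x hsplit)).fderiv
  rw [h3, ← volForm_comp]
  have h4 := orientDet_cons_append_smul (-1) (fun _ => 1) (fun _ => -1)
    (fderiv ℝ F (p, s) (0, -1))
    (fun i => fderiv ℝ F (p, s) (fderiv ℝ f u (Pi.single i 1), 0))
    (fun i => fderiv ℝ g v (Pi.single i 1))
  have h5 : (-1 : ℝ) ^ (n + 1) = -1 * ((∏ _i : Fin n, 1) * ∏ _i : Fin n, -1) := by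
    simp only [Finset.prod_const, Finset.card_univ, Fintype.card_fin]
    ring
  rw [h5, ← h4, orientDet_eq_volForm]
  congr 1
  ext1 k
  simp only [ContinuousLinearMap.comp_apply, ContinuousLinearEquiv.coe_coe]
  congr 1
  have hs1 : ∀ k : Fin (n + n + 1), splitCoords n (Pi.single k 1) =
    ((fun l => (Pi.single k 1 : Fin (n + n + 1) → ℝ) (Fin.castAdd n l).succ,
      fun l => (Pi.single k 1 : Fin (n + n + 1) → ℝ) (Fin.natAdd n l).succ),
      (Pi.single k 1 : Fin (n + n + 1) → ℝ) 0) := fun k => rfl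
  refine Fin.cases ?_ (fun l => ?_) k
  · have e0 : splitCoords n (Pi.single 0 1) = ((0, 0), 1) := by
      rw [hs1]; ext <;> simp
    rw [e0]
    have : ((0 : Space n), (-1 : ℝ)) = -(0, 1) := by simp
    rw [this, map_neg]
    simp
  · refine Fin.addCases (fun i => ?_) (fun i => ?_) l
    · have e0 : splitCoords n (Pi.single (Fin.castAdd n i).succ 1) = ((Pi.single i 1, 0), 0) := by
        rw [hs1]
        refine Prod.ext (Prod.ext ?_ ?_) ?_
        · ext l; simp [Pi.single_apply]
        · ext l; simp [Pi.single_apply, Fin.ext_iff]; omega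
        · simp
      rw [e0]
      simp
    · have e0 : splitCoords n (Pi.single (Fin.natAdd n i).succ 1) = ((0, Pi.single i 1), 0) := by
        rw [hs1]
        refine Prod.ext (Prod.ext ?_ ?_) ?_
        · ext l; simp [Pi.single_apply, Fin.ext_iff]; omega
        · ext l; simp [Pi.single_apply]
        · simp
      rw [e0, Fin.cons_succ, Fin.append_right]
      change fderiv ℝ F (p, s) (fderiv ℝ f u 0, 0) - fderiv ℝ g v (Pi.single i 1) = _
      rw [map_zero, show ((0 : Space n), (0 : ℝ)) = 0 from rfl, map_zero, zero_sub, neg_one_smul]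

end LegendrianTB
end

noncomputable section
namespace LegendrianTB

open MeasureTheory Set

variable {n : ℕ}

section Cylinder

variable {ι κ : Type*} [Fintype ι] [Fintype κ] {K J : Set (Space n)}
    (A : OrientedAtlas ι (Fin n → ℝ) (Space n) K) (B : OrientedAtlas κ (Fin n → ℝ) (Space n) J)

theorem cylinderAtlas_par (k : (ι × κ) × Unit) (x : Fin (n + n + 1) → ℝ) :
    (cylinderAtlas A B).par k x = ((A.par k.1.1 fun l => x (Fin.castAdd n l).succ,
      B.par k.1.2 fun l => x (Fin.natAdd n l).succ), x 0) := rfl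

/-- Along the homotopy from the cone `F` to the cone `F'`, no zero of the gap map escapes through
the apex: there the derivative along `K` and the velocity of the homotopy are both parallel to
`q' - q`. -/
theorem degIntegral_gapMap_eq (hn : 1 ≤ n) (hK : IsCompact K) (hJ : IsCompact J)
    {F F' : Space n × ℝ → Space n} {q q' : Space n} (hF : IsCone K F q) (hF' : IsCone K F' q')
    {φ : (Fin (n + n + 1) → ℝ) → ℝ} (hφ : ContDiff ℝ ∞ φ) :
    (cylinderAtlas A B).degIntegral φ (gapMap F') ((K ×ˢ J) ×ˢ Icc 0 1) =
      (cylinderAtlas A B).degIntegral φ (gapMap F) ((K ×ˢ J) ×ˢ Icc 0 1) := by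
  classical
  set C := cylinderAtlas A B with hC
  set Z : Set ((Space n × Space n) × ℝ) := (K ×ˢ J) ×ˢ Icc 0 1 with hZdef
  have hZ : IsCompact Z := (hK.prod hJ).prod isCompact_Icc
  have hZM : Z ⊆ (K ×ˢ J) ×ˢ univ := prod_mono_right (subset_univ _)
  set G : (Space n × Space n) × ℝ → Fin (n + n + 1) → ℝ := fun z => gapMap F' z - gapMap F z
    with hG
  have hGs : ContDiff ℝ ∞ G := (contDiff_gapMap hF'.smooth).sub (contDiff_gapMap hF.smooth)
  have hslab : ∀ k, ∀ x ∈ C.dom k, C.par k x ∈ Z ↔ x 0 ∈ Icc (0 : ℝ) 1 := by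
    intro k x hx
    have hm := C.par_mem k x hx
    exact ⟨fun h => h.2, fun h => ⟨hm.1, h⟩⟩
  set d : Fin (n + n + 1) → ℝ := coordsCLM n (q' - q) with hd
  set l₀ : Fin (n + n + 1) := (Fin.castAdd n ⟨0, hn⟩).succ with hl₀
  -- the homotopy `F + t (F' - F)` is performed in one chart after the other, by the partition of
  -- unity
  have hstep : ∀ T : Finset ((ι × κ) × Unit),
      C.degIntegral φ (fun z => gapMap F z + (∑ k ∈ T, C.weight k z) • G z) Z =
        C.degIntegral φ (gapMap F) Z := by
    intro T
    induction T using Finset.induction_on with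
    | empty => simp
    | insert k T hkT ih =>
      rw [← ih]
      have hΛ : ContDiff ℝ ∞ fun z => ∑ k ∈ T, C.weight k z :=
        ContDiff.sum fun k _ => C.contDiff_weight k
      have hH : ContDiff ℝ ∞ fun z => gapMap F z + (∑ k ∈ T, C.weight k z) • G z :=
        (contDiff_gapMap hF.smooth).add (hΛ.smul hGs)
      rw [← C.degIntegral_add_weight_smul hZ hZM (i₀ := 0) hslab hH hGs hφ k]
      · congr 1
        ext1 z
        rw [Finset.sum_insert hkT, add_smul]
        abel
      · intro x hx hx0 t
        have hpK : ∀ y, y ∈ C.dom k → (C.par k y).1.1 ∈ K := fun y hy => (C.par_mem k y hy).1.1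
        rcases hx0 with hx0 | hx0
        -- over time `0` both cones are the inclusion of `K`
        · left
          have h1 : G (C.par k x) = 0 := by
            have h2 := hpK x hx
            have h3 : (C.par k x).2 = 0 := hx0
            simp only [hG, gapMap, h3, hF.base _ h2, hF'.base _ h2, sub_self]
          rw [h1, smul_zero]
        -- over time `1` the gap map is a function of the point of `J` plus a multiple `c` of `d`
        · right
          have hGd : ∀ y ∈ C.dom k, y 0 = 1 → G (C.par k y) = d := by
            intro y hy hy0
            have h2 := hpK y hy
            have h3 : (C.par k y).2 = 1 := hy0
            simp only [hG, gapMap, h3, hF.apex _ h2, hF'.apex _ h2, hd]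
            rw [← map_sub]
            congr 1
            abel
          refine ⟨l₀, Fin.succ_ne_zero _, d, C.weight k (C.par k x), ?_⟩
          set c : (Fin (n + n + 1) → ℝ) → ℝ := fun y =>
            (∑ k' ∈ T, C.weight k' (C.par k y)) + t * C.weight k (C.par k y) with hc
          have hcs : ContDiff ℝ ∞ c := by
            refine ContDiff.add (ContDiff.sum fun k _ => ?_) (contDiff_const.mul ?_)
            · exact (C.contDiff_weight _).comp (C.contDiff_par _)
            · exact (C.contDiff_weight _).comp (C.contDiff_par _)
          set f : (Fin (n + n + 1) → ℝ) → Fin (n + n + 1) → ℝ := fun y =>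
            gapMap F (C.par k y) + (∑ k' ∈ T, C.weight k' (C.par k y)) • G (C.par k y) +
              t • C.weight k (C.par k y) • G (C.par k y) with hf
          have hfs : ContDiff ℝ ∞ f := (hH.comp (C.contDiff_par k)).add
            (ContDiff.const_smul t (((C.contDiff_weight k).comp (C.contDiff_par k)).smul
              (hGs.comp (C.contDiff_par k))))
          have hline : HasDerivAt (fun r : ℝ => x + r • (Pi.single l₀ 1 : Fin (n + n + 1) → ℝ))
              (Pi.single l₀ 1) 0 := by
            simpa using ((hasDerivAt_id (0 : ℝ)).smul_const
              (Pi.single l₀ 1 : Fin (n + n + 1) → ℝ)).const_add x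
          have h1 := HasFDerivAt.comp_hasDerivAt (0 : ℝ) (l := f) (l' := fderiv ℝ f x)
            (f := fun r : ℝ => x + r • (Pi.single l₀ 1 : Fin (n + n + 1) → ℝ))
            (by simpa using (hfs.differentiable (by simp) x).hasFDerivAt) hline
          have h2 := HasFDerivAt.comp_hasDerivAt (0 : ℝ) (l := c) (l' := fderiv ℝ c x)
            (f := fun r : ℝ => x + r • (Pi.single l₀ 1 : Fin (n + n + 1) → ℝ))
            (by simpa using (hcs.differentiable (by simp) x).hasFDerivAt) hline
          have h3 := (h2.smul_const d).const_add (coordsCLM n (q - (C.par k x).1.2))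
          have h4 : (f ∘ fun r : ℝ => x + r • (Pi.single l₀ 1 : Fin (n + n + 1) → ℝ)) =ᶠ[𝓝 0]
              fun r => coordsCLM n (q - (C.par k x).1.2) +
                (c ∘ fun r : ℝ => x + r • (Pi.single l₀ 1 : Fin (n + n + 1) → ℝ)) r • d := by
            have hev : ∀ᶠ r : ℝ in 𝓝 0, x + r • (Pi.single l₀ 1 : Fin (n + n + 1) → ℝ) ∈ C.dom k :=
                by
              refine hline.continuousAt.eventually ((C.isOpen_dom k).mem_nhds ?_)
              simpa using hx
            filter_upwards [hev] with r hr
            set y := x + r • (Pi.single l₀ 1 : Fin (n + n + 1) → ℝ) with hy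
            have hy0 : y 0 = 1 := by
              simp [hy, hl₀, hx0]
            have hyv : (C.par k y).1.2 = (C.par k x).1.2 := by
              simp only [hC, cylinderAtlas_par]
              congr 1
              ext1 l
              have hne : (Fin.natAdd n l).succ ≠ l₀ := by
                intro h
                have := congrArg Fin.val h
                simp [hl₀] at this
                omega
              simp only [hy, Pi.add_apply, Pi.smul_apply, Pi.single_apply, if_neg hne, smul_zero,
                add_zero]
            have hgap : gapMap F (C.par k y) = coordsCLM n (q - (C.par k x).1.2) := by
              have e1 : (C.par k y).2 = 1 := hy0
              simp only [gapMap, e1, hyv, hF.apex _ (hpK y hr)]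
            simp only [Function.comp, hf, hc, ← hy, hgap, hGd y hr hy0]
            simp only [add_smul, mul_smul]
            exact add_assoc (coordsCLM n _) _ _
          refine ⟨fderiv ℝ c x (Pi.single l₀ 1), by rw [hGd x hx hx0], ?_⟩
          exact h1.unique (h3.congr_of_eventuallyEq h4)
  have h1 := hstep Finset.univ
  rw [← h1]
  refine C.degIntegral_congr Z fun p hp => ?_
  rw [C.sum_weight p hp, one_smul, hG]
  simp

end Cylinder

/-- The degree integral of the gap map of a transverse cone is, up to a universal sign, the
algebraic intersection number times the integral of the test function. -/
theorem exists_degIntegral_gapMap_eq (hn : 1 ≤ n) {ι κ : Type} [Fintype ι] [Fintype κ]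
    {K J : Set (Space n)} (hK : IsCompact K) (hJ : IsCompact J) (hKJ : Disjoint K J)
    {τ σ : FormField n} {A : OrientedAtlas ι (Fin n → ℝ) (Space n) K}
    {B : OrientedAtlas κ (Fin n → ℝ) (Space n) J}
    (hA : ∀ i, IsParam K (A.dom i) (A.cod i) (A.par i) (A.coord i) ∧
      ∀ x ∈ A.dom i, 0 < A.sign i * τ (A.par i x) fun k => fderiv ℝ (A.par i) x (Pi.single k 1))
    (hB : ∀ i, IsParam J (B.dom i) (B.cod i) (B.par i) (B.coord i) ∧
      ∀ x ∈ B.dom i, 0 < B.sign i * σ (B.par i x) fun k => fderiv ℝ (B.par i) x (Pi.single k 1))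
    {F : Space n × ℝ → Space n} {q : Space n} {S : Finset (Space n × ℝ)} {δ : Space n × ℝ → ℤ}
    (hF : IsCone K F q) (hq : q ∉ J) (hS : (S : Set (Space n × ℝ)) = intersections K J F)
    (hδ : ∀ x ∈ S, IsLocalIntersectionNumber K τ J σ F x (δ x)) :
    ∃ r > 0, ∀ φ : (Fin (n + n + 1) → ℝ) → ℝ, Continuous φ → (∀ y, r ≤ ‖y‖ → φ y = 0) →
      (cylinderAtlas A B).degIntegral φ (gapMap F) ((K ×ˢ J) ×ˢ Icc 0 1) =
        ((-1) ^ (n + 1) * ((∑ x ∈ S, δ x : ℤ) : ℝ)) * ∫ y, φ y := by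
  classical
  set C := cylinderAtlas A B with hC
  set g : Space n × ℝ → (Space n × Space n) × ℝ := fun x => ((x.1, F x), x.2) with hg
  have hginj : Function.Injective g := by
    intro x y h
    simp only [hg, Prod.mk.injEq] at h
    exact Prod.ext h.1.1 h.2
  have hmemS : ∀ x, x ∈ S ↔ x.1 ∈ K ∧ x.2 ∈ Icc (0 : ℝ) 1 ∧ F x ∈ J := by
    intro x
    rw [← Finset.mem_coe, hS]
    rfl
  have hZ : IsCompact ((K ×ˢ J) ×ˢ Icc (0 : ℝ) 1) := (hK.prod hJ).prod isCompact_Icc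
  have hZM : (K ×ˢ J) ×ˢ Icc (0 : ℝ) 1 ⊆ (K ×ˢ J) ×ˢ univ := prod_mono_right (subset_univ _)
  have hzero : ∀ z, z ∈ S.image g ↔ z ∈ (K ×ˢ J) ×ˢ Icc (0 : ℝ) 1 ∧ gapMap F z = 0 := by
    rintro ⟨⟨p, y⟩, s⟩
    rw [Finset.mem_image]
    constructor
    · rintro ⟨x, hx, hxz⟩
      simp only [hg, Prod.mk.injEq] at hxz
      obtain ⟨⟨rfl, rfl⟩, rfl⟩ := hxz
      have := (hmemS x).1 hx
      exact ⟨⟨⟨this.1, this.2.2⟩, this.2.1⟩, by simp [gapMap]⟩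
    · rintro ⟨⟨⟨hp, hy⟩, hs⟩, h0⟩
      have h1 : F (p, s) = y := by
        rw [← sub_eq_zero]
        exact coordsCLM_injective (by rw [map_zero]; exact h0)
      refine ⟨(p, s), (hmemS _).2 ⟨hp, hs, ?_⟩, ?_⟩
      · rw [h1]; exact hy
      · simp only [hg, h1]
  -- without charts there are no points of `K × J`, hence no intersections
  rcases isEmpty_or_nonempty ((ι × κ) × Unit) with hι | hι
  · have hS0 : S = ∅ := by
      refine Finset.eq_empty_of_forall_notMem fun x hx => ?_
      obtain ⟨k, -⟩ := C.exists_mem_cod (hZM ((hzero (g x)).1 (Finset.mem_image_of_mem g hx)).1)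
      exact hι.elim k
    refine ⟨1, one_pos, fun φ _ _ => ?_⟩
    simp [OrientedAtlas.degIntegral, OrientedAtlas.total, hS0]
  have hcod : ∀ z, ∃ k, z ∈ S.image g → z ∈ C.cod k := by
    intro z
    by_cases hz : z ∈ S.image g
    · obtain ⟨k, hk⟩ := C.exists_mem_cod (hZM ((hzero z).1 hz).1)
      exact ⟨k, fun _ => hk⟩
    · exact ⟨hι.some, fun h => absurd h hz⟩
  choose k hk using hcod
  refine Exists.elim (C.exists_degIntegral_eq_sum hZ hZM (contDiff_gapMap hF.smooth)
    (S.image g) hzero k hk (fun z => (-1) ^ (n + 1) * (δ (z.1.1, z.2) : ℝ)) ?_ ?_ ?_)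
    fun r hr => ?_
  · intro z hz
    obtain ⟨x, hx, rfl⟩ := Finset.mem_image.1 hz
    have e : δ ((g x).1.1, (g x).2) = δ x := rfl
    simp only [e]
    rcases (hδ x hx).1 with h | h <;> rcases neg_one_pow_eq_or ℝ (n + 1) with h' | h' <;>
      rw [h, h'] <;> norm_num
  · intro z hz
    have hzk := hk z hz
    have hzZ := ((hzero z).1 hz).1
    obtain ⟨x, hx, rfl⟩ := Finset.mem_image.1 hz
    have e : δ ((g x).1.1, (g x).2) = δ x := rfl
    simp only [e]
    set i := (k (g x)).1.1 with hi
    set j := (k (g x)).1.2 with hj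
    have hmem := (hmemS x).1 hx
    have hui := A.coord_mem i x.1 hmem.1 hzk.1.1
    have hvj := B.coord_mem j (F x) hmem.2.2 hzk.1.2
    have hpu := A.par_coord i x.1 hmem.1 hzk.1.1
    have hpv := B.par_coord j (F x) hmem.2.2 hzk.1.2
    have hdet := det_fderiv_gapMap (x := C.coord (k (g x)) (g x)) (p := x.1) (y := F x)
      (u := A.coord i x.1) (v := B.coord j (F x)) (s := x.2) hF.smooth (A.contDiff_par i)
      (B.contDiff_par j) (by exact (splitCoords n).apply_symm_apply _) hpu hpv
    have h1 := (hδ x hx).pos_mul_orientDet hn (a := A.sign i) (b := B.sign j)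
      (e := fun l => fderiv ℝ (A.par i) (A.coord i x.1) (Pi.single l 1))
      (f := fun l => fderiv ℝ (B.par j) (B.coord j (F x)) (Pi.single l 1))
      (fun l => by
        have := (hA i).1.fderiv_par_mem hui (Pi.single l 1)
        rwa [hpu] at this)
      (fun l => by
        have := (hB j).1.fderiv_par_mem hvj (Pi.single l 1)
        rwa [hpv] at this)
      (by have := (hA i).2 _ hui; rwa [hpu] at this)
      (by have := (hB j).2 _ hvj; rwa [hpv] at this)
    have hsign : C.sign (k (g x)) = A.sign i * B.sign j * 1 := rfl
    have hpar : gapMap F ∘ C.par (k (g x)) =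
        gapMap F ∘ (Prod.map (Prod.map (A.par i) (B.par j)) id) ∘ splitCoords n := rfl
    rw [hpar, hdet, hsign]
    refine lt_of_lt_of_eq h1 ?_
    have h2 : ((-1 : ℝ) ^ (n + 1)) * (-1) ^ (n + 1) = 1 := by
      rw [← mul_pow]; norm_num
    simp only [Prod.mk.eta]
    linear_combination (-(δ x : ℝ) * (A.sign i * B.sign j) * orientDet (Fin.cons
      (fderiv ℝ F x (0, -1)) (Fin.append (fun l => fderiv ℝ F x
        (fderiv ℝ (A.par i) (A.coord i x.1) (Pi.single l 1), 0))
        fun l => fderiv ℝ (B.par j) (B.coord j (F x)) (Pi.single l 1)))) * h2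
  -- no zero lies over the ends of the cylinder: `K` and the apex are disjoint from `J`
  · intro z hz
    obtain ⟨x, hx, rfl⟩ := Finset.mem_image.1 hz
    have hmem := (hmemS x).1 hx
    refine ⟨{z | z.2 ∈ Ioo (0 : ℝ) 1}, isOpen_Ioo.preimage continuous_snd, ?_, ?_⟩
    · have e : (x.1, x.2) = x := rfl
      refine ⟨lt_of_le_of_ne hmem.2.1.1 fun h0 => ?_, lt_of_le_of_ne hmem.2.1.2 fun h1 => ?_⟩
      · have h2 := hF.base x.1 hmem.1
        have h3 : x.2 = 0 := h0.symm
        rw [← h3, e] at h2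
        exact Set.disjoint_left.1 hKJ hmem.1 (h2 ▸ hmem.2.2)
      · have h2 := hF.apex x.1 hmem.1
        have h3 : x.2 = 1 := h1
        rw [← h3, e] at h2
        exact hq (h2 ▸ hmem.2.2)
    · rintro ⟨z, s⟩ ⟨hs, hzM⟩
      exact ⟨hzM.1, Ioo_subset_Icc_self hs⟩
  · refine ⟨r, hr.1, fun φ hφ hφr => ?_⟩
    rw [hr.2 φ hφ hφr, Finset.sum_image hginj.injOn, ← Finset.mul_sum]
    push_cast
    rfl

/-- The linking number is well defined: the intersection numbers of two cones are compared through
the degree integrals of a bump function whose support is small for both of them. -/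
theorem HasLinkingNumber.unique (hn : 1 ≤ n) {K J : Set (Space n)} {τ σ : FormField n}
    (hK : IsSubmanifold K) (hKc : IsCompact K) (hτ : IsOrientation K τ)
    (hJ : IsSubmanifold J) (hJc : IsCompact J) (hσ : IsOrientation J σ) {m m' : ℤ}
    (h : HasLinkingNumber K τ J σ m) (h' : HasLinkingNumber K τ J σ m') : m = m' := by
  obtain ⟨hKJ, F, q, S, δ, hF, hq, hS, hδ, rfl⟩ := h
  obtain ⟨-, F', q', S', δ', hF', hq', hS', hδ', rfl⟩ := h'
  obtain ⟨ι, _, A, hA⟩ := exists_orientedAtlas hK hKc hτ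
  obtain ⟨κ, _, B, hB⟩ := exists_orientedAtlas hJ hJc hσ
  obtain ⟨r, hr, hrφ⟩ := exists_degIntegral_gapMap_eq hn hKc hJc hKJ hA hB hF hq hS hδ
  obtain ⟨r', hr', hrφ'⟩ := exists_degIntegral_gapMap_eq hn hKc hJc hKJ hA hB hF' hq' hS' hδ'
  set φ : ContDiffBump (0 : Fin (n + n + 1) → ℝ) :=
    { rIn := min r r' / 2
      rOut := min r r'
      rIn_pos := by positivity
      rIn_lt_rOut := by
        have : 0 < min r r' := lt_min hr hr'
        linarith } with hφ
  have h0 : ∀ y : Fin (n + n + 1) → ℝ, min r r' ≤ ‖y‖ → φ y = 0 := fun y hy =>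
    φ.zero_of_le_dist (by rwa [dist_zero_right])
  have e1 := hrφ φ φ.continuous fun y hy => h0 y ((min_le_left _ _).trans hy)
  have e2 := hrφ' φ φ.continuous fun y hy => h0 y ((min_le_right _ _).trans hy)
  rw [degIntegral_gapMap_eq A B hn hKc hJc hF hF' φ.contDiff, e1] at e2
  have h1 : (∫ y, φ y) ≠ 0 := φ.integral_pos.ne'
  have h2 := mul_right_cancel₀ h1 e2
  have h3 := mul_left_cancel₀ (pow_ne_zero _ (by norm_num : (-1 : ℝ) ≠ 0)) h2
  exact_mod_cast h3

end LegendrianTB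
end

noncomputable section
namespace LegendrianTB

/-! ### The push-off along the Reeb field -/

open MeasureTheory Set

variable {n : ℕ} {L : Set (Space n)}

theorem mem_pushOff {ε : ℝ} {p : Space n} : p ∈ pushOff ε L ↔ p - ε • reebField ∈ L := by
  constructor
  · rintro ⟨q, hq, rfl⟩
    simpa using hq
  · intro h
    exact ⟨_, h, by simp⟩

theorem IsSubmanifold.pushOff (hL : IsSubmanifold L) (ε : ℝ) : IsSubmanifold (pushOff ε L) := by
  intro p hp
  obtain ⟨Φ, hpΦ, hΦ, hΦs, hslice⟩ := hL _ (mem_pushOff.1 hp)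
  refine ⟨(Homeomorph.subRight (ε • (reebField : Space n))).transOpenPartialHomeomorph Φ,
    hpΦ, ?_, ?_, fun x hx => ?_⟩
  · exact hΦ.comp (contDiff_id.sub contDiff_const).contDiffOn fun x hx => hx
  · exact ((contDiff_id.add (contDiff_const (c := ε • (reebField : Space n)))).comp_contDiffOn hΦs)
  · rw [mem_pushOff]
    exact hslice _ hx

theorem isCompact_pushOff (hL : IsCompact L) (ε : ℝ) : IsCompact (pushOff ε L) :=
  hL.image (by fun_prop)

theorem tangentSpaceAt_pushOff_le (ε : ℝ) (p : Space n) :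
    tangentSpaceAt (pushOff ε L) p ≤ tangentSpaceAt L (p - ε • reebField) := by
  refine Submodule.span_mono ?_
  rintro v ⟨c, hc0, hcL, hc⟩
  refine ⟨fun t => c t - ε • reebField, by simp [hc0], ?_, hc.sub_const _⟩
  filter_upwards [hcL] with t ht
  exact mem_pushOff.1 ht

theorem IsOrientation.pushOff {τ : FormField n} (hτ : IsOrientation L τ) (ε : ℝ) :
    IsOrientation (pushOff ε L) (pushOffForm ε τ) := by
  constructor
  · exact hτ.continuousOn.comp (by fun_prop) fun p hp => mem_pushOff.1 hp
  · intro p hp v hv hvi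
    exact hτ.nonvanishing _ (mem_pushOff.1 hp) v (fun i => tangentSpaceAt_pushOff_le ε p (hv i)) hvi

/-! ### Reeb chords -/

namespace ReebChord

/-- The length of a Reeb chord. -/
def length (c : ReebChord L) : ℝ := (c.upper : Space n).2 - (c.lower : Space n).2

theorem upper_eq (c : ReebChord L) :
    (c.upper : Space n) = (c.lower : Space n) + c.length • reebField := by
  obtain ⟨T, hT, h⟩ := c.flow
  have : c.length = T := by rw [length, h]; simp [reebField]
  rw [this, h]

theorem length_pos (c : ReebChord L) : 0 < c.length := by
  obtain ⟨T, hT, h⟩ := c.flow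
  have : c.length = T := by rw [length, h]; simp [reebField]
  rwa [this]

theorem fst_eq (c : ReebChord L) : (c.upper : Space n).1 = (c.lower : Space n).1 := by
  rw [c.upper_eq]; simp [reebField]

theorem upper_ne_lower (c : ReebChord L) : (c.upper : Space n) ≠ c.lower := by
  intro h
  have := c.length_pos
  rw [length, h] at this
  simp at this

theorem ext_of_upper_length {c d : ReebChord L} (h : (c.upper : Space n) = d.upper)
    (h' : c.length = d.length) : c = d := by
  have h1 := c.upper_eq
  have h2 := d.upper_eq
  rw [h, h2, h'] at h1
  exact ReebChord.ext (Subtype.ext h) (Subtype.ext (add_right_cancel h1).symm)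

/-- The chord between two points of `L` on the same flow line. -/
def ofMem {p : Space n} (hp : p ∈ L) {T : ℝ} (hT : 0 < T) (h : p - T • reebField ∈ L) :
    ReebChord L := ⟨⟨p, hp⟩, ⟨_, h⟩, T, hT, by simp⟩

theorem length_ofMem {p : Space n} (hp : p ∈ L) {T : ℝ} (hT : 0 < T)
    (h : p - T • reebField ∈ L) : (ofMem hp hT h).length = T := by
  simp [length, ofMem, reebField]

end ReebChord

/-- Distinct Reeb chords lie over distinct double points. -/
theorem IsChordGeneric.finite_reebChord (h : IsChordGeneric L) : Finite (ReebChord L) := by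
  have := h.finite.to_subtype
  refine Finite.of_injective (β := {w : Cn n | ∃ a ∈ L, ∃ b ∈ L, a ≠ b ∧ a.1 = w ∧ b.1 = w})
    (fun c => ⟨(c.upper : Space n).1, c.upper, c.upper.2, c.lower, c.lower.2, c.upper_ne_lower, rfl,
      c.fst_eq.symm⟩) fun c d hcd => ?_
  have h1 : (c.upper : Space n).1 = (d.upper : Space n).1 := congrArg Subtype.val hcd
  have hc := c.length_pos
  have hd := d.length_pos
  simp only [ReebChord.length] at hc hd
  have e1 := h.double _ c.upper.2 _ c.lower.2 _ d.upper.2 c.fst_eq (c.fst_eq.symm.trans h1)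
  have e2 := h.double _ c.upper.2 _ c.lower.2 _ d.lower.2 c.fst_eq
    ((c.fst_eq.symm.trans h1).trans d.fst_eq)
  rcases e1 with e1 | e1 | e1
  · exact absurd e1 c.upper_ne_lower
  · rcases e2 with e2 | e2 | e2
    · exact absurd e2 c.upper_ne_lower
    · exact absurd (e1.symm.trans e2) d.upper_ne_lower
    · rw [e1, e2] at hc
      linarith
  · rcases e2 with e2 | e2 | e2
    · exact absurd e2 c.upper_ne_lower
    · exact ReebChord.ext (Subtype.ext e1) (Subtype.ext e2)
    · exact absurd (e1.symm.trans e2) d.upper_ne_lower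

/-! ### A cone that sweeps the Reeb chords -/

/-- The scaling factor of the cone: it is `1` up to time `1/2` and `0` at time `1`. -/
def coneScale (s : ℝ) : ℝ := 1 - Real.smoothTransition (2 * s - 1)

theorem contDiff_coneScale : ContDiff ℝ ∞ coneScale :=
  contDiff_const.sub (Real.smoothTransition.contDiff.comp (by fun_prop))

theorem coneScale_of_le {s : ℝ} (hs : s ≤ 1 / 2) : coneScale s = 1 := by
  rw [coneScale, Real.smoothTransition.zero_of_nonpos (by linarith), sub_zero]

theorem coneScale_one : coneScale 1 = 0 := by
  rw [coneScale, Real.smoothTransition.one_of_one_le (by norm_num), sub_self]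

theorem coneScale_mem (s : ℝ) : coneScale s ∈ Icc (0 : ℝ) 1 := by
  have h1 := Real.smoothTransition.nonneg (2 * s - 1)
  have h2 := Real.smoothTransition.le_one (2 * s - 1)
  constructor <;> rw [coneScale] <;> linarith

/-- The cone that moves `L` down the Reeb flow with speed `R`, and contracts it to a point after
it has left the slab that contains `L` and its push-off. -/
def reebCone (R : ℝ) (x : Space n × ℝ) : Space n :=
  coneScale x.2 • x.1 - (R * x.2) • reebField

theorem isCone_reebCone (K : Set (Space n)) (R : ℝ) :
    IsCone K (reebCone R) (-(R • reebField)) where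
  smooth := ((contDiff_coneScale.comp contDiff_snd).smul contDiff_fst).sub
    ((contDiff_const.mul contDiff_snd).smul contDiff_const)
  base p _ := by simp [reebCone, coneScale_of_le]
  apex p _ := by simp [reebCone, coneScale_one]

theorem reebCone_of_le {R : ℝ} {x : Space n × ℝ} (hx : x.2 ≤ 1 / 2) :
    reebCone R x = x.1 - (R * x.2) • reebField := by
  rw [reebCone, coneScale_of_le hx, one_smul]

theorem fderiv_reebCone {R : ℝ} {x : Space n × ℝ} (hx : x.2 < 1 / 2) (v : Space n × ℝ) :
    fderiv ℝ (reebCone R) x v = v.1 - (R * v.2) • reebField := by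
  set T : Space n × ℝ →L[ℝ] Space n := ContinuousLinearMap.fst ℝ (Space n) ℝ -
    (R • ContinuousLinearMap.snd ℝ (Space n) ℝ).smulRight (reebField : Space n) with hT
  have h1 : (reebCone R : Space n × ℝ → Space n) =ᶠ[𝓝 x] fun y => T y := by
    filter_upwards [(continuous_snd.isOpen_preimage _ isOpen_Iio).mem_nhds
      (show x ∈ Prod.snd ⁻¹' Iio (1 / 2 : ℝ) from hx)] with y hy
    rw [reebCone_of_le (le_of_lt hy)]
    rfl
  rw [h1.fderiv_eq, ContinuousLinearMap.fderiv]
  rfl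

/-- The linking number of `L` with its push-off is the sum of the signs of the Reeb chords. -/
theorem eventually_hasLinkingNumber (hL : IsCompact L) (hfin : Finite (ReebChord L))
    {τ : FormField n} {δ : ReebChord L → ℤ} (hδ : ∀ c, δ c = 1 ∨ δ c = -1)
    (hsign : ∀ (c : ReebChord L) (R : ℝ), 0 < R → ∀ e f : Fin n → Space n,
      IsPositiveFrame L τ c.upper e → IsPositiveFrame L τ c.lower f →
        0 < (δ c : ℝ) * orientDet (Fin.cons (R • reebField) (Fin.append e f))) :
    ∀ᶠ ε in 𝓝[>] (0 : ℝ),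
      HasLinkingNumber L τ (pushOff ε L) (pushOffForm ε τ) (∑ᶠ c, δ c) := by
  classical
  have := Fintype.ofFinite (ReebChord L)
  have h1 : ∀ᶠ ε in 𝓝[>] (0 : ℝ), 0 < ε ∧ ε < 1 ∧ ∀ c : ReebChord L, ε < c.length := by
    refine (eventually_mem_nhdsWithin).and (Filter.Eventually.and ?_ ?_)
    · exact (eventually_lt_nhds one_pos).filter_mono nhdsWithin_le_nhds
    · rw [Filter.eventually_all]
      intro c
      exact (eventually_lt_nhds c.length_pos).filter_mono nhdsWithin_le_nhds
  obtain ⟨B, hB⟩ := hL.isBounded.exists_norm_le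
  have hBz : ∀ p ∈ L, |p.2| ≤ max B 0 := fun p hp =>
    ((norm_snd_le p).trans (hB p hp)).trans (le_max_left _ _)
  set b := max B 0
  have hb0 : 0 ≤ b := le_max_right _ _
  -- at this speed, `L` has left the slab of its push-off before the cone starts to contract
  set R : ℝ := 4 * b + 4 with hR
  have hR0 : 0 < R := by linarith
  filter_upwards [h1] with ε hε
  obtain ⟨hε0, hε1, hεc⟩ := hε
  have hdisj : Disjoint L (pushOff ε L) := by
    rw [Set.disjoint_left]
    intro p hp hp'
    have := hεc (ReebChord.ofMem hp hε0 (mem_pushOff.1 hp'))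
    rw [ReebChord.length_ofMem] at this
    exact lt_irrefl _ this
  have hJz : ∀ p ∈ pushOff ε L, -b + ε ≤ p.2 := by
    intro p hp
    have h2 := hBz _ (mem_pushOff.1 hp)
    have h3 : (p - ε • (reebField : Space n)).2 = p.2 - ε := by simp [reebField]
    rw [h3, abs_le] at h2
    linarith [h2.1]
  -- the upper end of a chord meets the push-off of the lower end after time `(length - ε) / R`
  set g : ReebChord L → Space n × ℝ := fun c => (c.upper, (c.length - ε) / R) with hg
  have hginj : Function.Injective g := by
    intro c d hcd
    simp only [hg, Prod.mk.injEq] at hcd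
    refine ReebChord.ext_of_upper_length hcd.1 ?_
    have := hcd.2
    field_simp at this
    linarith
  have hlen : ∀ c : ReebChord L, c.length ≤ 2 * b := by
    intro c
    have h2 := abs_le.1 (hBz _ c.upper.2)
    have h3 := abs_le.1 (hBz _ c.lower.2)
    rw [ReebChord.length]
    linarith [h2.2, h3.1]
  have hgs : ∀ c, 0 < (g c).2 ∧ (g c).2 < 1 / 2 := by
    intro c
    have h2 := hεc c
    have h3 := hlen c
    refine ⟨div_pos (by linarith) hR0, ?_⟩
    simp only [hg]
    rw [div_lt_iff₀ hR0]
    linarith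
  have hgF : ∀ c, reebCone R (g c) - ε • reebField = (c.lower : Space n) := by
    intro c
    rw [reebCone_of_le (hgs c).2.le]
    have h2 : R * (g c).2 = c.length - ε := by
      simp only [hg]; field_simp
    rw [h2, sub_sub, ← add_smul, sub_add_cancel]
    change (c.upper : Space n) - _ = _
    rw [c.upper_eq, add_sub_cancel_right]
  refine ⟨hdisj, reebCone R, -(R • reebField), Finset.univ.image g, Function.extend g δ 1,
    isCone_reebCone L R, ?_, ?_, ?_, ?_⟩
  · intro h
    have h2 := hJz _ h
    simp only [reebField, Prod.smul_mk, smul_zero, smul_eq_mul, mul_one, Prod.neg_mk] at h2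
    linarith
  · ext ⟨p, s⟩
    simp only [Finset.coe_image, Finset.coe_univ, image_univ, mem_range]
    constructor
    · rintro ⟨c, hc⟩
      have h2 := hgs c
      have h3 := hgF c
      rw [hc] at h2 h3
      refine ⟨?_, ⟨h2.1.le, by linarith [h2.2]⟩, ?_⟩
      · have : p = c.upper := (congrArg Prod.fst hc).symm
        rw [this]; exact c.upper.2
      · rw [mem_pushOff, h3]; exact c.lower.2
    · rintro ⟨hp, hs, hF⟩
      simp only at hp hs
      have hs2 : s < 1 / 2 := by
        by_contra hs2
        have h2 := hJz _ hF
        have h3 : (reebCone R (p, s)).2 = coneScale s * p.2 - R * s := by simp [reebCone, reebField]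
        rw [h3] at h2
        have h4 := coneScale_mem s
        have h5 := abs_le.1 (hBz p hp)
        have h6 : coneScale s * p.2 ≤ b := by nlinarith [h4.1, h4.2, h5.2]
        have h7 : R * (1 / 2) ≤ R * s := by nlinarith
        linarith
      rw [mem_pushOff, reebCone_of_le hs2.le, sub_sub, ← add_smul] at hF
      have hT : 0 < R * s + ε := by nlinarith [hs.1]
      refine ⟨ReebChord.ofMem hp hT hF, ?_⟩
      simp only [hg, ReebChord.length_ofMem]
      refine Prod.ext rfl ?_
      simp only
      field_simp
      ring
  · intro x hx
    obtain ⟨c, -, rfl⟩ := Finset.mem_image.1 hx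
    rw [hginj.extend_apply]
    refine ⟨hδ c, fun e f he hf => ?_⟩
    have h2 : fderiv ℝ (reebCone R : Space n × ℝ → Space n) (g c) (0, -1) = R • reebField := by
      rw [fderiv_reebCone (hgs c).2]
      simp
    have h3 : ∀ i, fderiv ℝ (reebCone R : Space n × ℝ → Space n) (g c) (e i, 0) = e i := by
      intro i
      rw [fderiv_reebCone (hgs c).2]
      simp
    rw [h2]
    simp only [h3]
    refine hsign c R hR0 e f he ⟨fun i => ?_, ?_⟩
    · have := tangentSpaceAt_pushOff_le ε _ (hf.1 i)
      rwa [hgF c] at this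
    · have := hf.2
      rw [pushOffForm, hgF c] at this
      exact this
  · rw [Finset.sum_image hginj.injOn, finsum_eq_sum_of_fintype]
    exact Finset.sum_congr rfl fun c _ => (hginj.extend_apply _ _ _).symm

end LegendrianTB
end

noncomputable section

namespace LegendrianTB

/-! ### Linear symplectic geometry -/

open Matrix

variable {n : ℕ}

/-- The symplectic form as a bilinear map. -/
def symplecticBilin (n : ℕ) : Cn n →ₗ[ℝ] Cn n →ₗ[ℝ] ℝ :=
  LinearMap.mk₂ ℝ symplecticForm
    (fun u u' v => by
      simp only [symplecticForm, ← Finset.sum_add_distrib]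
      exact Finset.sum_congr rfl fun j _ => by simp; ring)
    (fun a u v => by
      simp only [symplecticForm, smul_eq_mul, Finset.mul_sum]
      exact Finset.sum_congr rfl fun j _ => by simp; ring)
    (fun u v v' => by
      simp only [symplecticForm, ← Finset.sum_add_distrib]
      exact Finset.sum_congr rfl fun j _ => by simp; ring)
    (fun a u v => by
      simp only [symplecticForm, smul_eq_mul, Finset.mul_sum]
      exact Finset.sum_congr rfl fun j _ => by simp; ring)

theorem symplecticBilin_apply (u v : Cn n) : symplecticBilin n u v = symplecticForm u v := rfl

theorem symplecticForm_swap (u v : Cn n) : symplecticForm v u = -symplecticForm u v := by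
  simp only [symplecticForm, ← Finset.sum_neg_distrib]
  exact Finset.sum_congr rfl fun j _ => by ring

theorem symplecticForm_add_left (u u' v : Cn n) :
    symplecticForm (u + u') v = symplecticForm u v + symplecticForm u' v :=
  LinearMap.map_add₂ (symplecticBilin n) u u' v

theorem symplecticForm_add_right (u v v' : Cn n) :
    symplecticForm u (v + v') = symplecticForm u v + symplecticForm u v' :=
  map_add (symplecticBilin n u) v v'

theorem symplecticForm_smul_left (a : ℝ) (u v : Cn n) :
    symplecticForm (a • u) v = a * symplecticForm u v :=
  LinearMap.map_smul₂ (symplecticBilin n) a u v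

theorem symplecticForm_smul_right (a : ℝ) (u v : Cn n) :
    symplecticForm u (a • v) = a * symplecticForm u v :=
  map_smul (symplecticBilin n u) a v

theorem symplecticForm_neg_left (u v : Cn n) : symplecticForm (-u) v = -symplecticForm u v :=
  LinearMap.map_neg₂ (symplecticBilin n) u v

theorem symplecticForm_neg_right (u v : Cn n) : symplecticForm u (-v) = -symplecticForm u v :=
  map_neg (symplecticBilin n u) v

theorem symplecticForm_self (u : Cn n) : symplecticForm u u = 0 := by
  have := symplecticForm_swap u u
  linarith

/-- Multiplication by `i` tames the symplectic form. -/
theorem symplecticForm_I_smul_pos {u : Cn n} (hu : u ≠ 0) :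
    0 < symplecticForm u (Complex.I • u) := by
  have h1 : symplecticForm u (Complex.I • u) = ∑ j, Complex.normSq (u j) := by
    refine Finset.sum_congr rfl fun j _ => ?_
    simp [Complex.normSq_apply]
  rw [h1]
  obtain ⟨j, hj⟩ := Function.ne_iff.1 hu
  exact Finset.sum_pos' (fun i _ => Complex.normSq_nonneg _)
    ⟨j, Finset.mem_univ _, Complex.normSq_pos.2 hj⟩

/-- A real basis of an isotropic subspace is linearly independent over `ℂ`. -/
theorem det_ne_zero_of_isotropic {v : Fin n → Cn n} (hv : LinearIndependent ℝ v)
    (h0 : ∀ i j, symplecticForm (v i) (v j) = 0) : (Matrix.of v).det ≠ 0 := by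
  have hspan : ∀ a b : Fin n → ℝ, symplecticForm (∑ i, a i • v i) (∑ i, b i • v i) = 0 := by
    intro a b
    rw [← symplecticBilin_apply]
    simp [symplecticBilin_apply, h0]
  have h1 : LinearIndependent ℂ (Matrix.of v).row := by
    rw [Fintype.linearIndependent_iff]
    intro g hg
    set u := ∑ i, (g i).re • v i with hu
    set w := ∑ i, (g i).im • v i with hw
    have huw : u + Complex.I • w = 0 := by
      rw [← hg, hu, hw, Finset.smul_sum, ← Finset.sum_add_distrib]
      refine Finset.sum_congr rfl fun i _ => ?_
      ext j
      simp only [Pi.add_apply, Pi.smul_apply, smul_eq_mul, Complex.real_smul, Matrix.row_apply,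
        Matrix.of_apply]
      conv_rhs => rw [← Complex.re_add_im (g i)]
      ring
    have hw0 : w = 0 := by
      by_contra hne
      have h2 := symplecticForm_I_smul_pos hne
      rw [show Complex.I • w = -u from (neg_eq_of_add_eq_zero_right huw).symm,
        symplecticForm_neg_right, hspan, neg_zero] at h2
      exact lt_irrefl _ h2
    have hu0 : u = 0 := by rw [hw0] at huw; simpa using huw
    have h3 := Fintype.linearIndependent_iff.1 hv _ hu0
    have h4 := Fintype.linearIndependent_iff.1 hv _ hw0
    exact fun i => Complex.ext (h3 i) (h4 i)
  exact ((Matrix.isUnit_iff_isUnit_det _).1 (linearIndependent_rows_iff_isUnit.1 h1)).ne_zero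

/-- The determinant of a frame changes under a real change of basis by its determinant. -/
theorem det_sum_smul (a : Matrix (Fin n) (Fin n) ℝ) (f : Fin n → Cn n) :
    (Matrix.of fun i => ∑ k, a i k • f k).det = a.det * (Matrix.of f).det := by
  have h1 : (Matrix.of fun i => ∑ k, a i k • f k) = a.map Complex.ofRealHom * Matrix.of f := by
    ext i j
    simp [Matrix.mul_apply, Finset.sum_apply]
  rw [h1, Matrix.det_mul, ← RingHom.mapMatrix_apply, ← RingHom.map_det]
  rfl

theorem alternatingMap_sum_smul {E : Type*} [AddCommGroup E] [Module ℝ E]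
    (Φ : E [⋀^Fin n]→ₗ[ℝ] ℝ) (a : Matrix (Fin n) (Fin n) ℝ) (f : Fin n → E) :
    Φ (fun i => ∑ k, a i k • f k) = a.det * Φ f := by
  have h1 := map_comp_eq_det_mul Φ (Fintype.linearCombination ℝ f) (Matrix.toLin' aᵀ)
  rw [LinearMap.det_toLin', Matrix.det_transpose] at h1
  convert! h1 using 2
  · ext1 i
    simp [Fintype.linearCombination_apply]
  · congr 1
    ext1 i
    simp [Fintype.linearCombination_apply, Pi.single_apply]

/-- Vectors of an `n`-dimensional space are combinations of a given basis. -/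
theorem exists_eq_sum_smul {E : Type*} [AddCommGroup E] [Module ℝ E] {V : Submodule ℝ E}
    [FiniteDimensional ℝ V] (hV : Module.finrank ℝ V = n) {f : Fin n → E} (hf : ∀ i, f i ∈ V)
    (hfi : LinearIndependent ℝ f) {v : Fin n → E} (hv : ∀ i, v i ∈ V) :
    ∃ a : Matrix (Fin n) (Fin n) ℝ, v = fun i => ∑ k, a i k • f k := by
  have h1 : Submodule.span ℝ (Set.range f) = V := by
    apply Submodule.eq_of_le_of_finrank_eq (Submodule.span_le.2 (Set.range_subset_iff.2 hf))
    rw [finrank_span_eq_card hfi, hV, Fintype.card_fin]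
  have h2 : ∀ i, ∃ c : Fin n → ℝ, ∑ k, c k • f k = v i := fun i =>
    (Submodule.mem_span_range_iff_exists_fun ℝ).1 (h1 ▸ hv i)
  choose a ha using h2
  exact ⟨a, funext fun i => (ha i).symm⟩

theorem exists_basis_of_finrank {E : Type*} [AddCommGroup E] [Module ℝ E] {V : Submodule ℝ E}
    [FiniteDimensional ℝ V] (hV : Module.finrank ℝ V = n) :
    ∃ f : Fin n → E, (∀ i, f i ∈ V) ∧ LinearIndependent ℝ f := by
  have b := Module.finBasisOfFinrankEq ℝ V hV
  exact ⟨fun i => b i, fun i => (b i).2, b.linearIndependent.map' V.subtype V.ker_subtype⟩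

theorem IsLagrangian.det_ne_zero {V : Submodule ℝ (Cn n)} (hV : IsLagrangian V)
    {v : Fin n → Cn n} (hv : ∀ i, v i ∈ V) (hvi : LinearIndependent ℝ v) :
    (Matrix.of v).det ≠ 0 :=
  det_ne_zero_of_isotropic hvi fun i j => hV.2 _ (hv i) _ (hv j)

namespace IsCompatible

variable {I : Cn n →ₗ[ℝ] Cn n}

theorem symplecticForm_apply_left (h : IsCompatible I) (u v : Cn n) :
    symplecticForm (I u) v = -symplecticForm u (I v) := by
  rw [← h.symplectic u (I v), h.sq, symplecticForm_neg_right, neg_neg]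

theorem symplecticForm_apply_swap (h : IsCompatible I) (u v : Cn n) :
    symplecticForm u (I v) = symplecticForm v (I u) := by
  rw [symplecticForm_swap, h.symplecticForm_apply_left, neg_neg]

end IsCompatible

/-- Lagrangian subspaces rotate through Lagrangian subspaces. -/
theorem IsLagrangian.rotate {V : Submodule ℝ (Cn n)} (hV : IsLagrangian V)
    {I : Cn n →ₗ[ℝ] Cn n} (hI : IsCompatible I) (t : ℝ) : IsLagrangian (rotate I V t) := by
  set R : Cn n →ₗ[ℝ] Cn n := Real.cos t • LinearMap.id + Real.sin t • I with hR
  have hRa : ∀ u, R u = Real.cos t • u + Real.sin t • I u := fun u => rfl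
  constructor
  · have hinj : Function.Injective R := by
      rw [← LinearMap.ker_eq_bot, LinearMap.ker_eq_bot']
      intro u hu
      have h1 : Real.cos t • R u - Real.sin t • I (R u) = u := by
        rw [hRa, map_add, map_smul, map_smul, hI.sq]
        have h2 := Real.cos_sq_add_sin_sq t
        ext j
        simp only [Pi.sub_apply, Pi.smul_apply, Pi.add_apply, Pi.neg_apply, Complex.real_smul]
        have h3 : (Real.cos t : ℂ) ^ 2 + (Real.sin t : ℂ) ^ 2 = 1 := by exact_mod_cast h2
        linear_combination (u j) * h3
      rw [← h1, hu, map_zero, smul_zero, smul_zero, sub_zero]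
    rw [LegendrianTB.rotate, ← hR, ← (Submodule.equivMapOfInjective R hinj V).finrank_eq]
    exact hV.1
  · rintro _ ⟨u, hu, rfl⟩ _ ⟨v, hv, rfl⟩
    rw [← hR, hRa, hRa, symplecticForm_add_left, symplecticForm_add_right,
      symplecticForm_add_right]
    simp only [symplecticForm_smul_left, symplecticForm_smul_right, hI.symplectic,
      hI.symplecticForm_apply_left, hV.2 u hu v hv]
    ring

/-- Two Lagrangian subspaces that span `ℂⁿ` are interchanged by a compatible complex structure. -/
theorem exists_isCompatible {V W : Submodule ℝ (Cn n)} (hV : IsLagrangian V)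
    (hW : IsLagrangian W) (hVW : W ⊔ V = ⊤) :
    ∃ I : Cn n →ₗ[ℝ] Cn n, IsCompatible I ∧ V.map I = W := by
  have hnd : ∀ w : Cn n, (∀ u : Cn n, symplecticForm u w = 0) → w = 0 := by
    intro w hw
    by_contra hne
    have h1 := symplecticForm_I_smul_pos hne
    rw [symplecticForm_swap, hw, neg_zero] at h1
    exact lt_irrefl _ h1
  have hdecomp : ∀ u : Cn n, ∃ v ∈ V, ∃ w ∈ W, v + w = u := fun u => by
    have : u ∈ V ⊔ W := by rw [sup_comm, hVW]; trivial
    exact Submodule.mem_sup.1 this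
  -- the pairings of `V` with `W` by the symplectic form and with itself by the metric
  set ψ : W →ₗ[ℝ] Module.Dual ℝ V :=
    (((symplecticBilin n).flip.compl₂ V.subtype).comp W.subtype) with hψ
  have hψa : ∀ (w : W) (v : V), ψ w v = symplecticForm (v : Cn n) w := fun _ _ => rfl
  set g : V →ₗ[ℝ] Module.Dual ℝ V :=
    ((((symplecticBilin n).flip.comp
      ((LinearMap.lsmul ℂ (Cn n) Complex.I).restrictScalars ℝ)).compl₂ V.subtype).comp
        V.subtype) with hg
  have hga : ∀ v v' : V, g v v' = symplecticForm (v' : Cn n) (Complex.I • (v : Cn n)) :=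
    fun _ _ => rfl
  have hψi : Function.Injective ψ := by
    rw [← LinearMap.ker_eq_bot, LinearMap.ker_eq_bot']
    intro w hw
    refine Subtype.ext (hnd _ fun u => ?_)
    obtain ⟨v, hv, w', hw', rfl⟩ := hdecomp u
    rw [symplecticForm_add_left, hW.2 _ hw' _ w.2, add_zero]
    exact congrArg (fun l : Module.Dual ℝ V => l ⟨v, hv⟩) hw
  have hgi : Function.Injective g := by
    rw [← LinearMap.ker_eq_bot, LinearMap.ker_eq_bot']
    intro v hv
    by_contra hne
    have h1 := symplecticForm_I_smul_pos (u := (v : Cn n)) fun h => hne (Subtype.ext h)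
    rw [← hga v v, hv] at h1
    exact lt_irrefl _ h1
  have hd1 : Module.finrank ℝ W = Module.finrank ℝ (Module.Dual ℝ V) := by
    rw [Subspace.dual_finrank_eq, hV.1, hW.1]
  have hd2 : Module.finrank ℝ V = Module.finrank ℝ (Module.Dual ℝ V) := by
    rw [Subspace.dual_finrank_eq]
  -- `φ` carries the metric of `V` to the symplectic pairing; it is the restriction of `I` to `V`
  set φ : V ≃ₗ[ℝ] W := (LinearEquiv.ofInjectiveOfFinrankEq g hgi hd2).trans
    (LinearEquiv.ofInjectiveOfFinrankEq ψ hψi hd1).symm with hφ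
  have hφa : ∀ v v' : V, symplecticForm (v' : Cn n) (φ v) =
      symplecticForm (v' : Cn n) (Complex.I • (v : Cn n)) := by
    intro v v'
    rw [← hψa, ← hga]
    congr 1
    exact (LinearEquiv.ofInjectiveOfFinrankEq ψ hψi hd1).apply_symm_apply _
  have hsymm : ∀ v v' : V, symplecticForm (v' : Cn n) (φ v) = symplecticForm (v : Cn n) (φ v') := by
    intro v v'
    rw [hφa, hφa]
    refine Finset.sum_congr rfl fun j _ => ?_
    simp only [Pi.smul_apply, smul_eq_mul, Complex.mul_re, Complex.mul_im, Complex.I_re,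
      Complex.I_im]
    ring
  have hpos : ∀ v : V, (v : Cn n) ≠ 0 → 0 < symplecticForm (v : Cn n) (φ v) := by
    intro v hv
    rw [hφa]
    exact symplecticForm_I_smul_pos hv
  have hpos' : ∀ v : V, 0 ≤ symplecticForm (v : Cn n) (φ v) := by
    intro v
    rcases eq_or_ne (v : Cn n) 0 with h0 | h0
    · rw [h0, ← symplecticBilin_apply, map_zero, LinearMap.zero_apply]
    · exact (hpos v h0).le
  have hcompl : IsCompl V W := by
    refine ⟨?_, codisjoint_iff.2 (by rw [sup_comm, hVW])⟩
    rw [disjoint_iff, eq_bot_iff]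
    intro x hx
    refine hnd x fun u => ?_
    obtain ⟨v, hv, w, hw, rfl⟩ := hdecomp u
    rw [symplecticForm_add_left, hV.2 _ hv _ hx.1, hW.2 _ hw _ hx.2, add_zero]
  set e := Submodule.prodEquivOfIsCompl V W hcompl with he
  set J : V × W →ₗ[ℝ] V × W :=
    (-((φ.symm : W →ₗ[ℝ] V).comp (LinearMap.snd ℝ V W))).prod
      ((φ : V →ₗ[ℝ] W).comp (LinearMap.fst ℝ V W)) with hJ
  set I : Cn n →ₗ[ℝ] Cn n := (e : V × W →ₗ[ℝ] Cn n).comp (J.comp (e.symm : Cn n →ₗ[ℝ] V × W))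
    with hI
  have hIa : ∀ (v : V) (w : W), I ((v : Cn n) + w) = (φ v : Cn n) - φ.symm w := by
    intro v w
    have h1 : e.symm ((v : Cn n) + w) = (v, w) := by
      rw [LinearEquiv.symm_apply_eq, he, Submodule.coe_prodEquivOfIsCompl']
    rw [hI, LinearMap.comp_apply, LinearMap.comp_apply, LinearEquiv.coe_coe, LinearEquiv.coe_coe,
      h1, he, Submodule.coe_prodEquivOfIsCompl']
    simp [hJ]
    abel
  have hall : ∀ u : Cn n, ∃ (v : V) (w : W), (v : Cn n) + w = u := fun u => by
    obtain ⟨v, hv, w, hw, h⟩ := hdecomp u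
    exact ⟨⟨v, hv⟩, ⟨w, hw⟩, h⟩
  have hIV : ∀ v : V, I v = φ v := fun v => by simpa using hIa v 0
  refine ⟨I, ⟨?_, ?_, ?_⟩, ?_⟩
  · intro u
    obtain ⟨v, w, rfl⟩ := hall u
    rw [hIa, sub_eq_neg_add, show -((φ.symm w : V) : Cn n) = ((-φ.symm w : V) : Cn n) from rfl, hIa]
    simp
    abel
  · intro u u'
    obtain ⟨v, w, rfl⟩ := hall u
    obtain ⟨v', w', rfl⟩ := hall u'
    rw [hIa, hIa, sub_eq_add_neg, sub_eq_add_neg]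
    simp only [symplecticForm_add_left, symplecticForm_add_right, symplecticForm_neg_left,
      symplecticForm_neg_right]
    rw [hV.2 _ v.2 _ v'.2, hW.2 _ w.2 _ w'.2, hW.2 _ (φ v).2 _ (φ v').2,
      hV.2 _ (φ.symm w).2 _ (φ.symm w').2, symplecticForm_swap (φ.symm w' : Cn n) (φ v),
      hsymm v (φ.symm w'), φ.apply_symm_apply, hsymm v' (φ.symm w), φ.apply_symm_apply,
      symplecticForm_swap (v' : Cn n) w]
    ring
  · intro u hu
    obtain ⟨v, w, rfl⟩ := hall u
    rw [hIa, sub_eq_add_neg]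
    simp only [symplecticForm_add_left, symplecticForm_add_right,
      symplecticForm_neg_right]
    rw [hV.2 _ v.2 _ (φ.symm w).2, hW.2 _ w.2 _ (φ v).2,
      symplecticForm_swap (φ.symm w : Cn n) (w : Cn n)]
    have h1 := hpos' (φ.symm w)
    rw [φ.apply_symm_apply] at h1
    rcases eq_or_ne (v : Cn n) 0 with h0 | h0
    · have hw : ((φ.symm w : V) : Cn n) ≠ 0 := by
        intro h
        have : φ.symm w = 0 := Subtype.ext h
        rw [LinearEquiv.map_eq_zero_iff] at this
        rw [this, h0] at hu
        simp at hu
      have h2 := hpos _ hw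
      rw [φ.apply_symm_apply] at h2
      linarith [hpos' v]
    · linarith [hpos v h0]
  · ext x
    constructor
    · rintro ⟨v, hv, rfl⟩
      rw [hIV ⟨v, hv⟩]
      exact (φ _).2
    · intro hx
      refine ⟨φ.symm ⟨x, hx⟩, (φ.symm _).2, ?_⟩
      rw [hIV, φ.apply_symm_apply]

end LegendrianTB

end

noncomputable section

namespace LegendrianTB

/-! ### The orientation of a pair of Lagrangian frames -/

open Matrix

variable {n : ℕ}

/-- The real determinant of a complex matrix acting on `ℝ²ᵐ = ℂᵐ`. -/
theorem det_fromBlocks_complex {m : Type*} [Fintype m] [DecidableEq m] (A B : Matrix m m ℝ) :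
    (fromBlocks A B (-B) A).det =
      Complex.normSq (A.map Complex.ofRealHom + Complex.I • B.map Complex.ofRealHom).det := by
  set A' := A.map Complex.ofRealHom with hA
  set B' := B.map Complex.ofRealHom with hB
  have h1 : (fromBlocks A B (-B) A).map Complex.ofRealHom = fromBlocks A' B' (-B') A' := by
    rw [fromBlocks_map, hA, hB]
    congr 1
    ext i j
    simp
  have h2 : fromBlocks 1 (Complex.I • 1) 0 1 * fromBlocks A' B' (-B') A' *
      fromBlocks 1 (-(Complex.I • 1)) 0 1 =
      fromBlocks (A' - Complex.I • B') 0 (-B') (A' + Complex.I • B') := by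
    rw [fromBlocks_multiply, fromBlocks_multiply, fromBlocks_inj]
    refine ⟨?_, ?_, ?_, ?_⟩
    · simp [sub_eq_add_neg]
    · ext i j
      simp
      linear_combination (B' i j) * Complex.I_mul_I
    · simp
    · simp [add_comm]
  have h3 := congrArg Matrix.det h2
  rw [det_mul, det_mul, det_fromBlocks_zero₂₁, det_fromBlocks_zero₂₁, det_fromBlocks_zero₁₂,
    det_one]  at h3
  simp only [one_mul, mul_one] at h3
  rw [← h1, ← RingHom.mapMatrix_apply,
    ← RingHom.map_det] at h3
  have h4 : A' - Complex.I • B' = (starRingEnd ℂ).mapMatrix (A' + Complex.I • B') := by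
    ext i j
    simp [hA, hB, sub_eq_add_neg]
  rw [h4, ← RingHom.map_det, ← Complex.normSq_eq_conj_mul_self] at h3
  exact Complex.ofReal_injective h3

/-- For a Lagrangian frame `v`, the orientation of the basis `u, v` of `ℝ²ⁿ` is given by the
symplectic pairings of `u` with `v`: multiplication with `i v*` makes the basis block
triangular. -/
theorem det_fromBlocks_re_im (u : Fin n → Cn n) {v : Fin n → Cn n} (hv : LinearIndependent ℝ v)
    (h0 : ∀ i j, symplecticForm (v i) (v j) = 0) :
    (fromBlocks (of fun i j => (u i j).re) (of fun i j => (u i j).im)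
      (of fun i j => (v i j).re) (of fun i j => (v i j).im)).det =
      (of fun i j => symplecticForm (u i) (v j)).det := by
  set C : Matrix (Fin n) (Fin n) ℝ := of fun i j => (v i j).re with hC
  set D : Matrix (Fin n) (Fin n) ℝ := of fun i j => (v i j).im with hD
  set A : Matrix (Fin n) (Fin n) ℝ := of fun i j => (u i j).re with hA
  set B : Matrix (Fin n) (Fin n) ℝ := of fun i j => (u i j).im with hB
  have hdet := det_ne_zero_of_isotropic hv h0
  have h1 : (fromBlocks Dᵀ Cᵀ (-Cᵀ) Dᵀ).det = Complex.normSq (of v).det := by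
    rw [det_fromBlocks_complex]
    have : Dᵀ.map Complex.ofRealHom + Complex.I • Cᵀ.map Complex.ofRealHom =
        Complex.I • (of v)ᴴ := by
      ext i j
      apply Complex.ext <;> simp [hC, hD]
    rw [this, det_smul, det_conjTranspose, Complex.normSq_mul, map_pow, Complex.normSq_I, one_pow,
      one_mul]
    exact Complex.normSq_conj _
  have h2 : (C * Cᵀ + D * Dᵀ).det = Complex.normSq (of v).det := by
    have h3 : (C * Cᵀ + D * Dᵀ).map Complex.ofRealHom = of v * (of v)ᴴ := by
      ext i j
      have := h0 j i
      simp only [symplecticForm] at this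
      apply Complex.ext
      · simp [hC, hD, mul_apply, ← Finset.sum_add_distrib]
      · simp only [hC, hD, mul_apply, map_apply, conjTranspose_apply, of_apply, Complex.im_sum,
          Complex.ofRealHom_eq_coe, Complex.ofReal_im, Complex.star_def, Complex.mul_im,
          Complex.conj_re, Complex.conj_im]
        rw [← this]
        exact Finset.sum_congr rfl fun k _ => by ring
    have h4 : (((C * Cᵀ + D * Dᵀ).det : ℝ) : ℂ) = (of v * (of v)ᴴ).det := by
      rw [← h3, ← RingHom.mapMatrix_apply, ← RingHom.map_det]
      rfl
    rw [det_mul, det_conjTranspose, Complex.star_def, Complex.mul_conj] at h4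
    exact_mod_cast h4
  have h5 : fromBlocks A B C D * fromBlocks Dᵀ Cᵀ (-Cᵀ) Dᵀ =
      fromBlocks (of fun i j => symplecticForm (u i) (v j)) (A * Cᵀ + B * Dᵀ) 0
        (C * Cᵀ + D * Dᵀ) := by
    rw [fromBlocks_multiply]
    congr 1
    · ext i j
      simp [hA, hB, hC, hD, mul_apply, symplecticForm, sub_eq_add_neg, Finset.sum_add_distrib]
    · ext i j
      have := h0 i j
      simp only [symplecticForm, Finset.sum_sub_distrib] at this
      simp [hC, hD, mul_apply]
      linarith
  have h6 := congrArg Matrix.det h5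
  rw [det_mul, h1, det_fromBlocks_zero₂₁, h2] at h6
  exact mul_right_cancel₀ (Complex.normSq_pos.2 hdet).ne' h6

/-- The position of the coordinates `z, x₁, …, xₙ, y₁, …, yₙ` in the list
`x₁, y₁, …, xₙ, yₙ, z`. -/
def interleave (n : ℕ) : Fin (n + n + 1) → Fin (n + n + 1) :=
  Fin.cons (Fin.last _) (Fin.append (fun k => ⟨2 * k, by omega⟩) fun k => ⟨2 * k + 1, by omega⟩)

theorem interleave_zero : interleave n 0 = Fin.last _ := rfl

theorem interleave_castAdd (k : Fin n) :
    interleave n (Fin.castAdd n k).succ = ⟨2 * k, by omega⟩ := by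
  simp only [interleave, Fin.cons_succ, Fin.append_left]

theorem interleave_natAdd (k : Fin n) :
    interleave n (Fin.natAdd n k).succ = ⟨2 * k + 1, by omega⟩ := by
  simp only [interleave, Fin.cons_succ, Fin.append_right]

theorem forall_fin_add_add_one {P : Fin (n + n + 1) → Prop} (h0 : P 0)
    (h1 : ∀ k : Fin n, P (Fin.castAdd n k).succ) (h2 : ∀ k : Fin n, P (Fin.natAdd n k).succ) :
    ∀ i, P i := by
  intro i
  refine Fin.cases h0 (fun l => ?_) i
  exact Fin.addCases h1 h2 l

theorem interleave_injective : Function.Injective (interleave n) := by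
  have key : ∀ i j, interleave n i = interleave n j → i = j := by
    refine forall_fin_add_add_one ?_ ?_ ?_
    · refine forall_fin_add_add_one (fun _ => rfl) (fun k => ?_) (fun k => ?_)
      · rw [interleave_zero, interleave_castAdd, Fin.ext_iff, Fin.val_last]
        intro h; simp only at h; omega
      · rw [interleave_zero, interleave_natAdd, Fin.ext_iff, Fin.val_last]
        intro h; simp only at h; omega
    · refine fun l => forall_fin_add_add_one ?_ (fun k => ?_) (fun k => ?_)
      · rw [interleave_zero, interleave_castAdd, Fin.ext_iff, Fin.val_last]
        intro h; simp only at h; omega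
      · rw [interleave_castAdd, interleave_castAdd, Fin.ext_iff]
        intro h; simp only at h
        rw [show l = k from Fin.ext (by omega)]
      · rw [interleave_castAdd, interleave_natAdd, Fin.ext_iff]
        intro h; simp only at h; omega
    · refine fun l => forall_fin_add_add_one ?_ (fun k => ?_) (fun k => ?_)
      · rw [interleave_zero, interleave_natAdd, Fin.ext_iff, Fin.val_last]
        intro h; simp only at h; omega
      · rw [interleave_castAdd, interleave_natAdd, Fin.ext_iff]
        intro h; simp only at h; omega
      · rw [interleave_natAdd, interleave_natAdd, Fin.ext_iff]
        intro h; simp only at h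
        rw [show l = k from Fin.ext (by omega)]
  exact fun i j => key i j

/-- `interleave` as a permutation. -/
def interleavePerm (n : ℕ) : Equiv.Perm (Fin (n + n + 1)) :=
  Equiv.ofBijective _ (Finite.injective_iff_bijective.1 (interleave_injective (n := n)))

theorem interleavePerm_apply (i : Fin (n + n + 1)) : interleavePerm n i = interleave n i := rfl

/-- The inversions of `interleave` are the `2n` inversions of its first place and the pairs
`(xₖ, yₗ)` with `l < k`. -/
theorem sign_interleavePerm (n : ℕ) :
    ((Equiv.Perm.sign (interleavePerm n) : ℤˣ) : ℤ) = (-1) ^ (n * (n - 1) / 2) := by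
  have h1 := Equiv.Perm.sign_eq_prod_prod_Ioi (interleavePerm n)
  have h2 : ∀ i : Fin (n + n + 1), (∏ j ∈ Finset.Ioi i,
      if interleavePerm n i < interleavePerm n j then (1 : ℤˣ) else -1) =
      ∏ j, if i < j ∧ interleave n j < interleave n i then (-1 : ℤˣ) else 1 := by
    intro i
    have h3 : Finset.Ioi i = Finset.univ.filter fun j => i < j := by ext; simp
    rw [h3, Finset.prod_filter]
    refine Finset.prod_congr rfl fun j _ => ?_
    by_cases hij : i < j
    · have hne : interleave n i ≠ interleave n j := fun h => hij.ne (interleave_injective h)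
      simp only [interleavePerm_apply, hij, true_and, if_true]
      rcases lt_or_gt_of_ne hne with h | h
      · simp [h, h.not_gt]
      · simp [h, h.not_gt]
    · simp [hij]
  rw [Finset.prod_congr rfl fun i _ => h2 i, Fin.prod_univ_succ] at h1
  have hz : (∏ j, if (0 : Fin (n + n + 1)) < j ∧ interleave n j < interleave n 0
      then (-1 : ℤˣ) else 1) = 1 := by
    rw [Fin.prod_univ_succ, Fin.prod_univ_add]
    have e1 : ∀ k : Fin n, (if (0 : Fin (n + n + 1)) < (Fin.castAdd n k).succ ∧
        interleave n (Fin.castAdd n k).succ < interleave n 0 then (-1 : ℤˣ) else 1) = -1 := by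
      intro k
      rw [if_pos]
      refine ⟨Fin.succ_pos _, ?_⟩
      rw [interleave_zero, interleave_castAdd, Fin.lt_def, Fin.val_last]
      simp only; omega
    have e2 : ∀ k : Fin n, (if (0 : Fin (n + n + 1)) < (Fin.natAdd n k).succ ∧
        interleave n (Fin.natAdd n k).succ < interleave n 0 then (-1 : ℤˣ) else 1) = -1 := by
      intro k
      rw [if_pos]
      refine ⟨Fin.succ_pos _, ?_⟩
      rw [interleave_zero, interleave_natAdd, Fin.lt_def, Fin.val_last]
      simp only; omega
    rw [Finset.prod_congr rfl fun k _ => e1 k, Finset.prod_congr rfl fun k _ => e2 k]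
    simp [← mul_pow]
  have hy : ∀ k : Fin n, (∏ j, if (Fin.natAdd n k).succ < j ∧
      interleave n j < interleave n (Fin.natAdd n k).succ then (-1 : ℤˣ) else 1) = 1 := by
    intro k
    refine Finset.prod_eq_one fun j hj => if_neg ?_
    clear hj
    revert j
    refine forall_fin_add_add_one (by simp) (fun l => ?_) (fun l => ?_)
    all_goals
      intro h
      have h3 := h.1
      have h4 := h.2
      simp only [interleave_natAdd, interleave_castAdd, Fin.lt_def, Fin.val_succ,
        Fin.val_castAdd, Fin.val_natAdd] at h3 h4
      omega
  have hx : ∀ k : Fin n, (∏ j, if (Fin.castAdd n k).succ < j ∧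
      interleave n j < interleave n (Fin.castAdd n k).succ then (-1 : ℤˣ) else 1) =
      (-1) ^ (k : ℕ) := by
    intro k
    rw [Fin.prod_univ_succ, Fin.prod_univ_add, if_neg (by simp), one_mul]
    have e1 : ∀ l : Fin n, (if (Fin.castAdd n k).succ < (Fin.castAdd n l).succ ∧
        interleave n (Fin.castAdd n l).succ < interleave n (Fin.castAdd n k).succ
        then (-1 : ℤˣ) else 1) = 1 := by
      intro l
      rw [if_neg]
      intro h
      have h3 := h.1
      have h4 := h.2
      simp only [interleave_castAdd, Fin.lt_def, Fin.val_succ, Fin.val_castAdd] at h3 h4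
      omega
    have e2 : ∀ l : Fin n, (if (Fin.castAdd n k).succ < (Fin.natAdd n l).succ ∧
        interleave n (Fin.natAdd n l).succ < interleave n (Fin.castAdd n k).succ
        then (-1 : ℤˣ) else 1) = if l < k then -1 else 1 := by
      intro l
      congr 1
      simp only [interleave_castAdd, interleave_natAdd, Fin.lt_def, Fin.val_succ,
        Fin.val_castAdd, Fin.val_natAdd, eq_iff_iff]
      omega
    rw [Finset.prod_congr rfl fun k _ => e1 k, Finset.prod_congr rfl fun k _ => e2 k,
      Finset.prod_const_one, one_mul, ← Finset.prod_filter, Finset.prod_const]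
    congr 1
    rw [show (Finset.univ.filter fun l : Fin n => l < k) = Finset.Iio k by ext; simp, Fin.card_Iio]
  rw [hz, one_mul, Fin.prod_univ_add, Finset.prod_congr rfl fun k _ => hx k, Finset.prod_congr rfl
      fun k _ => hy k,
    Finset.prod_const_one, mul_one, Finset.prod_pow_eq_pow_sum,
    Fin.sum_univ_eq_sum_range (fun k => k), Finset.sum_range_id] at h1
  rw [h1]
  push_cast
  rfl

theorem coords_last (v : Space n) : coords v (Fin.last _) = v.2 := by
  rw [coords, dif_neg]
  simp only [Fin.val_last]; omega

theorem coords_interleave_castAdd (v : Space n) (k : Fin n) :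
    coords v (interleave n (Fin.castAdd n k).succ) = (v.1 k).re := by
  have h1 : 2 * (k : ℕ) / 2 = k := by omega
  rw [interleave_castAdd, coords, dif_pos (by simp), if_pos (by simp)]
  simp

theorem coords_interleave_natAdd (v : Space n) (k : Fin n) :
    coords v (interleave n (Fin.natAdd n k).succ) = (v.1 k).im := by
  have h1 : (2 * (k : ℕ) + 1) / 2 = k := by omega
  have h2 : ¬ (2 * (k : ℕ) + 1) % 2 = 0 := by omega
  rw [interleave_natAdd, coords, dif_pos (by simp only [h1]; exact k.2), if_neg h2]
  simp only [h1]

/-- The orientation of the Reeb direction and `2n` further vectors, through the projections of the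
latter; the sign is that of the permutation of the coordinates. The Reeb direction is the last of
    the
`2n + 1` coordinates, so that moving it to the first place costs no sign. -/
theorem orientDet_cons_reebField (R : ℝ) (e f : Fin n → Space n) :
    orientDet (Fin.cons (R • reebField) (Fin.append e f)) =
      (-1) ^ (n * (n - 1) / 2) * (R * (fromBlocks (of fun i j => ((e i).1 j).re)
        (of fun i j => ((e i).1 j).im) (of fun i j => ((f i).1 j).re)
        (of fun i j => ((f i).1 j).im)).det) := by
  set w : Fin (n + n + 1) → Space n := Fin.cons (R • reebField) (Fin.append e f) with hw
  set M : Matrix (Fin (n + n + 1)) (Fin (n + n + 1)) ℝ := of fun i k => coords (w i) k with hM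
  have h1 := det_permute' (interleavePerm n) M
  rw [sign_interleavePerm] at h1
  set N := M.submatrix id (interleavePerm n) with hN
  have hN0 : ∀ j, N 0 j = if j = 0 then R else 0 := by
    have hw0 : w 0 = (0, R) := by simp [hw, reebField]
    refine forall_fin_add_add_one ?_ (fun k => ?_) (fun k => ?_)
    · simp [hN, hM, interleavePerm_apply, interleave_zero, coords_last, hw0]
    · rw [if_neg (Fin.succ_ne_zero _)]
      simp only [hN, hM, submatrix_apply, of_apply, interleavePerm_apply, id,
        coords_interleave_castAdd, hw0]
      simp
    · rw [if_neg (Fin.succ_ne_zero _)]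
      simp only [hN, hM, submatrix_apply, of_apply, interleavePerm_apply, id,
        coords_interleave_natAdd, hw0]
      simp
  have h2 : N.det = R * (fromBlocks (of fun i j => ((e i).1 j).re)
        (of fun i j => ((e i).1 j).im) (of fun i j => ((f i).1 j).re)
        (of fun i j => ((f i).1 j).im)).det := by
    rw [det_succ_row_zero, Finset.sum_eq_single 0]
    · rw [hN0, if_pos rfl, Fin.val_zero, pow_zero, one_mul, ← det_submatrix_equiv_self
          finSumFinEquiv]
      congr 2
      ext i j
      rcases i with i | i <;> rcases j with j | j <;>
        simp only [submatrix_apply, finSumFinEquiv_apply_left, finSumFinEquiv_apply_right,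
          Fin.succAbove_zero, fromBlocks_apply₁₁, fromBlocks_apply₁₂, fromBlocks_apply₂₁,
          fromBlocks_apply₂₂, hN, hM, hw, of_apply, id, Fin.cons_succ, Fin.append_left,
          Fin.append_right, interleavePerm_apply, coords_interleave_castAdd,
          coords_interleave_natAdd]
    · intro j _ hj
      rw [hN0, if_neg hj]
      simp
    · simp
  have h3 : orientDet w = M.det := rfl
  rw [h3, ← h2, h1]
  push_cast
  rw [← mul_assoc, ← mul_pow]
  norm_num

/-- The orientation of a frame of the Reeb direction and two Lagrangian frames that are related by
a compatible complex structure. -/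
theorem orientDet_pos_of_compatible {I : Cn n →ₗ[ℝ] Cn n} (hI : IsCompatible I)
    {e f : Fin n → Space n} (hf : LinearIndependent ℝ fun i => (f i).1)
    (h0 : ∀ i j, symplecticForm (f i).1 (f j).1 = 0) {a : Matrix (Fin n) (Fin n) ℝ}
    (hdet : a.det ≠ 0) (he : ∀ i, (e i).1 = ∑ k, a i k • I (f k).1) {R : ℝ} (hR : 0 < R) :
    0 < (-1) ^ (n * (n - 1) / 2 + n) * a.det *
      orientDet (Fin.cons (R • reebField) (Fin.append e f)) := by
  set Q : Matrix (Fin n) (Fin n) ℝ := of fun i j => symplecticForm (f i).1 (I (f j).1) with hQ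
  have hQpos : Q.PosDef := by
    refine Matrix.PosDef.of_dotProduct_mulVec_pos ?_ fun x hx => ?_
    · ext i j
      simp [hQ, hI.symplecticForm_apply_swap]
    · have h1 : star x ⬝ᵥ Q *ᵥ x =
          symplecticForm (∑ i, x i • (f i).1) (I (∑ i, x i • (f i).1)) := by
        rw [← symplecticBilin_apply]
        simp only [map_sum, map_smul, LinearMap.sum_apply, LinearMap.smul_apply, smul_eq_mul,
          symplecticBilin_apply, dotProduct, mulVec, hQ, of_apply, Pi.star_apply, star_trivial,
          Finset.mul_sum]
        rw [Finset.sum_comm]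
        exact Finset.sum_congr rfl fun i _ => Finset.sum_congr rfl fun j _ => by ring
      rw [h1]
      refine hI.pos _ fun h => hx ?_
      exact funext (Fintype.linearIndependent_iff.1 hf x h)
  have h1 : (of fun i j => symplecticForm (e i).1 (f j).1) = -(a * Qᵀ) := by
    ext i j
    rw [of_apply, he, ← symplecticBilin_apply]
    simp only [map_sum, map_smul, LinearMap.sum_apply, LinearMap.smul_apply, smul_eq_mul,
      symplecticBilin_apply, Matrix.neg_apply, mul_apply, transpose_apply, hQ, of_apply,
      ← Finset.sum_neg_distrib]
    refine Finset.sum_congr rfl fun k _ => ?_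
    rw [symplecticForm_swap]
    ring
  rw [orientDet_cons_reebField, det_fromBlocks_re_im (fun i => (e i).1) hf h0, h1, det_neg,
    det_mul, det_transpose, Fintype.card_fin]
  have h2 : ((-1 : ℝ) ^ (n * (n - 1) / 2)) * (-1) ^ (n * (n - 1) / 2) = 1 := by
    rw [← mul_pow]; norm_num
  have h3 : ((-1 : ℝ) ^ n) * (-1) ^ n = 1 := by
    rw [← mul_pow]; norm_num
  have h4 : (-1 : ℝ) ^ (n * (n - 1) / 2 + n) * a.det * ((-1) ^ (n * (n - 1) / 2) *
      (R * ((-1) ^ n * (a.det * Q.det)))) = R * Q.det * a.det ^ 2 := by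
    rw [pow_add]
    linear_combination (R * Q.det * a.det ^ 2) * ((-1 : ℝ) ^ n * (-1) ^ n) * h2 +
      (R * Q.det * a.det ^ 2) * h3
  rw [h4]
  have := hQpos.det_pos
  positivity

end LegendrianTB

end

noncomputable section

namespace LegendrianTB

/-! ### Tangent spaces of Legendrian submanifolds -/

open Set

variable {n : ℕ}

theorem hasDerivAt_contactForm {g w : ℝ → Space n} {g' w' : Space n} {t : ℝ}
    (hg : HasDerivAt g g' t) (hw : HasDerivAt w w' t) :
    HasDerivAt (fun s => contactForm (g s) (w s))
      (contactForm (g t) w' - ∑ j, (g'.1 j).im * ((w t).1 j).re) t := by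
  have him : ∀ j, HasDerivAt (fun s => ((g s).1 j).im) (g'.1 j).im t := fun j =>
    (Complex.imCLM.comp ((ContinuousLinearMap.proj j).comp
      (ContinuousLinearMap.fst ℝ (Cn n) ℝ))).hasFDerivAt.comp_hasDerivAt t hg
  have hre : ∀ j, HasDerivAt (fun s => ((w s).1 j).re) (w'.1 j).re t := fun j =>
    (Complex.reCLM.comp ((ContinuousLinearMap.proj j).comp
      (ContinuousLinearMap.fst ℝ (Cn n) ℝ))).hasFDerivAt.comp_hasDerivAt t hw
  have h2 : HasDerivAt (fun s => (w s).2) w'.2 t :=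
    (ContinuousLinearMap.snd ℝ (Cn n) ℝ).hasFDerivAt.comp_hasDerivAt t hw
  have h3 := h2.sub (HasDerivAt.fun_sum fun j (_ : j ∈ Finset.univ) => (him j).mul (hre j))
  convert! h3 using 1
  rw [contactForm, Finset.sum_add_distrib]
  ring

/-- The tangent spaces of a Legendrian submanifold project to isotropic subspaces: differentiating
`α = 0` along the submanifold gives `dα = 0`, by the symmetry of second derivatives. -/
theorem IsParam.symplecticForm_eq_zero {L : Set (Space n)} (hL : IsLegendrian L)
    {dom : Set (Fin n → ℝ)} {cod : Set (Space n)} {par : (Fin n → ℝ) → Space n}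
    {coord : Space n → Fin n → ℝ} (h : IsParam L dom cod par coord) {x : Fin n → ℝ} (hx : x ∈ dom)
    (u v : Fin n → ℝ) : symplecticForm (fderiv ℝ par x u).1 (fderiv ℝ par x v).1 = 0 := by
  have key : ∀ u v : Fin n → ℝ, contactForm (par x) (fderiv ℝ (fderiv ℝ par) x u v) =
      ∑ j, ((fderiv ℝ par x u).1 j).im * ((fderiv ℝ par x v).1 j).re := by
    intro u v
    have hline : HasDerivAt (fun t : ℝ => x + t • u) u 0 := by
      simpa using ((hasDerivAt_id (0 : ℝ)).smul_const u).const_add x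
    have hg : HasDerivAt (fun t : ℝ => par (x + t • u)) (fderiv ℝ par x u) 0 :=
      HasFDerivAt.comp_hasDerivAt (0 : ℝ) (l := par) (l' := fderiv ℝ par x)
        (by simpa using (h.differentiableAt_par x).hasFDerivAt) hline
    have hD : HasDerivAt (fun t : ℝ => fderiv ℝ par (x + t • u))
        (fderiv ℝ (fderiv ℝ par) x u) 0 :=
      HasFDerivAt.comp_hasDerivAt (0 : ℝ) (l := fderiv ℝ par) (l' := fderiv ℝ (fderiv ℝ par) x)
        (by simpa using ((h.contDiff_par.fderiv_right (m := ∞) (by simp)).differentiable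
          (by simp) x).hasFDerivAt) hline
    have hw : HasDerivAt (fun t : ℝ => fderiv ℝ par (x + t • u) v)
        (fderiv ℝ (fderiv ℝ par) x u v) 0 :=
      (ContinuousLinearMap.apply ℝ (Space n) v).hasFDerivAt.comp_hasDerivAt (0 : ℝ) hD
    have h1 := hasDerivAt_contactForm hg hw
    simp only [zero_smul, add_zero] at h1
    have h2 : (fun t : ℝ => contactForm (par (x + t • u)) (fderiv ℝ par (x + t • u) v)) =ᶠ[𝓝 0]
        fun _ => 0 := by
      have h3 : ∀ᶠ t in 𝓝 (0 : ℝ), x + t • u ∈ dom :=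
        hline.continuousAt.eventually (h.isOpen_dom.mem_nhds (by simpa using hx))
      filter_upwards [h3] with t ht
      exact hL.tangent _ (h.par_mem _ ht) _ (h.fderiv_par_mem ht v)
    have h4 := (h1.congr_of_eventuallyEq h2.symm).unique (hasDerivAt_const (0 : ℝ) (0 : ℝ))
    linarith
  have hsymm : fderiv ℝ (fderiv ℝ par) x u v = fderiv ℝ (fderiv ℝ par) x v u :=
    ((h.contDiff_par.contDiffAt).isSymmSndFDerivAt (by
      rw [minSmoothness_of_isRCLikeNormedField]
      exact WithTop.coe_le_coe.2 le_top)).eq u v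
  have h1 := key u v
  have h2 := key v u
  rw [hsymm, h2] at h1
  rw [symplecticForm, Finset.sum_sub_distrib, ← h1, sub_eq_zero]
  exact Finset.sum_congr rfl fun j _ => mul_comm _ _

/-- The projection to `ℂⁿ` is injective on the contact planes. -/
theorem IsLegendrian.eq_zero_of_fst {L : Set (Space n)} (hL : IsLegendrian L) {p : Space n}
    (hp : p ∈ L) {v : Space n} (hv : v ∈ tangentSpaceAt L p) (h0 : v.1 = 0) : v = 0 := by
  have h1 := hL.tangent p hp v hv
  rw [contactForm, h0] at h1
  exact Prod.ext h0 (by simpa using h1)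

theorem IsLegendrian.linearIndependent_fst {L : Set (Space n)} (hL : IsLegendrian L) {p : Space n}
    (hp : p ∈ L) {e : Fin n → Space n} (he : ∀ i, e i ∈ tangentSpaceAt L p)
    (hi : LinearIndependent ℝ e) : LinearIndependent ℝ fun i => (e i).1 := by
  rw [Fintype.linearIndependent_iff] at hi ⊢
  intro g hg
  refine hi g (hL.eq_zero_of_fst hp (Submodule.sum_mem _ fun i _ =>
    Submodule.smul_mem _ _ (he i)) ?_)
  rw [← hg, Prod.fst_sum]
  rfl

theorem IsPositiveFrame.linearIndependent {L : Set (Space n)} {τ : FormField n} {p : Space n}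
    {e : Fin n → Space n} (he : IsPositiveFrame L τ p e) : LinearIndependent ℝ e := by
  by_contra h
  exact he.2.ne' ((τ p).toAlternatingMap.map_linearDependent e h)

/-- The orientation only serves to choose a parametrization. -/
theorem finrank_tangentSpaceAt {L : Set (Space n)} (hL : IsSubmanifold L) {τ : FormField n}
    (hτ : IsOrientation L τ) {p : Space n} (hp : p ∈ L) :
    Module.finrank ℝ (tangentSpaceAt L p) = n := by
  obtain ⟨dom, cod, par, coord, σ, h, hpc, -⟩ := exists_isParam hL hτ hp
  have hx := h.coord_mem p hp hpc
  have h1 := h.tangentSpaceAt_eq hx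
  rw [h.par_coord p hp hpc] at h1
  have h2 := finrank_span_eq_card (h.linearIndependent hx)
  rw [Fintype.card_fin] at h2
  have h3 : tangentSpaceAt L p =
      Submodule.span ℝ (range fun k => fderiv ℝ par (coord p) (Pi.single k 1)) := by
    rw [h1, LinearMap.range_eq_map, ← (Pi.basisFun ℝ (Fin n)).span_eq, Submodule.map_span,
      ← Set.range_comp]
    congr 2
    ext1 k
    simp
  rw [h3, h2]

theorem IsLegendrian.isLagrangian_projTangent {L : Set (Space n)} (hL : IsLegendrian L)
    {τ : FormField n} (hτ : IsOrientation L τ) {p : Space n} (hp : p ∈ L) :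
    IsLagrangian (projTangent L p) := by
  constructor
  · set φ : tangentSpaceAt L p →ₗ[ℝ] Cn n :=
      (LinearMap.fst ℝ (Cn n) ℝ).comp (tangentSpaceAt L p).subtype with hφ
    have h1 : projTangent L p = LinearMap.range φ := by
      rw [hφ, LinearMap.range_comp, Submodule.range_subtype, projTangent]
    rw [h1, LinearMap.finrank_range_of_inj, finrank_tangentSpaceAt hL.submanifold hτ hp]
    rw [← LinearMap.ker_eq_bot, LinearMap.ker_eq_bot']
    exact fun v hv => Subtype.ext (hL.eq_zero_of_fst hp v.2 hv)
  · obtain ⟨dom, cod, par, coord, σ, h, hpc, -⟩ := exists_isParam hL.submanifold hτ hp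
    have hx := h.coord_mem p hp hpc
    have h1 := h.tangentSpaceAt_eq hx
    rw [h.par_coord p hp hpc] at h1
    rw [projTangent, h1]
    rintro _ ⟨_, ⟨u, rfl⟩, rfl⟩ _ ⟨_, ⟨v, rfl⟩, rfl⟩
    exact h.symplecticForm_eq_zero hL hx u v

/-- The ratio of the complex determinant of the projected tangent spaces of an oriented Legendrian
submanifold to the orientation form: a nowhere vanishing continuous function. Up to positive
factors, it is the phase of the Lagrangian projection. -/
theorem IsLegendrian.exists_phase {L : Set (Space n)} (hL : IsLegendrian L) {τ : FormField n}
    (hτ : IsOrientation L τ) :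
    ∃ U : Space n → ℂ, ContinuousOn U L ∧ ∀ p ∈ L, U p ≠ 0 ∧ ∀ e : Fin n → Space n,
      (∀ i, e i ∈ tangentSpaceAt L p) → (Matrix.of fun i => (e i).1).det = τ p e * U p := by
  have hbasis : ∀ p : L, ∃ f : Fin n → Space n, (∀ i, f i ∈ tangentSpaceAt L p) ∧
      LinearIndependent ℝ f := fun p =>
    exists_basis_of_finrank (finrank_tangentSpaceAt hL.submanifold hτ p.2)
  choose f hf hfi using hbasis
  -- both sides are top forms on the tangent space, so their ratio does not depend on the frame `f
  -- p`
  set U : Space n → ℂ := fun p => open Classical in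
    if hp : p ∈ L then (Matrix.of fun i => (f ⟨p, hp⟩ i).1).det / τ p (f ⟨p, hp⟩) else 0 with hU
  have hU1 : ∀ p ∈ L, U p ≠ 0 ∧ ∀ e : Fin n → Space n,
      (∀ i, e i ∈ tangentSpaceAt L p) → (Matrix.of fun i => (e i).1).det = τ p e * U p := by
    intro p hp
    have h1 : τ p (f ⟨p, hp⟩) ≠ 0 := hτ.nonvanishing p hp _ (hf ⟨p, hp⟩) (hfi ⟨p, hp⟩)
    have h1' : (τ p (f ⟨p, hp⟩) : ℂ) ≠ 0 := Complex.ofReal_ne_zero.2 h1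
    have h2 : U p = (Matrix.of fun i => (f ⟨p, hp⟩ i).1).det / τ p (f ⟨p, hp⟩) := dif_pos hp
    constructor
    · rw [h2]
      refine div_ne_zero ((hL.isLagrangian_projTangent hτ hp).det_ne_zero (fun i => ?_)
        (hL.linearIndependent_fst hp (hf ⟨p, hp⟩) (hfi ⟨p, hp⟩))) h1'
      exact Submodule.mem_map_of_mem (hf ⟨p, hp⟩ i)
    · intro e he
      obtain ⟨a, ha⟩ := exists_eq_sum_smul (finrank_tangentSpaceAt hL.submanifold hτ hp)
        (hf ⟨p, hp⟩) (hfi ⟨p, hp⟩) he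
      have h3 : (fun i => (e i).1) = fun i => ∑ k, a i k • (f ⟨p, hp⟩ k).1 := by
        ext1 i
        rw [ha, Prod.fst_sum]
        rfl
      have h4 : τ p e = a.det * τ p (f ⟨p, hp⟩) := by
        rw [ha]
        exact alternatingMap_sum_smul (τ p).toAlternatingMap a _
      rw [h3, det_sum_smul, h4, h2]
      push_cast
      field_simp
  refine ⟨U, fun p hp => ?_, hU1⟩
  -- near `p`, the ratio is computed with the coordinate frame `F`
  obtain ⟨dom, cod, par, coord, σ, h, hpc, -⟩ := exists_isParam hL.submanifold hτ hp
  set F : Space n → Fin n → Space n := fun q k => fderiv ℝ par (coord q) (Pi.single k 1) with hF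
  have hFT : ∀ q ∈ L, q ∈ cod → (∀ i, F q i ∈ tangentSpaceAt L q) ∧ τ q (F q) ≠ 0 := by
    intro q hq hqc
    have hx := h.coord_mem q hq hqc
    have h1 : ∀ i, F q i ∈ tangentSpaceAt L q := by
      intro i
      have := h.fderiv_par_mem hx (Pi.single i 1)
      rwa [h.par_coord q hq hqc] at this
    exact ⟨h1, hτ.nonvanishing q hq _ h1 (h.linearIndependent hx)⟩
  have hUeq : ∀ q ∈ L, q ∈ cod → U q = (Matrix.of fun i => (F q i).1).det / τ q (F q) := by
    intro q hq hqc
    rw [(hU1 q hq).2 _ (hFT q hq hqc).1, mul_div_cancel_left₀]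
    exact Complex.ofReal_ne_zero.2 (hFT q hq hqc).2
  have hFc : ContinuousAt F p := by
    refine continuousAt_pi.2 fun k => ?_
    have h1 : ContinuousAt (fun q => fderiv ℝ par (coord q)) p :=
      ContinuousAt.comp (g := fderiv ℝ par)
        (h.contDiff_par.continuous_fderiv (by simp)).continuousAt
        (h.differentiableAt_coord hpc).continuousAt
    exact h1.clm_apply continuousAt_const
  have hdet : ContinuousAt (fun q => (Matrix.of fun i => (F q i).1).det) p := by
    have h1 : Continuous fun w : Fin n → Space n => (Matrix.of fun i => (w i).1).det :=
      Continuous.matrix_det (continuous_pi fun i => continuous_pi fun j => by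
        simp only [Matrix.of_apply]; fun_prop)
    exact ContinuousAt.comp (g := fun w : Fin n → Space n => (Matrix.of fun i => (w i).1).det)
      h1.continuousAt hFc
  have hτc : ContinuousWithinAt (fun q => τ q (F q)) L p := by
    have h1 : ContinuousWithinAt (fun q => (τ q, F q)) L p :=
      (hτ.continuousOn p hp).prodMk hFc.continuousWithinAt
    have h2 : Continuous fun q : ((Space n) [⋀^Fin n]→L[ℝ] ℝ) × (Fin n → Space n) => q.1 q.2 :=
      continuous_eval
    exact ContinuousAt.comp_continuousWithinAt
      (g := fun q : ((Space n) [⋀^Fin n]→L[ℝ] ℝ) × (Fin n → Space n) => q.1 q.2)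
      h2.continuousAt h1
  have hquot : ContinuousWithinAt (fun q => (Matrix.of fun i => (F q i).1).det / (τ q (F q) : ℂ))
      L p :=
    hdet.continuousWithinAt.div (Complex.continuous_ofReal.continuousAt.comp_continuousWithinAt hτc)
      (Complex.ofReal_ne_zero.2 (hFT p hp hpc).2)
  refine hquot.congr_of_eventuallyEq ?_ (hUeq p hp hpc)
  filter_upwards [self_mem_nhdsWithin, nhdsWithin_le_nhds (h.isOpen_cod.mem_nhds hpc)] with q hq hqc
  exact hUeq q hq hqc

end LegendrianTB

end

noncomputable section

namespace LegendrianTB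

/-! ### Conley–Zehnder indices of Reeb chords -/

open Set

variable {n : ℕ}

theorem eq_of_continuousOn_of_forall_int {g : ℝ → ℝ} (hg : ContinuousOn g (Icc 0 1))
    (h : ∀ t ∈ Icc (0 : ℝ) 1, ∃ k : ℤ, g t = k) : g 1 = g 0 := by
  have : DiscreteTopology (range ((↑) : ℤ → ℝ)) :=
    (Int.isClosedEmbedding_coe_real.isEmbedding.toHomeomorph).symm.isEmbedding.discreteTopology
  refine isPreconnected_Icc.constant_of_mapsTo (T := range ((↑) : ℤ → ℝ)) ⟨this⟩ hg (fun t ht => ?_)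
    (right_mem_Icc.2 zero_le_one) (left_mem_Icc.2 zero_le_one)
  obtain ⟨k, hk⟩ := h t ht
  exact ⟨k, hk.symm⟩

/-- Two continuous arguments of the same loop differ by a constant multiple of `2π`. -/
theorem HasMaslovIndex.unique {Γ : ℝ → Submodule ℝ (Cn n)} {m m' : ℤ} (h : HasMaslovIndex Γ m)
    (h' : HasMaslovIndex Γ m') : m = m' := by
  obtain ⟨hΓ, -, θ, hθc, hθ, hm⟩ := h
  obtain ⟨-, -, θ', hθc', hθ', hm'⟩ := h'
  have hπ := Real.pi_pos
  have h1 : ∀ t ∈ Icc (0 : ℝ) 1, ∃ k : ℤ, (θ t - θ' t) / (2 * Real.pi) = k := by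
    intro t ht
    obtain ⟨v, hv, hvi⟩ := exists_basis_of_finrank (hΓ t ht).1
    have hd := (hΓ t ht).det_ne_zero hv hvi
    have hd' : (‖(Matrix.of v).det‖ : ℂ) ^ 2 ≠ 0 :=
      pow_ne_zero _ (Complex.ofReal_ne_zero.2 (norm_ne_zero_iff.2 hd))
    have h2 := (hθ t ht v hv hvi).symm.trans (hθ' t ht v hv hvi)
    obtain ⟨k, hk⟩ := Complex.exp_eq_exp_iff_exists_int.1 (mul_left_cancel₀ hd' h2)
    refine ⟨k, ?_⟩
    have h3 := congrArg Complex.im hk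
    simp at h3
    rw [h3]
    field_simp
    ring
  have h2 := eq_of_continuousOn_of_forall_int ((hθc.sub hθc').div_const _) h1
  field_simp at h2
  simp only [Pi.sub_apply] at h2
  have h3 : 2 * Real.pi * (m : ℝ) = 2 * Real.pi * m' := by
    rw [← hm, ← hm']
    linarith
  exact_mod_cast mul_left_cancel₀ (by positivity) h3

/-- A real multiple of `exp ℓ` has argument `Im ℓ` up to sign. -/
theorem sq_eq_of_real_mul_exp (b : ℝ) (ℓ : ℂ) :
    ((b : ℂ) * Complex.exp ℓ) ^ 2 = (‖(b : ℂ) * Complex.exp ℓ‖ : ℂ) ^ 2 *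
      Complex.exp (((2 * ℓ.im : ℝ) : ℂ) * Complex.I) := by
  have h1 : (‖(b : ℂ) * Complex.exp ℓ‖ : ℂ) ^ 2 = (b : ℂ) ^ 2 * Complex.exp ℓ.re ^ 2 := by
    rw [norm_mul, Complex.norm_exp, Complex.norm_real, ← Complex.ofReal_pow, mul_pow,
      Real.norm_eq_abs, sq_abs]
    push_cast
    ring
  rw [h1, mul_pow, mul_assoc, ← Complex.exp_nat_mul, ← Complex.exp_nat_mul, ← Complex.exp_add]
  congr 2
  conv_lhs => rw [← Complex.re_add_im ℓ]
  push_cast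
  ring

/-- If `exp z` is real, then its sign is the parity of the number of half turns. -/
theorem exists_im_eq_of_exp_eq_real {z : ℂ} {q : ℝ} (h : Complex.exp z = q) :
    ∃ k : ℤ, z.im = Real.pi * k ∧ 0 < ((k.negOnePow : ℤ) : ℝ) * q := by
  have h1 := congrArg Complex.im h
  have h2 := congrArg Complex.re h
  rw [Complex.exp_im, Complex.ofReal_im] at h1
  rw [Complex.exp_re, Complex.ofReal_re] at h2
  obtain ⟨k, hk⟩ := Real.sin_eq_zero_iff.1 ((mul_eq_zero.1 h1).resolve_left (Real.exp_pos _).ne')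
  refine ⟨k, by rw [← hk, mul_comm], ?_⟩
  rw [← hk, Real.cos_int_mul_pi] at h2
  rw [← h2]
  rcases Int.even_or_odd k with he | ho
  · simp [Int.negOnePow_even k he, he.neg_one_zpow, Real.exp_pos]
  · simp [Int.negOnePow_odd k ho, ho.neg_one_zpow, Real.exp_pos]

theorem exists_continuous_log {g : ℝ × ℝ → ℂ} (hg : Continuous g) (h0 : ∀ x, g x ≠ 0) :
    ∃ ℓ : ℝ × ℝ → ℂ, Continuous ℓ ∧ ∀ x, Complex.exp (ℓ x) = g x := by
  have h1 : IsSimplyConnected (univ : Set (ℝ × ℝ)) := by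
    have : ContractibleSpace (univ : Set (ℝ × ℝ)) :=
      (convex_univ (𝕜 := ℝ)).contractibleSpace univ_nonempty
    exact inferInstanceAs (SimplyConnectedSpace (univ : Set (ℝ × ℝ)))
  obtain ⟨ℓ, hℓ, hexp⟩ := Complex.exists_continuousOn_eqOn_exp_comp h1 isOpen_univ hg.continuousOn
    (by rintro ⟨x, -, hx⟩; exact h0 x hx)
  exact ⟨ℓ, continuousOn_univ.1 hℓ, fun x => hexp (mem_univ x)⟩

/-- If `A` maps a Lagrangian frame `v` to an isotropic one, and pairs it with `v` symmetrically and
positively, then the frames `cos s v + sin s A v` stay Lagrangian. -/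
theorem det_cos_add_sin_ne_zero {v : Fin n → Cn n} (hv : LinearIndependent ℝ v)
    (h0 : ∀ i j, symplecticForm (v i) (v j) = 0) {A : Cn n →ₗ[ℝ] Cn n}
    (hA0 : ∀ i j, symplecticForm (A (v i)) (A (v j)) = 0)
    (hAs : ∀ i j, symplecticForm (v i) (A (v j)) = symplecticForm (v j) (A (v i)))
    (hAp : ∀ u, u ≠ 0 → 0 < symplecticForm u (A u)) (s : ℝ) :
    (Matrix.of fun i => Real.cos s • v i + Real.sin s • A (v i)).det ≠ 0 := by
  refine det_ne_zero_of_isotropic ?_ fun i j => ?_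
  · rw [Fintype.linearIndependent_iff] at hv ⊢
    intro g hg
    refine hv g ?_
    set u := ∑ i, g i • v i with hu
    have h1 : Real.cos s • u + Real.sin s • A u = 0 := by
      rw [← hg, hu, map_sum, Finset.smul_sum, Finset.smul_sum, ← Finset.sum_add_distrib]
      refine Finset.sum_congr rfl fun i _ => ?_
      rw [map_smul, smul_add, smul_comm (g i), smul_comm (g i)]
    by_contra hne
    have h2 : Real.sin s * symplecticForm u (A u) = 0 := by
      have h3 : symplecticForm u (Real.cos s • u + Real.sin s • A u) = 0 := by
        rw [h1, ← symplecticBilin_apply, map_zero]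
      rwa [symplecticForm_add_right, symplecticForm_smul_right, symplecticForm_smul_right,
        symplecticForm_self, mul_zero, zero_add] at h3
    have h4 : Real.sin s = 0 := (mul_eq_zero.1 h2).resolve_right (hAp u hne).ne'
    rw [h4, zero_smul, add_zero, smul_eq_zero] at h1
    have h5 := Real.cos_sq_add_sin_sq s
    rw [h1.resolve_right hne, h4] at h5
    norm_num at h5
  · simp only [symplecticForm_add_left, symplecticForm_add_right, symplecticForm_smul_left,
      symplecticForm_smul_right, h0, hA0]
    rw [symplecticForm_swap (v j) (A (v i)), hAs i j]
    ring

/-- The capped loop of a Reeb chord has a Maslov index, which does not depend on the compatible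
complex structure. Its parity compares the orientations at the ends of the chord. The argument of
    the
determinant of the loop is lifted simultaneously over the segment from `I` to `I'`. -/
theorem exists_hasMaslovIndex {L : Set (Space n)} (hL : IsLegendrian L) {τ : FormField n}
    (hτ : IsOrientation L τ) (c : ReebChord L) (γ : Path c.upper c.lower)
    {I I' : Cn n →ₗ[ℝ] Cn n} (hI : IsCompatible I) (hI' : IsCompatible I')
    (hIV : (projTangent L (c.lower : Space n)).map I = projTangent L (c.upper : Space n))
    (hIV' : (projTangent L (c.lower : Space n)).map I' = projTangent L (c.upper : Space n))
    {e f : Fin n → Space n} (he : ∀ i, e i ∈ tangentSpaceAt L (c.upper : Space n))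
    (hf : ∀ i, f i ∈ tangentSpaceAt L (c.lower : Space n)) (hfi : LinearIndependent ℝ f)
    (hef : ∀ i, (e i).1 = I (f i).1) :
    ∃ m : ℤ, HasMaslovIndex (cappedPath c γ I) m ∧ HasMaslovIndex (cappedPath c γ I') m ∧
      0 < ((m.negOnePow : ℤ) : ℝ) * (τ c.upper e * τ c.lower f) := by
  obtain ⟨U, hUc, hU⟩ := hL.exists_phase hτ
  have hlag0 := hL.isLagrangian_projTangent hτ c.upper.2
  have hlag1 := hL.isLagrangian_projTangent hτ c.lower.2
  set κ := τ c.lower f with hκ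
  have hκ0 : κ ≠ 0 := hτ.nonvanishing _ c.lower.2 _ hf hfi
  have hκ0' : (κ : ℂ) ≠ 0 := Complex.ofReal_ne_zero.2 hκ0
  set v : Fin n → Cn n := fun i => (f i).1 with hv
  have hvi : LinearIndependent ℝ v := hL.linearIndependent_fst c.lower.2 hf hfi
  have hvV : ∀ i, v i ∈ projTangent L (c.lower : Space n) := fun i =>
    Submodule.mem_map_of_mem (hf i)
  -- `A r` runs through the segment from `I` to `I'`; `ρ` clamps the parameter to `[0, 1]`, so
  -- that all functions are defined on `ℝ × ℝ`
  set ρ : ℝ → ℝ := fun r => max 0 (min 1 r) with hρ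
  have hρ0 : ∀ r, 0 ≤ ρ r := fun r => le_max_left _ _
  have hρ1 : ∀ r, ρ r ≤ 1 := fun r => max_le zero_le_one (min_le_left _ _)
  have hρc : Continuous ρ := by fun_prop
  set A : ℝ → Cn n →ₗ[ℝ] Cn n := fun r => (1 - ρ r) • I + ρ r • I' with hA
  have hAa : ∀ r u, A r u = (1 - ρ r) • I u + ρ r • I' u := fun r u => rfl
  have hA0 : A 0 = I := by
    have : ρ 0 = 0 := by simp [hρ]
    simp [hA, this]
  have hA1 : A 1 = I' := by
    have : ρ 1 = 1 := by simp [hρ]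
    simp [hA, this]
  have hAV : ∀ r i, A r (v i) ∈ projTangent L (c.upper : Space n) := by
    intro r i
    refine Submodule.add_mem _ (Submodule.smul_mem _ _ ?_) (Submodule.smul_mem _ _ ?_)
    · rw [← hIV]; exact Submodule.mem_map_of_mem (hvV i)
    · rw [← hIV']; exact Submodule.mem_map_of_mem (hvV i)
  set d : ℝ → ℝ → ℂ := fun r s =>
    (Matrix.of fun i => Real.cos s • v i + Real.sin s • A r (v i)).det with hd
  have hd0 : ∀ r s, d r s ≠ 0 := by
    intro r s
    refine det_cos_add_sin_ne_zero hvi (fun i j => hlag1.2 _ (hvV i) _ (hvV j))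
      (fun i j => hlag0.2 _ (hAV r i) _ (hAV r j)) (fun i j => ?_) (fun u hu => ?_) s
    · rw [hAa, hAa]
      simp only [symplecticForm_add_right, symplecticForm_smul_right]
      rw [hI.symplecticForm_apply_swap (v i), hI'.symplecticForm_apply_swap (v i)]
    · rw [hAa]
      simp only [symplecticForm_add_right, symplecticForm_smul_right]
      have h1 := hI.pos u hu
      have h2 := hI'.pos u hu
      rcases (hρ0 r).eq_or_lt with h3 | h3
      · rw [← h3]; linarith
      · have := mul_pos h3 h2
        have := mul_nonneg (sub_nonneg.2 (hρ1 r)) h1.le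
        linarith
  have hdc : Continuous fun x : ℝ × ℝ => d x.1 (Real.pi / 2 * (2 * x.2 - 1)) := by
    refine Continuous.matrix_det (continuous_pi fun i => continuous_pi fun j => ?_)
    simp only [Matrix.of_apply, hAa, Pi.add_apply, Pi.smul_apply]
    fun_prop
  have hext : ∀ t : ℝ, ((γ.extend t : L) : Space n) ∈ L := fun t => (γ.extend t).2
  have hγc : Continuous fun t : ℝ => U (γ.extend t : L) :=
    hUc.comp_continuous (continuous_subtype_val.comp γ.continuous_extend) hext
  -- a nonvanishing function of which the determinant of every frame is a real multiple
  set G : ℝ × ℝ → ℂ := fun x => if x.2 ≤ 1 / 2 then U (γ.extend (2 * x.2) : L)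
    else d x.1 (Real.pi / 2 * (2 * x.2 - 1)) / κ with hG
  have hGc : Continuous G := by
    refine Continuous.if_le (hγc.comp (by fun_prop)) (hdc.div_const _) continuous_snd
      continuous_const fun x hx => ?_
    have h1 : 2 * x.2 = 1 := by linarith
    rw [h1, γ.extend_one, sub_self, mul_zero, eq_div_iff hκ0', mul_comm]
    have h2 := (hU _ c.lower.2).2 f hf
    rw [← h2]
    simp [hd, hv]
  have hG0 : ∀ x, G x ≠ 0 := by
    intro x
    simp only [hG]
    split_ifs
    · exact (hU _ (hext _)).1
    · exact div_ne_zero (hd0 _ _) hκ0'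
  obtain ⟨ℓ, hℓc, hℓ⟩ := exists_continuous_log hGc hG0
  have hstart : ∀ r, G (r, 0) = U c.upper := by
    intro r
    simp [hG]
  have hend : ∀ r, ∀ w : Fin n → Space n, (∀ i, w i ∈ tangentSpaceAt L (c.upper : Space n)) →
      (∀ i, (w i).1 = A r (v i)) →
      Complex.exp (ℓ (r, 1) - ℓ (r, 0)) = ((τ c.upper w / κ : ℝ) : ℂ) := by
    intro r w hw hwA
    have h1 : G (r, 1) = d r (Real.pi / 2) / κ := by
      simp only [hG]
      rw [if_neg (by norm_num)]
      norm_num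
    have h2 : d r (Real.pi / 2) = τ c.upper w * U c.upper := by
      rw [← (hU _ c.upper.2).2 w hw]
      simp only [hd, Real.cos_pi_div_two, Real.sin_pi_div_two, zero_smul, one_smul, zero_add, hwA]
    rw [Complex.exp_sub, hℓ, hℓ, h1, h2, hstart]
    have := (hU _ c.upper.2).1
    push_cast
    field_simp
  -- the ends of the loop are frames of the same space, so the total change of the argument is an
  -- integer multiple of `π`, and does not depend on `r`
  have hint : ∀ r, ∃ k : ℤ, (ℓ (r, 1) - ℓ (r, 0)).im / Real.pi = k := by
    intro r
    choose w hw hwA using fun i => Submodule.mem_map.1 (hAV r i)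
    obtain ⟨k, hk, -⟩ := exists_im_eq_of_exp_eq_real (hend r w hw hwA)
    refine ⟨k, ?_⟩
    rw [hk]
    field_simp
  have hconst : (ℓ (1, 1) - ℓ (1, 0)).im / Real.pi = (ℓ (0, 1) - ℓ (0, 0)).im / Real.pi :=
    eq_of_continuousOn_of_forall_int (g := fun r => (ℓ (r, 1) - ℓ (r, 0)).im / Real.pi)
      (by fun_prop) fun r _ => hint r
  obtain ⟨m, hm, hsign⟩ := exists_im_eq_of_exp_eq_real (hend 0 e he (by rw [hA0]; exact hef))
  have hπ := Real.pi_pos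
  have hm1 : (ℓ (1, 1) - ℓ (1, 0)).im = Real.pi * m := by
    rw [← hm]
    field_simp at hconst
    exact hconst
  have main : ∀ r, (ℓ (r, 1) - ℓ (r, 0)).im = Real.pi * m → IsCompatible (A r) →
      (projTangent L (c.lower : Space n)).map (A r) = projTangent L (c.upper : Space n) →
      HasMaslovIndex (cappedPath c γ (A r)) m := by
    intro r hr hAr hArV
    refine ⟨fun t _ => ?_, ?_, fun t => 2 * (ℓ (r, t)).im, by fun_prop, ?_, ?_⟩
    · rw [cappedPath]
      split_ifs
      · exact hL.isLagrangian_projTangent hτ (hext _)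
      · exact hlag1.rotate hAr _
    · rw [cappedPath, cappedPath, if_pos (by norm_num), if_neg (by norm_num), rotate]
      norm_num
      rw [← hArV]
    · intro t _ w hw hwi
      obtain ⟨b, hb⟩ : ∃ b : ℝ, (Matrix.of w).det = b * Complex.exp (ℓ (r, t)) := by
        rw [hℓ]
        simp only [cappedPath] at hw
        simp only [hG]
        split_ifs at hw ⊢ with ht
        · choose w' hw' hww' using fun i => Submodule.mem_map.1 (hw i)
          refine ⟨τ (γ.extend (2 * t) : L) w', ?_⟩
          rw [← (hU _ (hext _)).2 w' hw']
          congr 2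
          ext1 i
          exact (hww' i).symm
        · choose w' hw' hww' using fun i => Submodule.mem_map.1 (hw i)
          obtain ⟨a, ha⟩ := exists_eq_sum_smul hlag1.1 hvV hvi hw'
          refine ⟨a.det * κ, ?_⟩
          have h1 : w = fun i => ∑ k, a i k • (Real.cos (Real.pi / 2 * (2 * t - 1)) • v k +
              Real.sin (Real.pi / 2 * (2 * t - 1)) • A r (v k)) := by
            ext1 i
            rw [← hww' i, ha, map_sum]
            refine Finset.sum_congr rfl fun k _ => ?_
            rw [map_smul]
            rfl
          rw [h1, det_sum_smul]
          push_cast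
          field_simp
          rfl
      rw [hb]
      exact sq_eq_of_real_mul_exp b _
    · rw [Complex.sub_im] at hr
      linear_combination 2 * hr
  refine ⟨m, ?_, ?_, ?_⟩
  · have := main 0 hm (by rwa [hA0]) (by rwa [hA0])
    rwa [hA0] at this
  · have := main 1 hm1 (by rwa [hA1]) (by rwa [hA1])
    rwa [hA1] at this
  · have h1 : ((m.negOnePow : ℤ) : ℝ) * (τ c.upper e * κ) =
        ((m.negOnePow : ℤ) : ℝ) * (τ c.upper e / κ) * κ ^ 2 := by
      field_simp
    rw [h1]
    positivity

end LegendrianTB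

end

noncomputable section

namespace LegendrianTB

/-! ### The Thurston–Bennequin invariant -/

variable {n : ℕ}

/-- The sign of a Reeb chord. -/
theorem negOnePow_chord (n : ℕ) (ν : ℤ) :
    ((((((n : ℤ) - 2) * ((n : ℤ) - 1) / 2).negOnePow : ℤ) * ((ν - 1).negOnePow : ℤ) : ℤ) : ℝ) =
      (-1) ^ (n * (n - 1) / 2 + n) * ((ν.negOnePow : ℤ) : ℝ) := by
  have h1 : ((n : ℤ) - 2) * ((n : ℤ) - 1) / 2 = ((n * (n - 1) / 2 : ℕ) : ℤ) + n - 2 * n + 1 := by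
    have h2 : ((n * (n - 1) / 2 : ℕ) : ℤ) = (n : ℤ) * ((n : ℤ) - 1) / 2 := by
      rcases n with _ | n
      · simp
      · push_cast
        simp
    rw [h2, show ((n : ℤ) - 2) * ((n : ℤ) - 1) = (n : ℤ) * ((n : ℤ) - 1) + (-(n : ℤ) + 1) * 2 by
      ring, Int.add_mul_ediv_right _ _ two_ne_zero]
    ring
  rw [h1, Int.negOnePow_succ, Int.negOnePow_sub, Int.negOnePow_two_mul, mul_one, ← Nat.cast_add,
    Int.negOnePow_sub, Int.negOnePow_one]
  have h3 := Int.cast_negOnePow_natCast ℝ (n * (n - 1) / 2 + n)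
  rw [← h3]
  push_cast
  ring

/-- The Conley–Zehnder index of a Reeb chord is well defined, and its parity is the orientation of
    the
Reeb direction together with positive frames at the two ends of the chord. -/
theorem exists_conleyZehnderIndex {L : Set (Space n)} (hLeg : IsLegendrian L)
    (hor : IsOrientable L) (hgen : IsChordGeneric L) (c : ReebChord L)
    (γ : Path c.upper c.lower) :
    ∃ ν : ℤ, (∀ m : ℤ, HasConleyZehnderIndex c γ m ↔ m = ν) ∧
      ∀ τ : FormField n, IsOrientation L τ → ∀ R : ℝ, 0 < R → ∀ e f : Fin n → Space n,
        IsPositiveFrame L τ c.upper e → IsPositiveFrame L τ c.lower f →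
          0 < (-1) ^ (n * (n - 1) / 2 + n) * ((ν.negOnePow : ℤ) : ℝ) *
            orientDet (Fin.cons (R • reebField) (Fin.append e f)) := by
  obtain ⟨τ₀, hτ₀⟩ := hor
  have hlag0 := hLeg.isLagrangian_projTangent hτ₀ c.upper.2
  have hlag1 := hLeg.isLagrangian_projTangent hτ₀ c.lower.2
  have hT0 := finrank_tangentSpaceAt hLeg.submanifold hτ₀ c.upper.2
  have hT1 := finrank_tangentSpaceAt hLeg.submanifold hτ₀ c.lower.2
  obtain ⟨I, hI, hIV⟩ := exists_isCompatible hlag1 hlag0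
    (hgen.transverse _ c.upper.2 _ c.lower.2 c.upper_ne_lower c.fst_eq)
  have hlift : ∀ {J : Cn n →ₗ[ℝ] Cn n},
      (projTangent L (c.lower : Space n)).map J = projTangent L (c.upper : Space n) →
      ∀ f : Fin n → Space n, (∀ i, f i ∈ tangentSpaceAt L (c.lower : Space n)) →
      ∃ e : Fin n → Space n, (∀ i, e i ∈ tangentSpaceAt L (c.upper : Space n)) ∧
        ∀ i, (e i).1 = J (f i).1 := by
    intro J hJ f hf
    have h1 : ∀ i, J (f i).1 ∈ projTangent L (c.upper : Space n) := fun i => by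
      rw [← hJ]
      exact Submodule.mem_map_of_mem (Submodule.mem_map_of_mem (hf i))
    choose e he hef using fun i => Submodule.mem_map.1 (h1 i)
    exact ⟨e, he, hef⟩
  obtain ⟨f₀, hf₀, hfi₀⟩ := exists_basis_of_finrank hT1
  obtain ⟨e₀, he₀, hef₀⟩ := hlift hIV f₀ hf₀
  obtain ⟨ν, hν, -, -⟩ := exists_hasMaslovIndex hLeg hτ₀ c γ hI hI hIV hIV he₀ hf₀ hfi₀ hef₀
  refine ⟨ν, fun m => ⟨?_, ?_⟩, ?_⟩
  · rintro ⟨J, hJ, hJV, hm⟩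
    obtain ⟨k, hk, hk', -⟩ := exists_hasMaslovIndex hLeg hτ₀ c γ hI hJ hIV hJV he₀ hf₀ hfi₀ hef₀
    rw [hm.unique hk', hν.unique hk]
  · rintro rfl
    exact ⟨I, hI, hIV, hν⟩
  · intro τ hτ R hR e f he hf
    have hfi := hf.linearIndependent
    obtain ⟨e', he', hef'⟩ := hlift hIV f hf.1
    obtain ⟨k, hk, -, hsign⟩ := exists_hasMaslovIndex hLeg hτ c γ hI hI hIV hIV he' hf.1 hfi hef'
    rw [← hν.unique hk, ← mul_assoc] at hsign
    -- `e'` is positive or negative according to the parity of `ν`, and `e` is positive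
    have h1 := (pos_iff_pos_of_mul_pos hsign).2 hf.2
    have hei' : LinearIndependent ℝ e' := by
      by_contra h
      have h2 : τ c.upper e' = 0 := (τ c.upper).toAlternatingMap.map_linearDependent e' h
      rw [h2, mul_zero] at h1
      exact lt_irrefl _ h1
    obtain ⟨a, ha⟩ := exists_eq_sum_smul hT0 he' hei' he.1
    have h3 : τ c.upper e = a.det * τ c.upper e' := by
      rw [ha]
      exact alternatingMap_sum_smul (τ c.upper).toAlternatingMap a _
    have h4 : 0 < ((ν.negOnePow : ℤ) : ℝ) * a.det := by
      have h5 := mul_pos h1 he.2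
      rw [h3] at h5
      have h6 : τ c.upper e' ≠ 0 := fun h0 => by
        rw [h0, mul_zero] at h1
        exact lt_irrefl _ h1
      have h7 : ((ν.negOnePow : ℤ) : ℝ) * τ c.upper e' * (a.det * τ c.upper e') =
          ((ν.negOnePow : ℤ) : ℝ) * a.det * τ c.upper e' ^ 2 := by ring
      rw [h7] at h5
      exact (pos_iff_pos_of_mul_pos h5).2 (by positivity)
    have hadet : a.det ≠ 0 := fun h0 => by
      rw [h0, mul_zero] at h4
      exact lt_irrefl _ h4
    have h8 := orientDet_pos_of_compatible hI (e := e) (f := f)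
      (hLeg.linearIndependent_fst c.lower.2 hf.1 hfi)
      (fun i j => hlag1.2 _ (Submodule.mem_map_of_mem (hf.1 i)) _
        (Submodule.mem_map_of_mem (hf.1 j))) hadet (fun i => by
          rw [ha, Prod.fst_sum]
          exact Finset.sum_congr rfl fun k _ => by rw [Prod.smul_fst, hef']) hR
    have h9 := mul_pos h4 h8
    have h10 : ((ν.negOnePow : ℤ) : ℝ) * a.det * ((-1) ^ (n * (n - 1) / 2 + n) * a.det *
        orientDet (Fin.cons (R • reebField) (Fin.append e f))) =
        (-1) ^ (n * (n - 1) / 2 + n) * ((ν.negOnePow : ℤ) : ℝ) *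
          orientDet (Fin.cons (R • reebField) (Fin.append e f)) * a.det ^ 2 := by ring
    rw [h10] at h9
    exact (pos_iff_pos_of_mul_pos h9).2 (by positivity)

end LegendrianTB

end

theorem proposition3p3 (n : ℕ) (hn : 1 ≤ n) (L : Set (Space n)) (hLeg : IsLegendrian L)
    (hcomp : IsCompact L) (hconn : IsConnected L) (hor : IsOrientable L)
    (hgen : IsChordGeneric L) (γ : ∀ c : ReebChord L, Path c.upper c.lower) :
    Finite (ReebChord L) ∧
      ∃ ν : ReebChord L → ℤ,
        (∀ (c : ReebChord L) (m : ℤ), HasConleyZehnderIndex c (γ c) m ↔ m = ν c) ∧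
        HasThurstonBennequin L
          (((((n : ℤ) - 2) * ((n : ℤ) - 1) / 2).negOnePow : ℤ) *
            ∑ᶠ c : ReebChord L, ((ν c - 1).negOnePow : ℤ)) := by
  have hfin := hgen.finite_reebChord
  choose ν hν hsign using fun c => exists_conleyZehnderIndex hLeg hor hgen c (γ c)
  refine ⟨hfin, ν, hν, hor, fun τ hτ => ?_⟩
  rw [mul_finsum]
  have h1 := eventually_hasLinkingNumber hcomp hfin (τ := τ)
    (δ := fun c => ((((n : ℤ) - 2) * ((n : ℤ) - 1) / 2).negOnePow : ℤ) *
      ((ν c - 1).negOnePow : ℤ)) (fun c => ?_) fun c R hR e f he hf => ?_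
  · filter_upwards [h1] with ε hε m
    refine ⟨fun hm => ?_, fun hm => hm ▸ hε⟩
    exact HasLinkingNumber.unique hn hLeg.submanifold hcomp hτ (hLeg.submanifold.pushOff ε)
      (isCompact_pushOff hcomp ε) (hτ.pushOff ε) hm hε
  · rw [← Units.val_mul, ← Int.negOnePow_add]
    rcases Int.units_eq_one_or
      ((((n : ℤ) - 2) * ((n : ℤ) - 1) / 2 + (ν c - 1)).negOnePow) with h | h <;> simp [h]
  · rw [negOnePow_chord]
    exact hsign c τ hτ R hR e f he hf
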